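/- **Proposition (Statistical preconditioning: non-isotropic results).** *Setting.* Let $d,n,N\ge 1$ be integers and let $\Sigma\in\mathbb R^{d\times d}$ be symmetric positive definite with eigenvalues $\sigma_1^2\ge\dots\ge\sigma_d^2>0$. For an integer $r\ge1$ put $d_{\rm eff}(r)=\sum_{i=1}^d(\sigma_i/\sigma_1)^{2/r}$. A random vector $a$ in $\mathbb R^d$ is $\Sigma$-subgaussian if $\mathbb P(|a^\top x|>t)\le 2\exp\!\big(-\tfrac{t^2}{2x^\top\Sigma x}\big)$ for all $t>0$ and all $\|x\|\le1$. Let $\ell:\mathbb R\to\mathbb R$ be convex and twice differentiable, with $\ell''$ Lipschitz with constant $\|\ell''\|_{\rm Lip}$. Let $\ell_1,\dots,\ell_n$ and $\tilde\ell_1,\dots,\tilde\ell_N$ be convex, twice differentiable functions on $\mathbb R$ with $\ell_j''=\tilde\ell_i''=\ell''$ for all $i,j$. Let $a_1,\dots,a_n$ be i.i.d. $\Sigma$-subgaussian random vectors and let $\tilde a_1,\dots,\tilde a_N$ be i.i.d. with the same law as the $a_j$ (on the same probability space; the two samples need not be independent of each other). For $\lambda>0$ let $$F(x)=\frac1n\sum_{j=1}^n\ell_j(a_j^\top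 x)+\frac\lambda2\|x\|^2,\qquad \tilde f(x)=\frac1N\sum_{i=1}^N\tilde\ell_i(\tilde a_i^\top x)+\frac\lambda2\|x\|^2,$$ and for $\mu\ge0$ let $\phi(x)=\tilde f(x)+\frac\mu2\|x\|^2$. Let $\psi$ be a convex function with convex domain ${\rm Dom}_\psi\subset\mathbb R^d$ such that $\|x\|\le R$ for all $x\in{\rm Dom}_\psi$, where $R\ge0$. With the Bregman divergence $D_g(x,y)=g(x)-g(y)-\langle\nabla g(y),x-y\rangle$, let $L_{F/\phi}$ be the smallest and $\sigma_{F/\phi}$ the largest constant such that $\sigma_{F/\phi}D_\phi(x,y)\le D_F(x,y)\le L_{F/\phi}D_\phi(x,y)$ for all $x,y\in{\rm Dom}_\psi$, and let $\kappa_{F/\phi}=L_{F/\phi}/\sigma_{F/\phi}$. Finally let $0<\delta<1$, assume $d\ge2$ or $\delta\le\frac12$, and put $$m=\min(n,N),\qquad A=R\,\sigma_1^3\|\ell''\|_{\rm Lip}+\sigma_1^2\,\ell''(0).$$ *Claim.* There are universal constants $C,C'>0$ and $k\in\mathbb N$ such that, with $$\mu=C\,A\left(\frac{(d_{\rm eff}(3)\ln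 d+\ln(1/\delta))\sqrt{d_{\rm eff}(1)+\ln(m/\delta)}}{m}+\frac{\sqrt{\ln(1/\delta)}+\sqrt{d_{\rm eff}(1)\ln d}}{\sqrt m}\right),$$ the following two statements hold simultaneously with probability at least $1-\delta$: 1. $\displaystyle\sup_{\|x\|\le R}\big\|\nabla^2\tilde f(x)-\nabla^2F(x)\big\|_{\rm op}\le\mu$; 2. if ${\rm Dom}_\psi$ has at least two points, then, for $\phi$ built with this $\mu$, $$1\le\kappa_{F/\phi}\le1+C'\big(1+\ln d+\ln m+\ln(1/\delta)\big)^k\,\frac A\lambda\,\max\left(\sqrt{\frac{d_{\rm eff}(1)}m},\ \frac{\sqrt{d_{\rm eff}(1)}\,d_{\rm eff}(3)}m\right),$$ that is, $\kappa_{F/\phi}=1+\tilde O\Big(\frac A\lambda\max\big(\sqrt{d_{\rm eff}(1)/m},\,\sqrt{d_{\rm eff}(1)}\,d_{\rm eff}(3)/m\big)\Big)$ with logarithmic factors in $d,m,\delta^{-1}$ hidden. When $\ell''(0)=0$ and $N\ge n$, one has $m=n$ and $A=R\sigma_1^3\|\ell''\|_{\rm Lip}$. -/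

import Mathlib

open MeasureTheory ProbabilityTheory
open scoped NNReal Matrix

noncomputable section

namespace StatPrecond

/-- The Euclidean space `ℝ^d`. -/
abbrev Vec (d : ℕ) := EuclideanSpace ℝ (Fin d)

/-- A random vector `a` is `S`-subgaussian: for all `t > 0` and all `x` in the unit ball,
`P(|aᵀx| > t) ≤ 2 exp(- t² / (2 xᵀ S x))`. -/
def IsSubgaussianVec {Ω : Type*} [MeasurableSpace Ω] (P : Measure Ω) {d : ℕ}
    (S : Matrix (Fin d) (Fin d) ℝ) (a : Ω → Vec d) : Prop :=
  ∀ t : ℝ, 0 < t → ∀ x : Vec d, ‖x‖ ≤ 1 →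
    P.real {ω | t < |inner ℝ (a ω) x|} ≤
      2 * Real.exp (-(1 / 2) * (t ^ 2 / (x.ofLp ⬝ᵥ (S *ᵥ x.ofLp))))

/-- `σ₁`, the square root of the largest eigenvalue of `S`. -/
def sigmaOne {d : ℕ} {S : Matrix (Fin d) (Fin d) ℝ} (hS : S.IsHermitian) : ℝ :=
  √(⨆ i, hS.eigenvalues i)

/-- The effective dimension `d_eff(r) = ∑ i, (σ_i / σ₁) ^ (2 / r)`, where the `σ_i ^ 2` are the
eigenvalues of `S`, counted with multiplicity. -/
def effDim {d : ℕ} {S : Matrix (Fin d) (Fin d) ℝ} (hS : S.IsHermitian) (r : ℕ) : ℝ :=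
  ∑ i, (√(hS.eigenvalues i) / sigmaOne hS) ^ ((2 : ℝ) / r)

/-- The empirical risk structure: `ℓ` is convex and twice differentiable with `L`-Lipschitz second
derivative, the `ℓs j` are convex, twice differentiable, with the same second derivative as `ℓ`,
and the `a j` are i.i.d. `S`-subgaussian random vectors. -/
structure IsEmpiricalRiskModel {Ω : Type*} [MeasurableSpace Ω] (P : Measure Ω) {d n : ℕ}
    (S : Matrix (Fin d) (Fin d) ℝ) (ℓ : ℝ → ℝ) (L : ℝ≥0)
    (ℓs : Fin n → ℝ → ℝ) (a : Fin n → Ω → Vec d) : Prop where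
  convex_loss : ConvexOn ℝ Set.univ ℓ
  differentiable_loss : Differentiable ℝ ℓ
  differentiable_deriv_loss : Differentiable ℝ (deriv ℓ)
  lipschitz_deriv2_loss : LipschitzWith L (deriv (deriv ℓ))
  convex_losses : ∀ j, ConvexOn ℝ Set.univ (ℓs j)
  differentiable_losses : ∀ j, Differentiable ℝ (ℓs j)
  differentiable_deriv_losses : ∀ j, Differentiable ℝ (deriv (ℓs j))
  deriv2_losses : ∀ j t, deriv (deriv (ℓs j)) t = deriv (deriv ℓ) t
  measurable_sample : ∀ j, Measurable (a j)
  indep_sample : iIndepFun a P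
  identDistrib_sample : ∀ i j, IdentDistrib (a i) (a j) P P
  subgaussian_sample : ∀ j, IsSubgaussianVec P S (a j)

/-- The `lam`-regularized empirical risk of the data points `v j` with losses `ℓs j`:
`x ↦ (1/n) ∑ j, ℓs j (v jᵀ x) + (lam/2) ‖x‖²`. -/
def regRisk {d n : ℕ} (ℓs : Fin n → ℝ → ℝ) (v : Fin n → Vec d) (lam : ℝ) (x : Vec d) : ℝ :=
  (1 / (n : ℝ)) * ∑ j, ℓs j (inner ℝ (v j) x) + lam / 2 * ‖x‖ ^ 2

/-- The Hessian of `g` at `x`, as a linear operator: the derivative of the gradient. The norm on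
`Vec d →L[ℝ] Vec d` is the operator norm. -/
def hess {d : ℕ} (g : Vec d → ℝ) (x : Vec d) : Vec d →L[ℝ] Vec d :=
  fderiv ℝ (fun y => gradient g y) x

/-- The Bregman divergence `D_g(x, y) = g x - g y - ⟨∇g(y), x - y⟩`. -/
def bregman {d : ℕ} (g : Vec d → ℝ) (x y : Vec d) : ℝ :=
  g x - g y - inner ℝ (gradient g y) (x - y)

/-- `L_{F/φ}` on `D`: the least `M` such that `D_F ≤ M D_φ` on `D × D`. -/
def relSmoothConst {d : ℕ} (D : Set (Vec d)) (F φ : Vec d → ℝ) : ℝ :=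
  sInf {M : ℝ | ∀ x ∈ D, ∀ y ∈ D, bregman F x y ≤ M * bregman φ x y}

/-- `σ_{F/φ}` on `D`: the largest `s` such that `s D_φ ≤ D_F` on `D × D`. -/
def relStrongConvConst {d : ℕ} (D : Set (Vec d)) (F φ : Vec d → ℝ) : ℝ :=
  sSup {s : ℝ | ∀ x ∈ D, ∀ y ∈ D, s * bregman φ x y ≤ bregman F x y}

/-- The relative condition number `κ_{F/φ} = L_{F/φ} / σ_{F/φ}` on `D`. -/
def relCondNumber {d : ℕ} (D : Set (Vec d)) (F φ : Vec d → ℝ) : ℝ :=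
  relSmoothConst D F φ / relStrongConvConst D F φ

/-- The scale `R σ₁³ L + σ₁² c` of the Hessian deviation, where `L` is the Lipschitz constant of
`ℓ''` and `c = ℓ''(0)`. -/
def devScale (R s L c : ℝ) : ℝ := R * s ^ 3 * L + s ^ 2 * c

/-- The rate of the Hessian deviation in ambient dimension `d` with `m` samples at confidence
`1 - δ`, where `d₁ = d_eff(1)` and `d₃ = d_eff(3)`. -/
def devRate (d : ℕ) (d₁ d₃ m δ : ℝ) : ℝ :=
  (d₃ * Real.log d + Real.log (1 / δ)) * √(d₁ + Real.log (m / δ)) / m +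
    (√(Real.log (1 / δ)) + √(d₁ * Real.log d)) / √m

end StatPrecond

end

/-!
Write `g = ℓ''`. The Hessians of `F` and `f̃` differ by the difference of the empirical means of
`a ↦ g(aᵀx) aaᵀ` over the two samples, so it is enough to bound, for each sample, the deviation of
`n⁻¹ ∑ g(aⱼᵀx) (aⱼᵀu)²` from its expectation, uniformly over `‖x‖ ≤ R` and `‖u‖ ≤ 1`. Rotating to
the eigenbasis of `Σ` and rescaling reduces this to unit balls, a `1`-Lipschitz `g` with
`|g 0| ≤ 1` and the diagonal variance proxy `(σᵢ/σ₁)²`; the factor `A` is what the rescaling costs.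

The terms are cubic in the data and have no exponential moments, so data points of norm larger
than `M ~ √(d_eff(1) + ln(n/δ))` are discarded: with high probability none occurs in the sample,
and Cauchy-Schwarz bounds what the expectation loses. A truncated increment between `(x, u)` and
`(x', u')` at distance `ρ` in the norm of the proxy is dominated both by `ρ M` times a quadratic
gauge of the data and by `ρ` times its power `3/2`. This yields Bernstein moments of variance `ρ²`
and scale `ρ M`, and chaining over nets of mesh `2⁻ᵏ` gives the rate. Its subgaussian part is the
sum of `2⁻ᵏ √(entropy at 2⁻ᵏ)`, of order `√(d_eff(1) ln d)`; its subexponential part is the sum of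
`2⁻ᵏ (entropy at 2⁻ᵏ)`, of order `d_eff(3)` because the entropy at scale `ε` is at most a multiple
of `∑ (σᵢ/(σ₁ ε))^(2/3)`.

On the event `‖∇²f̃ - ∇²F‖ ≤ μ` one has `∇²F ≤ ∇²φ ≤ (1 + 2μ/λ) ∇²F`, since `∇²F ≥ λ`. Along
segments these inequalities integrate to Bregman divergences and give `κ ≤ 1 + 2μ/λ`.
-/

namespace StatPrecond

section ExponentialMoments

variable {α : Type*} [MeasurableSpace α] {ν : Measure α}

theorem integrable_and_integral_le_of_lintegral_ofReal_le {f : α → ℝ}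
    (hf : AEStronglyMeasurable f ν) (hf0 : ∀ a, 0 ≤ f a) {c : ℝ} (hc : 0 ≤ c)
    (h : ∫⁻ a, ENNReal.ofReal (f a) ∂ν ≤ ENNReal.ofReal c) :
    Integrable f ν ∧ ∫ a, f a ∂ν ≤ c := by
  refine ⟨(lintegral_ofReal_ne_top_iff_integrable hf (ae_of_all _ hf0)).1
    (h.trans_lt ENNReal.ofReal_lt_top).ne, ?_⟩
  rw [integral_eq_lintegral_of_nonneg_ae (ae_of_all _ hf0) hf]
  exact ENNReal.toReal_le_of_le_ofReal hc h

theorem lintegral_Ioi_one_two_mul_rpow_neg_two :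
    ∫⁻ t in Set.Ioi (1 : ℝ), ENNReal.ofReal (2 * t ^ (-2 : ℝ)) = 2 := by
  rw [← ofReal_integral_eq_lintegral_ofReal
    ((integrableOn_Ioi_rpow_of_lt (by norm_num) one_pos).const_mul 2)
    ((ae_restrict_iff' measurableSet_Ioi).2 (ae_of_all _ fun t ht => ?_)),
    integral_const_mul, integral_Ioi_rpow_of_lt (by norm_num) one_pos]
  · norm_num
  · have : (0 : ℝ) < t := one_pos.trans ht
    positivity

theorem measure_lt_exp_sq_le_of_tail {f : α → ℝ}
    (h : ∀ t : ℝ, 0 < t → ν {a | t < |f a|} ≤ ENNReal.ofReal (2 * Real.exp (-(t ^ 2 / 2))))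
    {t : ℝ} (ht : 1 < t) :
    ν {a | t < Real.exp (f a ^ 2 / 4)} ≤ ENNReal.ofReal (2 * t ^ (-2 : ℝ)) := by
  have ht0 : 0 < t := one_pos.trans ht
  have hlog : 0 < Real.log t := Real.log_pos ht
  have hsub : {a | t < Real.exp (f a ^ 2 / 4)} ⊆ {a | 2 * √(Real.log t) < |f a|} := by
    intro a (ha : t < Real.exp (f a ^ 2 / 4))
    have hlt : Real.log t < f a ^ 2 / 4 := (Real.log_lt_iff_lt_exp ht0).2 ha
    rw [Set.mem_ofPred_eq]
    refine lt_of_pow_lt_pow_left₀ 2 (abs_nonneg _) ?_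
    rw [mul_pow, Real.sq_sqrt hlog.le, sq_abs]
    linarith
  calc ν {a | t < Real.exp (f a ^ 2 / 4)}
      ≤ ENNReal.ofReal (2 * Real.exp (-((2 * √(Real.log t)) ^ 2 / 2))) :=
        (measure_mono hsub).trans (h _ (by positivity))
    _ = ENNReal.ofReal (2 * t ^ (-2 : ℝ)) := by
        rw [mul_pow, Real.sq_sqrt hlog.le, Real.rpow_def_of_pos ht0]
        ring_nf

theorem lintegral_exp_sq_le_of_tail [IsProbabilityMeasure ν] {f : α → ℝ} (hf : Measurable f)
    (h : ∀ t : ℝ, 0 < t → ν {a | t < |f a|} ≤ ENNReal.ofReal (2 * Real.exp (-(t ^ 2 / 2)))) :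
    ∫⁻ a, ENNReal.ofReal (Real.exp (f a ^ 2 / 4)) ∂ν ≤ 3 := by
  rw [lintegral_eq_lintegral_meas_lt ν (ae_of_all _ fun a => (Real.exp_pos _).le) (by fun_prop),
    ← Set.Ioc_union_Ioi_eq_Ioi (zero_le_one' ℝ),
    lintegral_union measurableSet_Ioi (Set.Ioc_disjoint_Ioi le_rfl)]
  have hle_one : ∫⁻ t in Set.Ioc (0 : ℝ) 1, ν {a | t < Real.exp (f a ^ 2 / 4)} ≤ 1 :=
    calc _ ≤ ∫⁻ _ in Set.Ioc (0 : ℝ) 1, 1 := lintegral_mono fun t => prob_le_one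
      _ = 1 := by simp
  have hgt_one : ∫⁻ t in Set.Ioi (1 : ℝ), ν {a | t < Real.exp (f a ^ 2 / 4)} ≤ 2 :=
    (setLIntegral_mono (by fun_prop) fun _ ht => measure_lt_exp_sq_le_of_tail h ht).trans_eq
      lintegral_Ioi_one_two_mul_rpow_neg_two
  exact (add_le_add hle_one hgt_one).trans_eq (by norm_num)

theorem exp_le_one_add_add_sq_mul_exp_abs (y : ℝ) :
    Real.exp y ≤ 1 + y + y ^ 2 * Real.exp |y| := by
  have h := Complex.norm_exp_sub_sum_le_norm_mul_exp (y : ℂ) 2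
  simp only [Finset.sum_range_succ, Finset.sum_range_zero, pow_zero, Nat.factorial_zero,
    Nat.cast_one, div_one, zero_add, pow_one, Nat.factorial_one] at h
  rw [← Complex.ofReal_exp, ← Complex.ofReal_one, ← Complex.ofReal_add, ← Complex.ofReal_sub,
    Complex.norm_real, Complex.norm_real, Real.norm_eq_abs, Real.norm_eq_abs, sq_abs] at h
  linarith [le_abs_self (Real.exp y - (1 + y))]

end ExponentialMoments

section Bernstein

variable {α : Type*} [MeasurableSpace α] {ν : Measure α} [IsProbabilityMeasure ν] {X : α → ℝ}
  {l₀ K l : ℝ}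

theorem integrable_of_integrable_sq_mul_exp_abs (hX : Measurable X) (hl₀ : 0 ≤ l₀)
    (hint : Integrable (fun a => X a ^ 2 * Real.exp (l₀ * |X a|)) ν) : Integrable X ν := by
  refine ((integrable_const (1 : ℝ)).add hint).mono' hX.aestronglyMeasurable
    (ae_of_all _ fun a => ?_)
  have hexp : 1 ≤ Real.exp (l₀ * |X a|) := Real.one_le_exp (by positivity)
  calc ‖X a‖ ≤ 1 + X a ^ 2 * 1 := by
        rw [Real.norm_eq_abs, ← sq_abs]; nlinarith [sq_nonneg (|X a| - 1)]
    _ ≤ 1 + X a ^ 2 * Real.exp (l₀ * |X a|) := by gcongr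

theorem integrable_exp_mul_of_integrable_sq_mul_exp_abs (hX : Measurable X)
    (hint : Integrable (fun a => X a ^ 2 * Real.exp (l₀ * |X a|)) ν) (hl : |l| ≤ l₀) :
    Integrable (fun a => Real.exp (l * X a)) ν := by
  refine ((integrable_const (Real.exp l₀)).add hint).mono' (by fun_prop) (ae_of_all _ fun a => ?_)
  have hle : Real.exp (l * X a) ≤ Real.exp (l₀ * |X a|) := by
    refine Real.exp_le_exp.2 ((le_abs_self _).trans ?_)
    rw [abs_mul]
    gcongr
  have hl₀ : 0 ≤ l₀ := (abs_nonneg l).trans hl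
  rw [Real.norm_eq_abs, Real.abs_exp]
  rcases le_total |X a| 1 with hX1 | hX1
  · have : Real.exp (l₀ * |X a|) ≤ Real.exp l₀ :=
      Real.exp_le_exp.2 (mul_le_of_le_one_right hl₀ hX1)
    exact (hle.trans this).trans (le_add_of_nonneg_right (by positivity))
  · have : 1 ≤ X a ^ 2 := by rw [← sq_abs]; exact one_le_pow₀ hX1
    exact (hle.trans (le_mul_of_one_le_left (Real.exp_pos _).le this)).trans
      (le_add_of_nonneg_left (Real.exp_pos _).le)

theorem mgf_le_exp_add_sq_mul (hX : Measurable X)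
    (hint : Integrable (fun a => X a ^ 2 * Real.exp (l₀ * |X a|)) ν)
    (hK : ∫ a, X a ^ 2 * Real.exp (l₀ * |X a|) ∂ν ≤ K) (hl : |l| ≤ l₀) :
    mgf X ν l ≤ Real.exp (l * ∫ a, X a ∂ν + l ^ 2 * K) := by
  have hlX : Integrable (fun a => l * X a) ν :=
    (integrable_of_integrable_sq_mul_exp_abs hX ((abs_nonneg l).trans hl) hint).const_mul l
  have hlin : Integrable (fun a => 1 + l * X a) ν := (integrable_const _).add hlX
  have hpoint (a : α) :
      Real.exp (l * X a) ≤ 1 + l * X a + l ^ 2 * (X a ^ 2 * Real.exp (l₀ * |X a|)) := by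
    have hle : |l * X a| ≤ l₀ * |X a| := by rw [abs_mul]; gcongr
    calc Real.exp (l * X a) ≤ 1 + l * X a + (l * X a) ^ 2 * Real.exp |l * X a| :=
          exp_le_one_add_add_sq_mul_exp_abs _
      _ ≤ 1 + l * X a + (l * X a) ^ 2 * Real.exp (l₀ * |X a|) := by gcongr
      _ = _ := by ring
  calc mgf X ν l
      ≤ ∫ a, (1 + l * X a + l ^ 2 * (X a ^ 2 * Real.exp (l₀ * |X a|))) ∂ν :=
        integral_mono (integrable_exp_mul_of_integrable_sq_mul_exp_abs hX hint hl)
          (hlin.add (hint.const_mul _)) hpoint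
    _ = 1 + l * ∫ a, X a ∂ν + l ^ 2 * ∫ a, X a ^ 2 * Real.exp (l₀ * |X a|) ∂ν := by
        rw [integral_add hlin (hint.const_mul _), integral_add (integrable_const _) hlX,
          integral_const_mul, integral_const_mul]
        simp
    _ ≤ (l * ∫ a, X a ∂ν + l ^ 2 * K) + 1 := by
        have := mul_le_mul_of_nonneg_left hK (sq_nonneg l)
        linarith
    _ ≤ Real.exp (l * ∫ a, X a ∂ν + l ^ 2 * K) := Real.add_one_le_exp _

variable {Ω : Type*} [MeasurableSpace Ω] {P : Measure Ω} {n : ℕ} {Y : Fin n → Ω → α}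

theorem measureReal_le_mean_sub_integral_le_exp (hn : 0 < n) (hY : ∀ j, Measurable (Y j))
    (hind : iIndepFun Y P) (hlaw : ∀ j, P.map (Y j) = ν) (hX : Measurable X)
    (hint : Integrable (fun a => X a ^ 2 * Real.exp (l₀ * |X a|)) ν)
    (hK : ∫ a, X a ^ 2 * Real.exp (l₀ * |X a|) ∂ν ≤ K) (hl0 : 0 ≤ l) (hl : l ≤ l₀) (t : ℝ) :
    P.real {ω | t ≤ 1 / (n : ℝ) * ∑ j, X (Y j ω) - ∫ a, X a ∂ν}
      ≤ Real.exp (n * (l ^ 2 * K - l * t)) := by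
  have := hind.isProbabilityMeasure
  have hn0 : (0 : ℝ) < n := by exact_mod_cast hn
  set e := ∫ a, X a ∂ν
  have hl' : |l| ≤ l₀ := by rwa [abs_of_nonneg hl0]
  have hZm (j : Fin n) : Measurable (X ∘ Y j) := hX.comp (hY j)
  have hZ : iIndepFun (fun j => X ∘ Y j) P := hind.comp (fun _ => X) fun _ => hX
  have hZint (j : Fin n) : Integrable (fun ω => Real.exp (l * (X ∘ Y j) ω)) P := by
    have := integrable_exp_mul_of_integrable_sq_mul_exp_abs hX hint hl'
    rw [← hlaw j] at this
    exact this.comp_measurable (hY j)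
  have hZmgf (j : Fin n) : mgf (X ∘ Y j) P l ≤ Real.exp (l * e + l ^ 2 * K) := by
    rw [← mgf_map (hY j).aemeasurable (by fun_prop), hlaw j]
    exact mgf_le_exp_add_sq_mul hX hint hK hl'
  have hset : {ω | t ≤ 1 / (n : ℝ) * ∑ j, X (Y j ω) - e}
      = {ω | n * (t + e) ≤ (∑ j, X ∘ Y j) ω} := by
    ext ω
    simp only [Set.mem_ofPred_eq, Finset.sum_apply, Function.comp_apply]
    rw [le_sub_iff_add_le, one_div, ← div_eq_inv_mul, le_div_iff₀' hn0]
  calc P.real {ω | t ≤ 1 / (n : ℝ) * ∑ j, X (Y j ω) - e}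
      ≤ Real.exp (-l * (n * (t + e))) * ∏ j, mgf (X ∘ Y j) P l := by
        rw [hset, ← hZ.mgf_sum hZm]
        exact measure_ge_le_exp_mul_mgf _ hl0
          (hZ.integrable_exp_mul_sum hZm fun j _ => hZint j)
    _ ≤ Real.exp (-l * (n * (t + e))) * ∏ _ : Fin n, Real.exp (l * e + l ^ 2 * K) := by
        gcongr with j
        · exact fun _ _ => mgf_nonneg
        · exact hZmgf j
    _ = Real.exp (n * (l ^ 2 * K - l * t)) := by
        rw [Finset.prod_const, Finset.card_univ, Fintype.card_fin, ← Real.exp_nat_mul,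
          ← Real.exp_add]
        ring_nf

/-- The deviation of the mean of `n` samples at confidence `1 - 2 exp (-τ)` in Bernstein's
inequality, for a variable `X` with `E[X² exp (l₀ |X|)] ≤ K`. -/
noncomputable def bernsteinRadius (K l₀ n τ : ℝ) : ℝ := 2 * √(K * τ / n) + 2 * τ / (l₀ * n)

theorem exists_bernstein_parameter {n τ : ℝ} (hn : 0 < n) (hl₀ : 0 < l₀) (hK : 0 < K)
    (hτ : 0 ≤ τ) :
    ∃ l, 0 ≤ l ∧ l ≤ l₀ ∧ n * (l ^ 2 * K - l * bernsteinRadius K l₀ n τ) ≤ -τ := by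
  -- `r` minimizes the quadratic part of the exponent.
  set r := √(τ / (n * K))
  have hr0 : 0 ≤ r := Real.sqrt_nonneg _
  have hτr : n * r ^ 2 * K = τ := by rw [Real.sq_sqrt (by positivity)]; field_simp
  have hradius : n * bernsteinRadius K l₀ n τ = 2 * (n * (K * r)) + 2 * τ / l₀ := by
    have : √(K * τ / n) = K * r := by
      rw [Real.sqrt_eq_iff_mul_self_eq (by positivity) (by positivity), ← hτr]
      field_simp
    rw [bernsteinRadius, this]
    field_simp
  rcases le_total r l₀ with h | h
  · refine ⟨r, hr0, h, ?_⟩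
    have : 0 ≤ r * (2 * τ / l₀) := by positivity
    calc n * (r ^ 2 * K - r * bernsteinRadius K l₀ n τ)
        = n * r ^ 2 * K - r * (n * bernsteinRadius K l₀ n τ) := by ring
      _ = -(n * r ^ 2 * K) - r * (2 * τ / l₀) := by rw [hradius]; ring
      _ ≤ -τ := by linarith
  · refine ⟨l₀, hl₀.le, le_rfl, ?_⟩
    have hquad : n * (l₀ ^ 2 * K) ≤ τ :=
      calc n * (l₀ ^ 2 * K) ≤ n * (r ^ 2 * K) := by gcongr
        _ = τ := by rw [← hτr]; ring
    have : 0 ≤ l₀ * (2 * (n * (K * r))) := by positivity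
    calc n * (l₀ ^ 2 * K - l₀ * bernsteinRadius K l₀ n τ)
        = n * (l₀ ^ 2 * K) - l₀ * (n * bernsteinRadius K l₀ n τ) := by ring
      _ = n * (l₀ ^ 2 * K) - l₀ * (2 * (n * (K * r))) - 2 * τ := by
          rw [hradius]; field_simp; ring
      _ ≤ -τ := by linarith

theorem measure_bernsteinRadius_le_mean_sub_integral_le (hn : 0 < n) (hY : ∀ j, Measurable (Y j))
    (hind : iIndepFun Y P) (hlaw : ∀ j, P.map (Y j) = ν) (hX : Measurable X) (hl₀ : 0 < l₀)
    (hK0 : 0 < K) (hint : Integrable (fun a => X a ^ 2 * Real.exp (l₀ * |X a|)) ν)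
    (hK : ∫ a, X a ^ 2 * Real.exp (l₀ * |X a|) ∂ν ≤ K) {τ : ℝ} (hτ : 0 ≤ τ) :
    P {ω | bernsteinRadius K l₀ n τ ≤ 1 / (n : ℝ) * ∑ j, X (Y j ω) - ∫ a, X a ∂ν}
      ≤ ENNReal.ofReal (Real.exp (-τ)) := by
  have := hind.isProbabilityMeasure
  obtain ⟨l, hl0, hl, hle⟩ :=
    exists_bernstein_parameter (n := n) (by exact_mod_cast hn) hl₀ hK0 hτ
  rw [← ofReal_measureReal]
  exact ENNReal.ofReal_le_ofReal <| (measureReal_le_mean_sub_integral_le_exp hn hY hind hlaw hX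
    hint hK hl0 hl _).trans (Real.exp_le_exp.2 hle)

theorem measure_bernsteinRadius_lt_abs_mean_sub_integral_le (hn : 0 < n)
    (hY : ∀ j, Measurable (Y j)) (hind : iIndepFun Y P) (hlaw : ∀ j, P.map (Y j) = ν)
    (hX : Measurable X) (hl₀ : 0 < l₀) (hK0 : 0 < K)
    (hint : Integrable (fun a => X a ^ 2 * Real.exp (l₀ * |X a|)) ν)
    (hK : ∫ a, X a ^ 2 * Real.exp (l₀ * |X a|) ∂ν ≤ K) {τ : ℝ} (hτ : 0 ≤ τ) :
    P {ω | bernsteinRadius K l₀ n τ < |1 / (n : ℝ) * ∑ j, X (Y j ω) - ∫ a, X a ∂ν|}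
      ≤ ENNReal.ofReal (2 * Real.exp (-τ)) := by
  have hpos := measure_bernsteinRadius_le_mean_sub_integral_le hn hY hind hlaw hX hl₀ hK0
    hint hK hτ
  have hneg := measure_bernsteinRadius_le_mean_sub_integral_le hn hY hind hlaw hX.neg hl₀ hK0
    (by simpa using hint) (by simpa using hK) hτ
  rw [two_mul (Real.exp (-τ)), ENNReal.ofReal_add (Real.exp_pos _).le (Real.exp_pos _).le]
  refine (measure_mono fun ω hω => ?_).trans
    ((measure_union_le _ _).trans (add_le_add hpos hneg))
  simp only [Set.mem_ofPred_eq, Set.mem_union, Pi.neg_apply, Finset.sum_neg_distrib,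
    integral_neg] at hω ⊢
  rcases lt_abs.1 hω with h | h
  · exact Or.inl h.le
  · right; linarith

end Bernstein

section SubgaussianDiag

variable {ι : Type*} [Fintype ι]

/-- The quadratic form `∑ i, s i ^ 2 * w i ^ 2` on Euclidean space, whose unit ball is the ellipsoid
with semi-axes `(s i)⁻¹`. -/
def diagForm (s : ι → ℝ) (w : EuclideanSpace ℝ ι) : ℝ := ∑ i, s i ^ 2 * w i ^ 2

/-- The law `ν` is subgaussian with variance proxy `diagForm s`, expressed through exponential
moments. The variable `q` replaces `√(diagForm s w)`, which would be a zero denominator at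
`w = 0`. -/
def HasSubgaussianDiag (ν : Measure (EuclideanSpace ℝ ι)) (s : ι → ℝ) : Prop :=
  ∀ (w : EuclideanSpace ℝ ι) (q : ℝ), 0 < q → diagForm s w ≤ q ^ 2 →
    ∫⁻ a, ENNReal.ofReal (Real.exp ((inner ℝ a w / q) ^ 2 / 4)) ∂ν ≤ 3

theorem diagForm_pos {s : ι → ℝ} (hs : ∀ i, 0 < s i) {w : EuclideanSpace ℝ ι} (hw : w ≠ 0) :
    0 < diagForm s w := by
  obtain ⟨i, hi⟩ : ∃ i, w i ≠ 0 := by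
    by_contra! h
    exact hw (by ext i; simpa using h i)
  have := hs i
  exact Finset.sum_pos' (fun _ _ => by positivity) ⟨i, Finset.mem_univ _, by positivity⟩

theorem diagForm_le_norm_sq {s : ι → ℝ} (hs : ∀ i, 0 ≤ s i) (hs1 : ∀ i, s i ≤ 1)
    (w : EuclideanSpace ℝ ι) : diagForm s w ≤ ‖w‖ ^ 2 := by
  rw [EuclideanSpace.real_norm_sq_eq]
  exact Finset.sum_le_sum fun i _ =>
    mul_le_of_le_one_left (sq_nonneg _) (pow_le_one₀ (hs i) (hs1 i))

theorem lintegral_exp_mul_sq_gaussianReal_le {b : ℝ} (hb0 : 0 ≤ b) (hb : b ≤ 1 / 4) :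
    ∫⁻ x, ENNReal.ofReal (Real.exp (b * x ^ 2)) ∂(gaussianReal 0 1)
      ≤ ENNReal.ofReal (Real.exp (2 * b)) := by
  have hpos : 0 < 1 / 2 - b := by linarith
  have hdensity (x : ℝ) : (gaussianPDF 0 1 * fun x => ENNReal.ofReal (Real.exp (b * x ^ 2))) x
      = ENNReal.ofReal ((√(2 * Real.pi))⁻¹ * Real.exp (-(1 / 2 - b) * x ^ 2)) := by
    simp only [Pi.mul_apply, gaussianPDF, gaussianPDFReal, NNReal.coe_one, mul_one, sub_zero]
    rw [← ENNReal.ofReal_mul (by positivity), mul_assoc, ← Real.exp_add]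
    ring_nf
  have hsqrt : (√(2 * Real.pi))⁻¹ * √(Real.pi / (1 / 2 - b)) = √((1 - 2 * b)⁻¹) := by
    rw [← Real.sqrt_inv, ← Real.sqrt_mul (by positivity)]
    congr 1
    field_simp
  have hinv : (1 - 2 * b)⁻¹ ≤ Real.exp (2 * b) ^ 2 :=
    calc (1 - 2 * b)⁻¹ ≤ 4 * b + 1 := by
          rw [inv_le_iff_one_le_mul₀ (by linarith)]
          nlinarith
      _ ≤ Real.exp (4 * b) := Real.add_one_le_exp _
      _ = Real.exp (2 * b) ^ 2 := by rw [← Real.exp_nat_mul]; push_cast; ring_nf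
  rw [gaussianReal_of_var_ne_zero 0 one_ne_zero,
    lintegral_withDensity_eq_lintegral_mul _ (measurable_gaussianPDF 0 1) (by fun_prop)]
  simp_rw [hdensity]
  rw [← ofReal_integral_eq_lintegral_ofReal ((integrable_exp_neg_mul_sq hpos).const_mul _)
    (ae_of_all _ fun x => by positivity), integral_const_mul, integral_gaussian, hsqrt]
  exact ENNReal.ofReal_le_ofReal ((Real.sqrt_le_left (Real.exp_pos _).le).2 hinv)

theorem lintegral_exp_mul_gaussianReal (c : ℝ) :
    ∫⁻ x, ENNReal.ofReal (Real.exp (c * x)) ∂(gaussianReal 0 1)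
      = ENNReal.ofReal (Real.exp (c ^ 2 / 2)) := by
  have hmgf := congrFun (mgf_fun_id_gaussianReal (μ := 0) (v := 1)) c
  rw [← ofReal_integral_eq_lintegral_ofReal (integrable_exp_mul_gaussianReal c)
    (ae_of_all _ fun x => (Real.exp_pos _).le), ← mgf, hmgf]
  simp

theorem lintegral_pi_gaussianReal_exp_sum {f : ι → ℝ → ℝ} (hf : ∀ i, Measurable (f i)) :
    ∫⁻ g, ENNReal.ofReal (Real.exp (∑ i, f i (g i))) ∂(Measure.pi fun _ : ι => gaussianReal 0 1)
      = ∏ i, ∫⁻ x, ENNReal.ofReal (Real.exp (f i x)) ∂(gaussianReal 0 1) := by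
  have hind := iIndepFun_pi (Ω := fun _ : ι => ℝ) (μ := fun _ : ι => gaussianReal 0 1)
    (X := fun i x => ENNReal.ofReal (Real.exp (f i x))) (fun i => by fun_prop)
  simp_rw [Real.exp_sum, ENNReal.ofReal_prod_of_nonneg fun _ _ => (Real.exp_pos _).le]
  rw [lintegral_prod_eq_prod_lintegral_of_indepFun Finset.univ _ hind (fun i => by fun_prop)]
  exact Finset.prod_congr rfl fun i _ =>
    (measurePreserving_eval (fun _ : ι => gaussianReal 0 1) i).lintegral_comp
      (f := fun x => ENNReal.ofReal (Real.exp (f i x))) (by fun_prop)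

variable {ν : Measure (EuclideanSpace ℝ ι)} [IsProbabilityMeasure ν] {s : ι → ℝ}

theorem HasSubgaussianDiag.lintegral_exp_half_inner_le (h : HasSubgaussianDiag ν s)
    (hs : ∀ i, 0 < s i) (w : EuclideanSpace ℝ ι) :
    ∫⁻ a, ENNReal.ofReal (Real.exp (1 / 2 * inner ℝ a w)) ∂ν
      ≤ 3 * ENNReal.ofReal (Real.exp (1 / 4 * diagForm s w)) := by
  rcases eq_or_ne w 0 with rfl | hw
  · simp [diagForm]
  · have hq0 := diagForm_pos hs hw
    set q := √(diagForm s w)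
    have hq : 0 < q := Real.sqrt_pos.2 hq0
    have hqsq : q ^ 2 = diagForm s w := Real.sq_sqrt hq0.le
    have hamgm (a : EuclideanSpace ℝ ι) :
        1 / 2 * inner ℝ a w ≤ (inner ℝ a w / q) ^ 2 / 4 + 1 / 4 * q ^ 2 := by
      have : inner ℝ a w = inner ℝ a w / q * q := (div_mul_cancel₀ _ hq.ne').symm
      linarith [sq_nonneg (inner ℝ a w / q - q)]
    calc _ ≤ ∫⁻ a, ENNReal.ofReal (Real.exp ((inner ℝ a w / q) ^ 2 / 4))
          * ENNReal.ofReal (Real.exp (1 / 4 * q ^ 2)) ∂ν := by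
          refine lintegral_mono fun a => ?_
          rw [← ENNReal.ofReal_mul (Real.exp_pos _).le, ← Real.exp_add]
          exact ENNReal.ofReal_le_ofReal (Real.exp_le_exp.2 (hamgm a))
      _ = (∫⁻ a, ENNReal.ofReal (Real.exp ((inner ℝ a w / q) ^ 2 / 4)) ∂ν)
          * ENNReal.ofReal (Real.exp (1 / 4 * q ^ 2)) := lintegral_mul_const _ (by fun_prop)
      _ ≤ _ := by rw [hqsq]; gcongr; exact h w q hq hqsq.ge

theorem exp_norm_sq_div_eight_eq_lintegral (a : EuclideanSpace ℝ ι) :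
    ENNReal.ofReal (Real.exp (‖a‖ ^ 2 / 8))
      = ∫⁻ g, ENNReal.ofReal (Real.exp (1 / 2 * inner ℝ a (WithLp.toLp 2 g)))
        ∂(Measure.pi fun _ : ι => gaussianReal 0 1) := by
  have hsum := lintegral_pi_gaussianReal_exp_sum (f := fun i x => (1 / 2 * a i) * x)
    (fun i => by fun_prop)
  have hinner (g : ι → ℝ) :
      1 / 2 * inner ℝ a (WithLp.toLp 2 g) = ∑ i, (1 / 2 * a i) * g i := by
    simp [PiLp.inner_apply, Finset.mul_sum, mul_comm, mul_left_comm]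
  simp_rw [hinner]
  rw [hsum]
  simp_rw [lintegral_exp_mul_gaussianReal]
  rw [← ENNReal.ofReal_prod_of_nonneg fun _ _ => (Real.exp_pos _).le, ← Real.exp_sum,
    EuclideanSpace.real_norm_sq_eq, Finset.sum_div]
  ring_nf

theorem lintegral_exp_diagForm_pi_gaussianReal_le (hs : ∀ i, 0 ≤ s i) (hs1 : ∀ i, s i ≤ 1) :
    ∫⁻ g, ENNReal.ofReal (Real.exp (1 / 4 * diagForm s (WithLp.toLp 2 g)))
        ∂(Measure.pi fun _ : ι => gaussianReal 0 1)
      ≤ ENNReal.ofReal (Real.exp ((∑ i, s i ^ 2) / 2)) := by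
  have hsum := lintegral_pi_gaussianReal_exp_sum (f := fun i x => (1 / 4 * s i ^ 2) * x ^ 2)
    (fun i => by fun_prop)
  have hform (g : ι → ℝ) :
      1 / 4 * diagForm s (WithLp.toLp 2 g) = ∑ i, (1 / 4 * s i ^ 2) * g i ^ 2 := by
    simp [diagForm, Finset.mul_sum, mul_assoc]
  simp_rw [hform]
  calc _ = _ := hsum
    _ ≤ ∏ i, ENNReal.ofReal (Real.exp (2 * (1 / 4 * s i ^ 2))) := by
        gcongr with i
        refine lintegral_exp_mul_sq_gaussianReal_le (by positivity) ?_
        linarith [pow_le_one₀ (n := 2) (hs i) (hs1 i)]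
    _ = _ := by
        rw [← ENNReal.ofReal_prod_of_nonneg fun _ _ => (Real.exp_pos _).le, ← Real.exp_sum,
          Finset.sum_div]
        ring_nf

/-- Writing `exp (‖a‖² / 8)` as a Gaussian average of exponentials of linear forms reduces its
moment to the one-dimensional marginals of `ν`. -/
theorem HasSubgaussianDiag.lintegral_exp_norm_sq_le (h : HasSubgaussianDiag ν s)
    (hs : ∀ i, 0 < s i) (hs1 : ∀ i, s i ≤ 1) :
    ∫⁻ a, ENNReal.ofReal (Real.exp (‖a‖ ^ 2 / 8)) ∂ν
      ≤ 3 * ENNReal.ofReal (Real.exp ((∑ i, s i ^ 2) / 2)) := by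
  simp_rw [exp_norm_sq_div_eight_eq_lintegral]
  rw [lintegral_lintegral_swap (by fun_prop)]
  calc _ ≤ ∫⁻ g, 3 * ENNReal.ofReal (Real.exp (1 / 4 * diagForm s (WithLp.toLp 2 g)))
        ∂(Measure.pi fun _ : ι => gaussianReal 0 1) :=
        lintegral_mono fun g => h.lintegral_exp_half_inner_le hs _
    _ = 3 * ∫⁻ g, ENNReal.ofReal (Real.exp (1 / 4 * diagForm s (WithLp.toLp 2 g)))
        ∂(Measure.pi fun _ : ι => gaussianReal 0 1) :=
        lintegral_const_mul _ (by unfold diagForm; fun_prop)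
    _ ≤ _ := by
        gcongr
        exact lintegral_exp_diagForm_pi_gaussianReal_le (fun i => (hs i).le) hs1

theorem HasSubgaussianDiag.measure_lt_norm_sq_le (h : HasSubgaussianDiag ν s)
    (hs : ∀ i, 0 < s i) (hs1 : ∀ i, s i ≤ 1) {η : ℝ} (hη : 0 < η) :
    ν {a | 4 * ∑ i, s i ^ 2 + 8 * Real.log (3 / η) < ‖a‖ ^ 2} ≤ ENNReal.ofReal η := by
  set T := 4 * ∑ i, s i ^ 2 + 8 * Real.log (3 / η) with hTdef
  have hT : Real.exp (T / 8) = Real.exp ((∑ i, s i ^ 2) / 2) * (3 / η) := by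
    rw [← Real.exp_log (show 0 < 3 / η by positivity), ← Real.exp_add, hTdef]
    ring_nf
  have hsub : {a : EuclideanSpace ℝ ι | T < ‖a‖ ^ 2}
      ⊆ {a | ENNReal.ofReal (Real.exp (T / 8)) ≤ ENNReal.ofReal (Real.exp (‖a‖ ^ 2 / 8))} :=
    fun a (ha : T < ‖a‖ ^ 2) =>
      ENNReal.ofReal_le_ofReal (Real.exp_le_exp.2 (by linarith))
  calc ν {a | T < ‖a‖ ^ 2}
      ≤ (∫⁻ a, ENNReal.ofReal (Real.exp (‖a‖ ^ 2 / 8)) ∂ν) / ENNReal.ofReal (Real.exp (T / 8)) :=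
        (measure_mono hsub).trans (meas_ge_le_lintegral_div (by fun_prop)
          (by simp [Real.exp_pos]) ENNReal.ofReal_ne_top)
    _ ≤ 3 * ENNReal.ofReal (Real.exp ((∑ i, s i ^ 2) / 2)) / ENNReal.ofReal (Real.exp (T / 8)) := by
        gcongr
        exact h.lintegral_exp_norm_sq_le hs hs1
    _ = ENNReal.ofReal η := by
        rw [← ENNReal.ofReal_ofNat 3, ← ENNReal.ofReal_mul (by norm_num),
          ← ENNReal.ofReal_div_of_pos (Real.exp_pos _), hT]
        congr 1
        field_simp

end SubgaussianDiag

theorem exists_int_abs_le_abs_sub_le_one (y : ℝ) : ∃ z : ℤ, |(z : ℝ)| ≤ |y| ∧ |y - z| ≤ 1 := by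
  rcases le_total 0 y with hy | hy
  · have h0 : (0 : ℝ) ≤ ⌊y⌋ := by exact_mod_cast Int.floor_nonneg.2 hy
    refine ⟨⌊y⌋, ?_, abs_le.2 ⟨?_, ?_⟩⟩
    · rw [abs_of_nonneg h0, abs_of_nonneg hy]
      exact Int.floor_le y
    all_goals linarith [Int.floor_le y, Int.lt_floor_add_one y]
  · have h0 : ((⌈y⌉ : ℤ) : ℝ) ≤ 0 := by exact_mod_cast Int.ceil_nonpos.2 hy
    refine ⟨⌈y⌉, ?_, abs_le.2 ⟨?_, ?_⟩⟩
    · rw [abs_of_nonpos h0, abs_of_nonpos hy]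
      exact neg_le_neg (Int.le_ceil y)
    all_goals linarith [Int.le_ceil y, Int.ceil_lt_add_one y]

theorem sum_Icc_exp_neg_abs_div_le {r : ℝ} (hr : 0 < r) (B : ℕ) :
    ∑ z ∈ Finset.Icc (-(B : ℤ)) B, Real.exp (-(|(z : ℝ)| / r)) ≤ 1 + 2 * r := by
  suffices h : ∑ z ∈ Finset.Icc (-(B : ℤ)) B, Real.exp (-(|(z : ℝ)| / r))
      ≤ 1 + 2 * r * (1 - Real.exp (-(B / r))) by
    nlinarith [Real.exp_pos (-(B / r))]
  induction B with
  | zero => simp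
  | succ B ih =>
    have hIcc : Finset.Icc (-((B + 1 : ℕ) : ℤ)) ((B + 1 : ℕ) : ℤ)
        = insert (-((B : ℤ) + 1)) (insert ((B : ℤ) + 1) (Finset.Icc (-(B : ℤ)) B)) := by
      ext z
      simp only [Finset.mem_Icc, Finset.mem_insert]
      omega
    rw [hIcc, Finset.sum_insert (by simp only [Finset.mem_insert, Finset.mem_Icc]; omega),
      Finset.sum_insert (by simp)]
    set E := Real.exp (-(((B + 1 : ℕ) : ℝ) / r)) with hE
    have hpos : |(((B : ℤ) + 1 : ℤ) : ℝ)| = (B + 1 : ℕ) := by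
      push_cast; exact abs_of_nonneg (by positivity)
    have hneg : |((-((B : ℤ) + 1) : ℤ) : ℝ)| = (B + 1 : ℕ) := by
      rw [Int.cast_neg, abs_neg, hpos]
    have hstep : Real.exp (-(B / r)) = E * Real.exp (1 / r) := by
      rw [hE, ← Real.exp_add]; congr 1; push_cast; field_simp; ring
    have hgap : 1 ≤ r * (Real.exp (1 / r) - 1) := by
      calc (1 : ℝ) = r * (1 / r) := by field_simp
        _ ≤ r * (Real.exp (1 / r) - 1) := by gcongr; linarith [Real.add_one_le_exp (1 / r)]
    rw [hpos, hneg, ← hE]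
    rw [hstep] at ih
    nlinarith [Real.exp_pos (-(((B + 1 : ℕ) : ℝ) / r))]

section Lattice

variable {ι : Type*}

/-- The integer points supported in `A` that lie in the weighted `ℓ¹` ball
`∑ i ∈ A, |z i| / r i ≤ D`. -/
def latticeBall (A : Finset ι) (r : ι → ℝ) (D : ℝ) : Set (ι → ℤ) :=
  {z | (∀ i ∉ A, z i = 0) ∧ ∑ i ∈ A, |(z i : ℝ)| / r i ≤ D}

variable {A : Finset ι} {r : ι → ℝ}

/- Chernoff counting: a point of the ball has weight `exp (D - ∑ i ∈ A, |z i| / r i) ≥ 1`, and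
the weights of all points of a box factor over the coordinates. -/
theorem card_le_of_coe_subset_latticeBall [Finite ι] {D : ℝ} (hr : ∀ i ∈ A, 0 < r i)
    {Z : Finset (ι → ℤ)} (hZ : ↑Z ⊆ latticeBall A r D) :
    (Z.card : ℝ) ≤ Real.exp D * ∏ i ∈ A, (1 + 2 * r i) := by
  classical
  cases nonempty_fintype ι
  obtain ⟨B, hB⟩ : ∃ B : ℕ, ∀ z ∈ Z, ∀ i, |z i| ≤ B := by
    refine ⟨Z.sup fun z => Finset.univ.sup fun i => (z i).natAbs, fun z hz i => ?_⟩
    rw [Int.abs_eq_natAbs, Int.ofNat_le]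
    exact (Finset.le_sup (f := fun i => (z i).natAbs) (Finset.mem_univ i)).trans
      (Finset.le_sup (f := fun z : ι → ℤ => Finset.univ.sup fun i => (z i).natAbs) hz)
  let box (i : ι) : Finset ℤ := if i ∈ A then Finset.Icc (-(B : ℤ)) B else {0}
  let w (i : ι) (t : ℤ) : ℝ := if i ∈ A then Real.exp (-(|(t : ℝ)| / r i)) else 1
  have hw (i : ι) (t : ℤ) : 0 ≤ w i t := by dsimp only [w]; split_ifs <;> positivity
  have hbox : Z ⊆ Fintype.piFinset box := fun z hz => by
    refine Fintype.mem_piFinset.2 fun i => ?_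
    by_cases hi : i ∈ A
    · simpa [box, hi] using abs_le.1 (hB z hz i)
    · simpa [box, hi] using (hZ hz).1 i hi
  calc (Z.card : ℝ) = ∑ _ ∈ Z, (1 : ℝ) := by simp
    _ ≤ ∑ z ∈ Z, Real.exp D * ∏ i, w i (z i) := by
        refine Finset.sum_le_sum fun z hz => ?_
        rw [Finset.prod_ite_mem, Finset.univ_inter, ← Real.exp_sum, ← Real.exp_add,
          Finset.sum_neg_distrib]
        exact Real.one_le_exp (by linarith [(hZ hz).2])
    _ ≤ ∑ z ∈ Fintype.piFinset box, Real.exp D * ∏ i, w i (z i) :=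
        Finset.sum_le_sum_of_subset_of_nonneg hbox fun _ _ _ =>
          mul_nonneg (Real.exp_pos _).le (Finset.prod_nonneg fun i _ => hw i _)
    _ = Real.exp D * ∏ i, ∑ t ∈ box i, w i t := by
        rw [← Finset.mul_sum, Finset.prod_univ_sum]
    _ ≤ Real.exp D * ∏ i, if i ∈ A then 1 + 2 * r i else 1 := by
        gcongr with i
        by_cases hi : i ∈ A
        · simpa only [box, w, if_pos hi] using sum_Icc_exp_neg_abs_div_le (hr i hi) B
        · simp [box, w, hi]
    _ = Real.exp D * ∏ i ∈ A, (1 + 2 * r i) := by rw [Finset.prod_ite_mem, Finset.univ_inter]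

theorem finite_latticeBall [Finite ι] (hr : ∀ i ∈ A, 0 < r i) (D : ℝ) :
    (latticeBall A r D).Finite := by
  by_contra hinf
  obtain ⟨Z, hZ, hcard⟩ := Set.Infinite.exists_subset_card_eq hinf
    (⌊Real.exp D * ∏ i ∈ A, (1 + 2 * r i)⌋₊ + 1)
  have h := card_le_of_coe_subset_latticeBall hr hZ
  rw [hcard, Nat.cast_add_one] at h
  exact (Nat.lt_floor_add_one _).not_ge h

theorem exists_int_mul_abs_le_abs_sub_le {h : ι → ℝ} (hh : ∀ i ∈ A, 0 < h i) (x : ι → ℝ) :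
    ∃ z : ι → ℤ, (∀ i ∉ A, z i = 0) ∧
      ∀ i ∈ A, h i * |(z i : ℝ)| ≤ |x i| ∧ |x i - h i * z i| ≤ h i := by
  classical
  choose f hf1 hf2 using exists_int_abs_le_abs_sub_le_one
  refine ⟨fun i => if i ∈ A then f (x i / h i) else 0, fun i hi => if_neg hi, fun i hi => ?_⟩
  have hp := hh i hi
  simp only [if_pos hi]
  constructor
  · have := hf1 (x i / h i)
    rwa [abs_div, abs_of_pos hp, le_div_iff₀' hp] at this
  · calc |x i - h i * f (x i / h i)| = h i * |x i / h i - f (x i / h i)| := by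
          rw [← abs_of_pos hp, ← abs_mul, abs_of_pos hp, mul_sub, mul_div_cancel₀ _ hp.ne']
      _ ≤ h i := mul_le_of_le_one_right hp.le (hf2 _)

variable [Fintype ι]

theorem sum_abs_le_sqrt_card_mul_norm (A : Finset ι) (x : EuclideanSpace ℝ ι) :
    ∑ i ∈ A, |x i| ≤ √(A.card : ℝ) * ‖x‖ := by
  refine abs_le_of_sq_le_sq' ?_ (by positivity) |>.2
  calc (∑ i ∈ A, |x i|) ^ 2 ≤ A.card * ∑ i ∈ A, |x i| ^ 2 := sq_sum_le_card_mul_sum_sq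
    _ ≤ A.card * ∑ i, x i ^ 2 := by
        simp_rw [sq_abs]
        gcongr
        exact Finset.subset_univ A
    _ = (√(A.card : ℝ) * ‖x‖) ^ 2 := by
        rw [mul_pow, Real.sq_sqrt (by positivity), EuclideanSpace.real_norm_sq_eq]

theorem mem_latticeBall_of_forall_mul_abs_le {s : ι → ℝ} (hs : ∀ i, 0 < s i) {ε : ℝ} (hε : 0 < ε)
    {x : EuclideanSpace ℝ ι} (hx : ‖x‖ ≤ 1) {z : ι → ℤ} (hz0 : ∀ i ∉ A, z i = 0)
    (hzx : ∀ i ∈ A, ε / (s i * √(A.card : ℝ)) * |(z i : ℝ)| ≤ |x i|) :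
    z ∈ latticeBall A (fun i => s i / ε) A.card := by
  refine ⟨hz0, ?_⟩
  calc ∑ i ∈ A, |(z i : ℝ)| / (s i / ε)
      = ∑ i ∈ A, √(A.card : ℝ) * (ε / (s i * √(A.card : ℝ)) * |(z i : ℝ)|) := by
        refine Finset.sum_congr rfl fun i hi => ?_
        have := hs i
        have : 0 < √(A.card : ℝ) := Real.sqrt_pos.2 (by exact_mod_cast Finset.card_pos.2 ⟨i, hi⟩)
        field_simp
    _ ≤ ∑ i ∈ A, √(A.card : ℝ) * |x i| := by
        gcongr with i hi
        exact hzx i hi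
    _ ≤ √(A.card : ℝ) * (√(A.card : ℝ) * 1) := by
        rw [← Finset.mul_sum]
        gcongr
        exact (sum_abs_le_sqrt_card_mul_norm A x).trans (by gcongr)
    _ = A.card := by rw [mul_one, Real.mul_self_sqrt (by positivity)]

theorem diagForm_sub_le_two_mul_sq {s : ι → ℝ} (hs : ∀ i, 0 ≤ s i) {ε : ℝ}
    (hsA : ∀ i ∉ A, s i ≤ ε) {x y : EuclideanSpace ℝ ι} (hx : ‖x‖ ≤ 1)
    (hy : ∀ i ∉ A, y i = 0) (hxy : ∀ i ∈ A, s i * |x i - y i| ≤ ε / √(A.card : ℝ)) :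
    diagForm s (x - y) ≤ 2 * ε ^ 2 := by
  classical
  have hterm (i : ι) : s i ^ 2 * (x - y) i ^ 2
      ≤ (if i ∈ A then ε ^ 2 / A.card else 0) + ε ^ 2 * x i ^ 2 := by
    rw [PiLp.sub_apply]
    by_cases hi : i ∈ A
    · have h := pow_le_pow_left₀ (mul_nonneg (hs i) (abs_nonneg _)) (hxy i hi) 2
      rw [mul_pow, sq_abs, div_pow, Real.sq_sqrt (by positivity)] at h
      rw [if_pos hi]
      nlinarith [sq_nonneg (ε * x i)]
    · rw [if_neg hi, hy i hi, sub_zero, zero_add]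
      gcongr
      · exact hs i
      · exact hsA i hi
  calc diagForm s (x - y)
      ≤ ∑ i, ((if i ∈ A then ε ^ 2 / A.card else 0) + ε ^ 2 * x i ^ 2) :=
        Finset.sum_le_sum fun i _ => hterm i
    _ = A.card * (ε ^ 2 / A.card) + ε ^ 2 * ‖x‖ ^ 2 := by
        rw [Finset.sum_add_distrib, ← Finset.mul_sum, Finset.sum_ite_mem, Finset.univ_inter,
          Finset.sum_const, nsmul_eq_mul, EuclideanSpace.real_norm_sq_eq]
    _ ≤ ε ^ 2 + ε ^ 2 * 1 := by
        gcongr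
        · rw [mul_div_left_comm]
          exact mul_le_of_le_one_right (sq_nonneg ε) (div_self_le_one _)
        · exact pow_le_one₀ (norm_nonneg x) hx
    _ = 2 * ε ^ 2 := by ring

end Lattice

section Net

variable {ι : Type*} [Fintype ι]

/-- An upper bound for the logarithm of the size of a net of the Euclidean unit ball at scale `ε` in
the norm `√(diagForm s)`: only the coordinates with `ε < s i` contribute. -/
noncomputable def entropy (s : ι → ℝ) (ε : ℝ) : ℝ :=
  ∑ i, if ε < s i then 1 + Real.log (1 + 2 * (s i / ε)) else 0

theorem exp_card_mul_prod_eq_exp_entropy {s : ι → ℝ} {ε : ℝ} (hε : 0 < ε) :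
    Real.exp (({i | ε < s i} : Finset ι).card) * ∏ i with ε < s i, (1 + 2 * (s i / ε))
      = Real.exp (entropy s ε) := by
  have hpos : ∀ i ∈ ({i | ε < s i} : Finset ι), 0 < 1 + 2 * (s i / ε) := fun i hi => by
    have := hε.trans (Finset.mem_filter.1 hi).2
    positivity
  rw [entropy, ← Finset.sum_filter, Finset.sum_add_distrib, Real.exp_add, Real.exp_sum _ (fun i =>
    Real.log _), Finset.prod_congr rfl fun i hi => Real.exp_log (hpos i hi)]
  simp

/- The mesh is `ε / (s i √|A|)` on the long axes `A = {i | ε < s i}`, and the short axes are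
collapsed. Rounding towards zero keeps the net in the unit ball, and the number of lattice points
needed is governed by an `ℓ¹` constraint. -/
theorem exists_net {s : ι → ℝ} (hs : ∀ i, 0 < s i) {ε : ℝ} (hε : 0 < ε) :
    ∃ N : Finset (EuclideanSpace ℝ ι), (N.card : ℝ) ≤ Real.exp (entropy s ε) ∧
      (∀ y ∈ N, ‖y‖ ≤ 1) ∧ ∀ x, ‖x‖ ≤ 1 → ∃ y ∈ N, diagForm s (x - y) ≤ 2 * ε ^ 2 := by
  classical
  let A : Finset ι := {i | ε < s i}
  let h (i : ι) : ℝ := ε / (s i * √(A.card : ℝ))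
  let pt (z : ι → ℤ) : EuclideanSpace ℝ ι := WithLp.toLp 2 fun i => h i * z i
  have hr : ∀ i ∈ A, 0 < s i / ε := fun i _ => div_pos (hs i) hε
  have hA : ∀ i ∈ A, 0 < √(A.card : ℝ) := fun i hi =>
    Real.sqrt_pos.2 (by exact_mod_cast Finset.card_pos.2 ⟨i, hi⟩)
  have hh : ∀ i ∈ A, 0 < h i := fun i hi => div_pos hε (mul_pos (hs i) (hA i hi))
  let Z := (finite_latticeBall hr A.card).toFinset
  refine ⟨(Z.image pt).filter fun y => ‖y‖ ≤ 1, ?_, fun y hy => (Finset.mem_filter.1 hy).2,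
    fun x hx => ?_⟩
  · have hle : ((Z.image pt).filter fun y => ‖y‖ ≤ 1).card ≤ Z.card :=
      (Finset.card_filter_le _ _).trans Finset.card_image_le
    calc _ ≤ (Z.card : ℝ) := Nat.cast_le.2 hle
      _ ≤ Real.exp A.card * ∏ i ∈ A, (1 + 2 * (s i / ε)) :=
          card_le_of_coe_subset_latticeBall hr (by simp [Z])
      _ = Real.exp (entropy s ε) := exp_card_mul_prod_eq_exp_entropy hε
  obtain ⟨z, hz0, hzA⟩ := exists_int_mul_abs_le_abs_sub_le hh x
  have hzball := mem_latticeBall_of_forall_mul_abs_le hs hε hx hz0 fun i hi => (hzA i hi).1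
  have hpt0 : ∀ i ∉ A, pt z i = 0 := fun i hi => by simp [pt, hz0 i hi]
  have hptx (i : ι) : ‖pt z i‖ ≤ ‖x i‖ := by
    by_cases hi : i ∈ A
    · simpa [pt, abs_mul, abs_of_pos (hh i hi)] using (hzA i hi).1
    · simp [hpt0 i hi]
  have hnorm : ‖pt z‖ ≤ ‖x‖ := by
    rw [EuclideanSpace.norm_eq, EuclideanSpace.norm_eq]
    gcongr with i
    exact hptx i
  refine ⟨pt z, by simpa [Z] using ⟨⟨z, hzball, rfl⟩, hnorm.trans hx⟩,
    diagForm_sub_le_two_mul_sq (fun i => (hs i).le) (fun i hi => by simpa [A] using hi) hx hpt0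
      fun i hi => ?_⟩
  calc s i * |x i - pt z i| ≤ s i * h i := by gcongr; exacts [(hs i).le, (hzA i hi).2]
    _ = ε / √(A.card : ℝ) := by
        have := hs i
        have := hA i hi
        simp only [h]
        field_simp

theorem entropy_nonneg {s : ι → ℝ} {ε : ℝ} (hε : 0 < ε) : 0 ≤ entropy s ε := by
  refine Finset.sum_nonneg fun i _ => ?_
  split_ifs with h
  · have : 0 < s i / ε := div_pos (hε.trans h) hε
    linarith [Real.log_nonneg (show (1 : ℝ) ≤ 1 + 2 * (s i / ε) by linarith)]
  · exact le_rfl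

theorem entropy_le_linear (s : ι → ℝ) {ε : ℝ} (hε : 0 < ε) :
    entropy s ε ≤ 3 * ∑ i, if ε < s i then s i / ε else 0 := by
  rw [entropy, Finset.mul_sum]
  refine Finset.sum_le_sum fun i _ => ?_
  split_ifs with h
  · have h1 : 1 < s i / ε := (one_lt_div hε).2 h
    linarith [Real.log_le_sub_one_of_pos (show (0 : ℝ) < 1 + 2 * (s i / ε) by linarith)]
  · simp

theorem one_add_log_le_rpow {r : ℝ} (hr : 1 ≤ r) :
    1 + Real.log (1 + 2 * r) ≤ 3 * r ^ (2 / 3 : ℝ) := by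
  set y := r ^ (1 / 3 : ℝ) with hy
  have hr0 : 0 ≤ r := zero_le_one.trans hr
  have hy1 : 1 ≤ y := Real.one_le_rpow hr (by norm_num)
  have hy2 : y ^ 2 = r ^ (2 / 3 : ℝ) := by
    rw [hy, ← Real.rpow_natCast, ← Real.rpow_mul hr0]; norm_num
  have hy3 : y ^ 3 = r := by
    rw [hy, ← Real.rpow_natCast, ← Real.rpow_mul hr0]; norm_num
  have hlog : Real.log (1 + 2 * r) ≤ Real.log 3 + 3 * Real.log y := by
    calc Real.log (1 + 2 * r) ≤ Real.log (3 * y ^ 3) :=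
          Real.log_le_log (by linarith) (by linarith)
      _ = Real.log 3 + 3 * Real.log y := by
          rw [Real.log_mul (by norm_num) (by positivity), Real.log_pow]; norm_num
  have hlogy := Real.log_le_sub_one_of_pos (show (0 : ℝ) < y by linarith)
  have hlog3 := Real.log_le_sub_one_of_pos (show (0 : ℝ) < 3 by norm_num)
  rw [← hy2]
  nlinarith

theorem entropy_le_rpow {s : ι → ℝ} (hs : ∀ i, 0 ≤ s i) {ε : ℝ} (hε : 0 < ε) :
    entropy s ε ≤ 3 * ∑ i, (s i / ε) ^ (2 / 3 : ℝ) := by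
  rw [entropy, Finset.mul_sum]
  refine Finset.sum_le_sum fun i _ => ?_
  split_ifs with h
  · exact one_add_log_le_rpow ((one_lt_div hε).2 h).le
  · have := hs i
    positivity

end Net

theorem sum_half_pow_lt_le (T : ℕ) {s : ℝ} (hs : 0 ≤ s) :
    ∑ k ∈ Finset.range T, (if (1 / 2 : ℝ) ^ k < s then (1 / 2 : ℝ) ^ k else 0) ≤ min (2 * s) 2 := by
  induction T generalizing s with
  | zero => simp [hs]
  | succ T ih =>
    have hshift (k : ℕ) : (if (1 / 2 : ℝ) ^ (k + 1) < s then (1 / 2 : ℝ) ^ (k + 1) else 0)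
        = 1 / 2 * (if (1 / 2 : ℝ) ^ k < 2 * s then (1 / 2 : ℝ) ^ k else 0) := by
      have hiff : (1 / 2 : ℝ) ^ (k + 1) < s ↔ (1 / 2 : ℝ) ^ k < 2 * s := by
        rw [pow_succ]; constructor <;> intro h <;> linarith
      rw [if_congr hiff rfl rfl, pow_succ', mul_ite, mul_zero]
    obtain ⟨h1, h2⟩ := le_min_iff.1 (ih (s := 2 * s) (by positivity))
    rw [Finset.sum_range_succ', Finset.sum_congr rfl fun k _ => hshift k, ← Finset.mul_sum,
      pow_zero]
    split_ifs with hc <;> apply le_min <;> linarith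

theorem geom_sum_le_inv_one_sub {r : ℝ} (hr0 : 0 ≤ r) (hr1 : r < 1) (T : ℕ) :
    ∑ k ∈ Finset.range T, r ^ k ≤ (1 - r)⁻¹ := by
  rw [← tsum_geometric_of_lt_one hr0 hr1]
  exact (summable_geometric_of_lt_one hr0 hr1).sum_le_tsum _ fun k _ => pow_nonneg hr0 k

theorem natClog_two_le_three_mul_log (d : ℕ) : (Nat.clog 2 d : ℝ) ≤ 3 * Real.log d := by
  rcases le_or_gt d 1 with hd | hd
  · rw [Nat.clog_of_right_le_one hd]
    exact_mod_cast mul_nonneg zero_le_three (Real.log_natCast_nonneg d)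
  have hpow : (2 : ℝ) ^ (Nat.clog 2 d - 1) ≤ d := by
    exact_mod_cast (Nat.pow_pred_clog_lt_self (by norm_num) hd).le
  have hlog := Real.log_le_log (by positivity) hpow
  rw [Real.log_pow, Nat.cast_sub (Nat.clog_pos (by norm_num) hd), Nat.cast_one] at hlog
  have hlog2 : Real.log 2 ≤ Real.log d := Real.log_le_log (by norm_num) (by exact_mod_cast hd)
  nlinarith [Real.log_two_gt_d9]

section Entropy

variable {ι : Type*} [Fintype ι] {s : ι → ℝ}

/- At scale `2⁻ᵏ` the entropy is at most a constant times `2 ^ (2 k / 3) * ∑ i, s i ^ (2 / 3)`, so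
that the sum is dominated by a geometric series of ratio `2 ^ (2 / 3) / 2 ≤ 4 / 5`. -/
theorem half_pow_mul_entropy_le (hs : ∀ i, 0 ≤ s i) (k : ℕ) :
    (1 / 2 : ℝ) ^ k * entropy s ((1 / 2 : ℝ) ^ (k + 1))
      ≤ (6 * ∑ i, s i ^ (2 / 3 : ℝ)) * (4 / 5) ^ k := by
  set c : ℝ := 2 ^ (2 / 3 : ℝ) with hc
  have hc0 : 0 < c := by positivity
  have hc1 : c ≤ 8 / 5 := by
    have hc3 : c ^ 3 = 4 := by
      rw [hc, ← Real.rpow_natCast, ← Real.rpow_mul (by norm_num)]; norm_num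
    refine (pow_le_pow_iff_left₀ hc0.le (by norm_num) (n := 3) (by norm_num)).1 ?_
    rw [hc3]; norm_num
  have hS : 0 ≤ ∑ i, s i ^ (2 / 3 : ℝ) := Finset.sum_nonneg fun i _ => Real.rpow_nonneg (hs i) _
  have hscale (i : ι) : (s i / (1 / 2 : ℝ) ^ (k + 1)) ^ (2 / 3 : ℝ)
      = s i ^ (2 / 3 : ℝ) * c ^ (k + 1) := by
    rw [one_div, inv_pow, div_inv_eq_mul, Real.mul_rpow (hs i) (by positivity), hc,
      ← Real.rpow_natCast, ← Real.rpow_natCast, ← Real.rpow_mul (by norm_num),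
      ← Real.rpow_mul (by norm_num), mul_comm ((k + 1 : ℕ) : ℝ)]
  have hent := entropy_le_rpow hs (show (0 : ℝ) < (1 / 2) ^ (k + 1) by positivity)
  simp_rw [hscale, ← Finset.sum_mul] at hent
  calc (1 / 2 : ℝ) ^ k * entropy s ((1 / 2 : ℝ) ^ (k + 1))
      ≤ (1 / 2 : ℝ) ^ k * (3 * ((∑ i, s i ^ (2 / 3 : ℝ)) * c ^ (k + 1))) := by gcongr
    _ = (3 * ∑ i, s i ^ (2 / 3 : ℝ)) * (c * (c / 2) ^ k) := by
        rw [div_pow, div_pow, one_pow, pow_succ]; ring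
    _ ≤ (3 * ∑ i, s i ^ (2 / 3 : ℝ)) * (2 * (4 / 5) ^ k) := by
        have hc2 : c ≤ 2 := by linarith
        have hratio : c / 2 ≤ 4 / 5 := by linarith
        gcongr
    _ = (6 * ∑ i, s i ^ (2 / 3 : ℝ)) * (4 / 5) ^ k := by ring

theorem sum_half_pow_mul_entropy_le (hs : ∀ i, 0 ≤ s i) (T : ℕ) :
    ∑ k ∈ Finset.range T, (1 / 2 : ℝ) ^ k * entropy s ((1 / 2 : ℝ) ^ (k + 1))
      ≤ 30 * ∑ i, s i ^ (2 / 3 : ℝ) := by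
  have hS : 0 ≤ ∑ i, s i ^ (2 / 3 : ℝ) := Finset.sum_nonneg fun i _ => Real.rpow_nonneg (hs i) _
  calc ∑ k ∈ Finset.range T, (1 / 2 : ℝ) ^ k * entropy s ((1 / 2 : ℝ) ^ (k + 1))
      ≤ ∑ k ∈ Finset.range T, (6 * ∑ i, s i ^ (2 / 3 : ℝ)) * (4 / 5) ^ k :=
        Finset.sum_le_sum fun k _ => half_pow_mul_entropy_le hs k
    _ = (6 * ∑ i, s i ^ (2 / 3 : ℝ)) * ∑ k ∈ Finset.range T, (4 / 5 : ℝ) ^ k :=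
        (Finset.mul_sum _ _ _).symm
    _ ≤ (6 * ∑ i, s i ^ (2 / 3 : ℝ)) * (1 - 4 / 5)⁻¹ := by
        gcongr
        exact geom_sum_le_inv_one_sub (by norm_num) (by norm_num) T
    _ = 30 * ∑ i, s i ^ (2 / 3 : ℝ) := by ring

theorem sq_half_pow_mul_sqrt_entropy_le (s : ι → ℝ) (k : ℕ) :
    ((1 / 2 : ℝ) ^ k * √(entropy s ((1 / 2 : ℝ) ^ k))) ^ 2
      ≤ 3 * ∑ i, s i * (if (1 / 2 : ℝ) ^ k < s i then (1 / 2 : ℝ) ^ k else 0) := by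
  set ε : ℝ := (1 / 2) ^ k
  have hε : 0 < ε := by positivity
  calc (ε * √(entropy s ε)) ^ 2 = ε ^ 2 * entropy s ε := by
        rw [mul_pow, Real.sq_sqrt (entropy_nonneg hε)]
    _ ≤ ε ^ 2 * (3 * ∑ i, if ε < s i then s i / ε else 0) := by
        gcongr
        exact entropy_le_linear s hε
    _ = 3 * ∑ i, s i * (if ε < s i then ε else 0) := by
        rw [mul_left_comm, Finset.mul_sum]
        congr 1
        refine Finset.sum_congr rfl fun i _ => ?_
        split_ifs
        · field_simp
        · simp

theorem sum_range_half_pow_mul_sqrt_entropy_le (hs : ∀ i, 0 ≤ s i) (K : ℕ) :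
    ∑ k ∈ Finset.range K, (1 / 2 : ℝ) ^ k * √(entropy s ((1 / 2 : ℝ) ^ k))
      ≤ √(K * (6 * ∑ i, s i ^ 2)) := by
  apply Real.le_sqrt_of_sq_le
  calc _ ≤ (Finset.range K).card *
        ∑ k ∈ Finset.range K, ((1 / 2 : ℝ) ^ k * √(entropy s ((1 / 2 : ℝ) ^ k))) ^ 2 :=
        sq_sum_le_card_mul_sum_sq
    _ ≤ K * ∑ k ∈ Finset.range K,
        3 * ∑ i, s i * (if (1 / 2 : ℝ) ^ k < s i then (1 / 2 : ℝ) ^ k else 0) := by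
        rw [Finset.card_range]
        gcongr with k
        exact sq_half_pow_mul_sqrt_entropy_le s k
    _ = K * (3 * ∑ i, s i * ∑ k ∈ Finset.range K,
        (if (1 / 2 : ℝ) ^ k < s i then (1 / 2 : ℝ) ^ k else 0)) := by
        rw [← Finset.mul_sum, Finset.sum_comm]
        simp_rw [Finset.mul_sum]
    _ ≤ K * (3 * ∑ i, s i * (2 * s i)) := by
        gcongr with i
        · exact hs i
        · exact (sum_half_pow_lt_le K (hs i)).trans (min_le_left _ _)
    _ = K * (6 * ∑ i, s i ^ 2) := by
        simp_rw [Finset.mul_sum]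
        refine Finset.sum_congr rfl fun i _ => ?_
        ring

theorem half_pow_clog_add_mul_sqrt_entropy_le (hs1 : ∀ i, s i ≤ 1) (k : ℕ) :
    (1 / 2 : ℝ) ^ (Nat.clog 2 (Fintype.card ι) + k) *
        √(entropy s ((1 / 2 : ℝ) ^ (Nat.clog 2 (Fintype.card ι) + k)))
      ≤ 2 * (3 / 4 : ℝ) ^ k := by
  set d := Fintype.card ι with hd
  set K := Nat.clog 2 d
  refine (sq_le_sq₀ (by positivity) (by positivity)).1 ?_
  have hcard : (d : ℝ) * (1 / 2) ^ K ≤ 1 := by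
    have : (d : ℝ) ≤ 2 ^ K := by exact_mod_cast Nat.le_pow_clog (by norm_num) d
    rwa [one_div, inv_pow, ← div_eq_mul_inv, div_le_one (by positivity)]
  calc _ ≤ 3 * ∑ i : ι, (1 : ℝ) * (1 / 2) ^ (K + k) := by
        refine (sq_half_pow_mul_sqrt_entropy_le s _).trans ?_
        gcongr with i
        · exact hs1 i
        · split_ifs
          · exact le_rfl
          · positivity
    _ = 3 * ((d * (1 / 2) ^ K) * (1 / 2) ^ k) := by
        rw [Finset.sum_const, Finset.card_univ, ← hd, nsmul_eq_mul, pow_add]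
        ring
    _ ≤ 4 * (1 * (9 / 16) ^ k) := by
        have hratio : (1 / 2 : ℝ) ^ k ≤ (9 / 16) ^ k :=
          pow_le_pow_left₀ (by norm_num) (by norm_num) k
        gcongr
        norm_num
    _ = (2 * (3 / 4 : ℝ) ^ k) ^ 2 := by
        rw [mul_pow, ← pow_mul, mul_comm k 2, pow_mul]
        norm_num

/- Cauchy-Schwarz over the first `log₂ d` scales; beyond them the number `d` of axes is beaten by
the geometric decay. -/
theorem sum_half_pow_mul_sqrt_entropy_le (hs : ∀ i, 0 ≤ s i) (hs1 : ∀ i, s i ≤ 1) (T : ℕ) :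
    ∑ k ∈ Finset.range T, (1 / 2 : ℝ) ^ k * √(entropy s ((1 / 2 : ℝ) ^ k))
      ≤ √(18 * ((∑ i, s i ^ 2) * Real.log (Fintype.card ι))) + 8 := by
  set K := Nat.clog 2 (Fintype.card ι)
  set f : ℕ → ℝ := fun k => (1 / 2 : ℝ) ^ k * √(entropy s ((1 / 2 : ℝ) ^ k))
  have hhead : ∑ k ∈ Finset.range K, f k
      ≤ √(18 * ((∑ i, s i ^ 2) * Real.log (Fintype.card ι))) := by
    refine (sum_range_half_pow_mul_sqrt_entropy_le hs K).trans (Real.sqrt_le_sqrt ?_)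
    have hS : 0 ≤ ∑ i, s i ^ 2 := Finset.sum_nonneg fun i _ => sq_nonneg _
    nlinarith [natClog_two_le_three_mul_log (Fintype.card ι)]
  have htail : ∑ k ∈ Finset.range T, f (K + k) ≤ 8 := by
    calc _ ≤ ∑ k ∈ Finset.range T, 2 * (3 / 4 : ℝ) ^ k :=
          Finset.sum_le_sum fun k _ => half_pow_clog_add_mul_sqrt_entropy_le hs1 k
      _ ≤ 2 * (1 - 3 / 4)⁻¹ := by
          rw [← Finset.mul_sum]
          gcongr
          exact geom_sum_le_inv_one_sub (by norm_num) (by norm_num) T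
      _ = 8 := by norm_num
  calc ∑ k ∈ Finset.range T, f k ≤ ∑ k ∈ Finset.range (K + T), f k :=
        Finset.sum_le_sum_of_subset_of_nonneg
          (Finset.range_subset_range.2 (Nat.le_add_left T K)) fun k _ _ => by positivity
    _ = ∑ k ∈ Finset.range K, f k + ∑ k ∈ Finset.range T, f (K + k) := Finset.sum_range_add _ _ _
    _ ≤ _ := add_le_add hhead htail

theorem entropy_antitoneOn (s : ι → ℝ) : AntitoneOn (entropy s) (Set.Ioi 0) := by
  intro ε hε ε' _ h
  refine Finset.sum_le_sum fun i _ => ?_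
  have hε : 0 < ε := hε
  have hε' : 0 < ε' := hε.trans_le h
  split_ifs with h1 h2 h2
  · have := hε'.trans h1
    gcongr
  · exact absurd (h.trans_lt h1) h2
  · have : 0 < s i / ε := div_pos (hε.trans h2) hε
    linarith [Real.log_nonneg (show (1 : ℝ) ≤ 1 + 2 * (s i / ε) by linarith)]
  · exact le_rfl

theorem exists_nets (hs : ∀ i, 0 < s i) (hs1 : ∀ i, s i ≤ 1) :
    ∃ N : ℕ → Finset (EuclideanSpace ℝ ι),
      (∀ k, ((N k).card : ℝ) ≤ Real.exp (entropy s ((1 / 2) ^ k))) ∧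
      (∀ k, ∀ y ∈ N k, ‖y‖ ≤ 1) ∧ N 0 = {0} ∧
      ∀ k x, ‖x‖ ≤ 1 → ∃ y ∈ N k, diagForm s (x - y) ≤ 2 * ((1 / 2) ^ k) ^ 2 := by
  choose N hcard hball hcover using fun k : ℕ =>
    exists_net hs (show (0 : ℝ) < (1 / 2) ^ k by positivity)
  refine ⟨fun | 0 => {0} | k + 1 => N (k + 1), fun k => ?_, fun k => ?_, rfl, fun k x hx => ?_⟩
  · rcases k with _ | k
    · simpa using entropy_nonneg one_pos
    · exact hcard (k + 1)
  · rcases k with _ | k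
    · simp
    · exact hball (k + 1)
  · rcases k with _ | k
    · have hform := diagForm_le_norm_sq (fun i => (hs i).le) hs1 x
      have hnorm : ‖x‖ ^ 2 ≤ 1 := pow_le_one₀ (norm_nonneg x) hx
      simpa using hform.trans (hnorm.trans one_le_two)
    · exact hcover (k + 1) x hx

end Entropy

section HessTerm

variable {E : Type*} [NormedAddCommGroup E] [InnerProductSpace ℝ E]

/-- The contribution `G (aᵀx) (aᵀu)²` of the data point `a` to the Hessian form at `x` in the
direction `u`, where `G` stands for the second derivative of the loss. -/
def hessTerm (G : ℝ → ℝ) (x u a : E) : ℝ := G (inner ℝ a x) * inner ℝ a u ^ 2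

open Classical in
/-- The contribution of the data point `a` to the Hessian form, with the data points of norm larger
than `M` discarded. -/
noncomputable def truncHessTerm (G : ℝ → ℝ) (M : ℝ) (x u a : E) : ℝ :=
  if ‖a‖ ≤ M then hessTerm G x u a else 0

variable {G : ℝ → ℝ} {M : ℝ} {x x' u u' a : E}

theorem abs_le_one_add_abs_of_lipschitz (hG : LipschitzWith 1 G) (hG0 : |G 0| ≤ 1) (t : ℝ) :
    |G t| ≤ 1 + |t| := by
  have h : |G t - G 0| ≤ |t| := by simpa [Real.dist_eq] using hG.dist_le_mul t 0
  linarith [abs_sub_abs_le_abs_sub (G t) (G 0)]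

theorem abs_inner_le_of_norm_le (ha : ‖a‖ ≤ M) (hx : ‖x‖ ≤ 1) : |inner ℝ a x| ≤ M :=
  (abs_real_inner_le_norm a x).trans
    ((mul_le_of_le_one_right (norm_nonneg a) hx).trans ha)

theorem abs_truncHessTerm_le (hG : LipschitzWith 1 G) (hG0 : |G 0| ≤ 1) (hM : 0 ≤ M)
    (hx : ‖x‖ ≤ 1) (hu : ‖u‖ ≤ 1) (a : E) : |truncHessTerm G M x u a| ≤ (1 + M) * M ^ 2 := by
  unfold truncHessTerm
  split_ifs with h
  · have hGM : |G (inner ℝ a x)| ≤ 1 + M :=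
      (abs_le_one_add_abs_of_lipschitz hG hG0 _).trans
        (by gcongr; exact abs_inner_le_of_norm_le h hx)
    rw [hessTerm, abs_mul, abs_pow]
    gcongr
    exact abs_inner_le_of_norm_le h hu
  · rw [abs_zero]
    positivity

theorem abs_hessTerm_sub_le (hG : LipschitzWith 1 G) (hG0 : |G 0| ≤ 1) (x x' u u' a : E) :
    |hessTerm G x u a - hessTerm G x' u' a|
      ≤ |inner ℝ a (x - x')| * |inner ℝ a u| ^ 2
        + (1 + |inner ℝ a x'|) * (|inner ℝ a (u - u')| * (|inner ℝ a u| + |inner ℝ a u'|)) := by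
  have hdecomp : hessTerm G x u a - hessTerm G x' u' a
      = (G (inner ℝ a x) - G (inner ℝ a x')) * inner ℝ a u ^ 2
        + G (inner ℝ a x') * (inner ℝ a (u - u') * (inner ℝ a u + inner ℝ a u')) := by
    rw [hessTerm, hessTerm, inner_sub_right]
    ring
  have hGx : |G (inner ℝ a x) - G (inner ℝ a x')| ≤ |inner ℝ a (x - x')| := by
    simpa [Real.dist_eq, inner_sub_right] using hG.dist_le_mul (inner ℝ a x) (inner ℝ a x')
  rw [hdecomp]
  refine (abs_add_le _ _).trans ?_
  rw [abs_mul, abs_mul, abs_mul, abs_pow]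
  gcongr
  · exact abs_le_one_add_abs_of_lipschitz hG hG0 _
  · exact abs_add_le _ _

theorem cubic_form_le_mul {p r y y' w : ℝ} (hr : 0 ≤ r) (hy : 0 ≤ y)
    (hy' : 0 ≤ y') (hM : 1 ≤ M) (hp : 0 ≤ p) (hyM : y ≤ M) (hwM : w ≤ M) :
    p * y ^ 2 + (1 + w) * (r * (y + y'))
      ≤ 2 * M * (1 + (p ^ 2 + r ^ 2 + y ^ 2 + y' ^ 2 + w ^ 2)) :=
  calc p * y ^ 2 + (1 + w) * (r * (y + y'))
      = p * y * y + (1 + w) * (r * (y + y')) := by ring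
    _ ≤ p * y * M + (2 * M) * (r * (y + y')) := by gcongr; linarith
    _ = M * (p * y + 2 * (r * (y + y'))) := by ring
    _ ≤ M * (2 * (1 + (p ^ 2 + r ^ 2 + y ^ 2 + y' ^ 2 + w ^ 2))) := by
        gcongr
        linarith [sq_nonneg (p - y), sq_nonneg (r - y), sq_nonneg (r - y'), sq_nonneg p,
          sq_nonneg y, sq_nonneg y', sq_nonneg w]
    _ = _ := by ring

theorem cubic_form_sq_le (p r y y' w : ℝ) :
    (p * y ^ 2 + (1 + w) * (r * (y + y'))) ^ 2
      ≤ 10 * (1 + (p ^ 2 + r ^ 2 + y ^ 2 + y' ^ 2 + w ^ 2)) ^ 3 := by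
  set V := 1 + (p ^ 2 + r ^ 2 + y ^ 2 + y' ^ 2 + w ^ 2) with hV
  have hpV : p ^ 2 ≤ V := by rw [hV]; nlinarith
  have hyV : y ^ 2 ≤ V := by rw [hV]; nlinarith
  have hrV : r ^ 2 ≤ V := by rw [hV]; nlinarith
  have hwV : (1 + w) ^ 2 ≤ 2 * V := by rw [hV]; nlinarith [sq_nonneg (1 - w)]
  have hyyV : (y + y') ^ 2 ≤ 2 * V := by rw [hV]; nlinarith [sq_nonneg (y - y')]
  have : 0 ≤ V := (sq_nonneg p).trans hpV
  have hfst : (p * y ^ 2) ^ 2 ≤ V ^ 3 :=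
    calc (p * y ^ 2) ^ 2 = p ^ 2 * (y ^ 2 * y ^ 2) := by ring
      _ ≤ V * (V * V) := by gcongr
      _ = V ^ 3 := by ring
  have hsnd : ((1 + w) * (r * (y + y'))) ^ 2 ≤ 4 * V ^ 3 :=
    calc ((1 + w) * (r * (y + y'))) ^ 2 = (1 + w) ^ 2 * (r ^ 2 * (y + y') ^ 2) := by ring
      _ ≤ 2 * V * (V * (2 * V)) := by gcongr
      _ = 4 * V ^ 3 := by ring
  linarith [add_sq_le (a := p * y ^ 2) (b := (1 + w) * (r * (y + y')))]

/-- The sum of squares of linear forms of the data point `a` that controls the difference of the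
Hessian terms at `(x, u)` and `(x', u')`, for `x, x'` and `u, u'` at distance `ρ`. -/
noncomputable def hessTermGauge (ρ : ℝ) (x x' u u' a : E) : ℝ :=
  1 + ((inner ℝ a (x - x') / ρ) ^ 2 + (inner ℝ a (u - u') / ρ) ^ 2
    + inner ℝ a u ^ 2 + inner ℝ a u' ^ 2 + inner ℝ a x' ^ 2)

theorem one_le_hessTermGauge (ρ : ℝ) (x x' u u' a : E) : 1 ≤ hessTermGauge ρ x x' u u' a :=
  le_add_of_nonneg_right (by positivity)

theorem abs_hessTerm_sub_le_mul (hG : LipschitzWith 1 G) (hG0 : |G 0| ≤ 1) {ρ : ℝ} (hρ : 0 < ρ)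
    (x x' u u' a : E) :
    |hessTerm G x u a - hessTerm G x' u' a|
      ≤ ρ * (|inner ℝ a (x - x') / ρ| * |inner ℝ a u| ^ 2
        + (1 + |inner ℝ a x'|)
          * (|inner ℝ a (u - u') / ρ| * (|inner ℝ a u| + |inner ℝ a u'|))) := by
  refine (abs_hessTerm_sub_le hG hG0 x x' u u' a).trans_eq ?_
  rw [abs_div, abs_div, abs_of_pos hρ]
  field_simp

theorem abs_truncHessTerm_sub_le (hG : LipschitzWith 1 G) (hG0 : |G 0| ≤ 1) (hM : 1 ≤ M)
    (x : E) (hx' : ‖x'‖ ≤ 1) (hu : ‖u‖ ≤ 1) (u' : E) {ρ : ℝ} (hρ : 0 < ρ) (a : E) :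
    |truncHessTerm G M x u a - truncHessTerm G M x' u' a|
      ≤ 2 * ρ * M * hessTermGauge ρ x x' u u' a := by
  have := one_le_hessTermGauge ρ x x' u u' a
  unfold truncHessTerm
  split_ifs with h
  · have hcubic := cubic_form_le_mul (abs_nonneg (inner ℝ a (u - u') / ρ)) (abs_nonneg _)
      (abs_nonneg (inner ℝ a u')) hM (abs_nonneg (inner ℝ a (x - x') / ρ))
      (abs_inner_le_of_norm_le h hu) (abs_inner_le_of_norm_le h hx')
    simp only [sq_abs] at hcubic
    refine (abs_hessTerm_sub_le_mul hG hG0 hρ x x' u u' a).trans ?_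
    simp only [sq_abs]
    exact (mul_le_mul_of_nonneg_left hcubic hρ.le).trans_eq (by rw [hessTermGauge]; ring)
  · rw [sub_zero, abs_zero]
    positivity

theorem truncHessTerm_sub_sq_le (hG : LipschitzWith 1 G) (hG0 : |G 0| ≤ 1) (M : ℝ)
    (x x' u u' : E) {ρ : ℝ} (hρ : 0 < ρ) (a : E) :
    (truncHessTerm G M x u a - truncHessTerm G M x' u' a) ^ 2
      ≤ 10 * ρ ^ 2 * hessTermGauge ρ x x' u u' a ^ 3 := by
  have := one_le_hessTermGauge ρ x x' u u' a
  unfold truncHessTerm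
  split_ifs with h
  · have hcubic := cubic_form_sq_le |inner ℝ a (x - x') / ρ| |inner ℝ a (u - u') / ρ|
      |inner ℝ a u| |inner ℝ a u'| |inner ℝ a x'|
    rw [← sq_abs]
    refine (pow_le_pow_left₀ (abs_nonneg _) (abs_hessTerm_sub_le_mul hG hG0 hρ x x' u u' a)
      2).trans ?_
    rw [mul_pow]
    refine (mul_le_mul_of_nonneg_left hcubic (sq_nonneg ρ)).trans_eq ?_
    simp only [sq_abs, hessTermGauge]
    ring
  · rw [sub_zero, zero_pow two_ne_zero]
    positivity

theorem hessTerm_sq_le (hG : LipschitzWith 1 G) (hG0 : |G 0| ≤ 1) (x u a : E) :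
    hessTerm G x u a ^ 2 ≤ 2 * (1 + (inner ℝ a x ^ 2 + inner ℝ a u ^ 2)) ^ 3 := by
  set V := 1 + (inner ℝ a x ^ 2 + inner ℝ a u ^ 2) with hV
  have hGV : G (inner ℝ a x) ^ 2 ≤ 2 * V :=
    calc G (inner ℝ a x) ^ 2 = |G (inner ℝ a x)| ^ 2 := (sq_abs _).symm
      _ ≤ (1 + |inner ℝ a x|) ^ 2 := by
          gcongr
          exact abs_le_one_add_abs_of_lipschitz hG hG0 _
      _ ≤ 2 * V := by
          rw [hV]
          nlinarith [sq_nonneg (1 - |inner ℝ a x|), sq_abs (inner ℝ a x), sq_nonneg (inner ℝ a u)]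
  have huV : inner ℝ a u ^ 2 ≤ V := by rw [hV]; nlinarith [sq_nonneg (inner ℝ a x)]
  have : 0 ≤ V := (sq_nonneg _).trans huV
  calc hessTerm G x u a ^ 2 = G (inner ℝ a x) ^ 2 * (inner ℝ a u ^ 2 * inner ℝ a u ^ 2) := by
        rw [hessTerm]
        ring
    _ ≤ 2 * V * (V * V) := by gcongr
    _ = 2 * V ^ 3 := by ring

end HessTerm

section Moments

theorem cube_le_exp {V : ℝ} (hV : 0 ≤ V) : V ^ 3 ≤ 384000 * Real.exp (V / 40) := by
  have h := Real.pow_div_factorial_le_exp (V / 40) (by positivity) 3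
  norm_num [Nat.factorial] at h
  linarith

theorem lintegral_ofReal_le_of_le_const_mul {α : Type*} [MeasurableSpace α] {ν : Measure α}
    {f g : α → ℝ} {c b : ℝ} (hc : 0 ≤ c) (hfg : ∀ a, f a ≤ c * g a)
    (hb : ∫⁻ a, ENNReal.ofReal (g a) ∂ν ≤ ENNReal.ofReal b) :
    ∫⁻ a, ENNReal.ofReal (f a) ∂ν ≤ ENNReal.ofReal (c * b) :=
  calc ∫⁻ a, ENNReal.ofReal (f a) ∂ν ≤ ∫⁻ a, ENNReal.ofReal c * ENNReal.ofReal (g a) ∂ν :=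
        lintegral_mono fun a => by
          rw [← ENNReal.ofReal_mul hc]
          exact ENNReal.ofReal_le_ofReal (hfg a)
    _ = ENNReal.ofReal c * ∫⁻ a, ENNReal.ofReal (g a) ∂ν :=
        lintegral_const_mul' _ _ ENNReal.ofReal_ne_top
    _ ≤ ENNReal.ofReal c * ENNReal.ofReal b := by gcongr
    _ = ENNReal.ofReal (c * b) := (ENNReal.ofReal_mul hc).symm

theorem exp_one_add_sum_div_twenty_le (v : Fin 5 → ℝ) :
    Real.exp ((1 + ∑ i, v i) / 20) ≤ ∑ i, 4 / 15 * Real.exp (v i / 4) := by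
  have hjensen := convexOn_exp.map_sum_le (t := Finset.univ) (w := fun _ : Fin 5 => (1 / 5 : ℝ))
    (p := fun i => v i / 4) (fun _ _ => by norm_num) (by simp) (fun _ _ => Set.mem_univ _)
  simp only [smul_eq_mul] at hjensen
  have hexp : Real.exp (1 / 20) ≤ 4 / 3 :=
    (Real.exp_bound_div_one_sub_of_interval (by norm_num) (by norm_num)).trans (by norm_num)
  calc Real.exp ((1 + ∑ i, v i) / 20)
      = Real.exp (1 / 20) * Real.exp (∑ i, 1 / 5 * (v i / 4)) := by
        rw [← Real.exp_add, ← Finset.mul_sum, ← Finset.sum_div]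
        ring_nf
    _ ≤ 4 / 3 * ∑ i, 1 / 5 * Real.exp (v i / 4) := by gcongr
    _ = ∑ i, 4 / 15 * Real.exp (v i / 4) := by
        rw [Finset.mul_sum]
        exact Finset.sum_congr rfl fun i _ => by ring

variable {ι : Type*} [Fintype ι] {ν : Measure (EuclideanSpace ℝ ι)} {s : ι → ℝ}

theorem HasSubgaussianDiag.lintegral_exp_one_add_sum_sq_le (h : HasSubgaussianDiag ν s)
    (w : Fin 5 → EuclideanSpace ℝ ι) (q : Fin 5 → ℝ) (hq : ∀ i, 0 < q i)
    (hw : ∀ i, diagForm s (w i) ≤ q i ^ 2) :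
    ∫⁻ a, ENNReal.ofReal (Real.exp ((1 + ∑ i, (inner ℝ a (w i) / q i) ^ 2) / 20)) ∂ν
      ≤ ENNReal.ofReal 4 :=
  calc _ ≤ ∫⁻ a, ∑ i, ENNReal.ofReal (4 / 15)
        * ENNReal.ofReal (Real.exp ((inner ℝ a (w i) / q i) ^ 2 / 4)) ∂ν := by
        refine lintegral_mono fun a =>
          (ENNReal.ofReal_le_ofReal (exp_one_add_sum_div_twenty_le _)).trans_eq ?_
        rw [ENNReal.ofReal_sum_of_nonneg fun i _ => by positivity]
        exact Finset.sum_congr rfl fun i _ => ENNReal.ofReal_mul (by norm_num)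
    _ = ∑ i, ENNReal.ofReal (4 / 15)
        * ∫⁻ a, ENNReal.ofReal (Real.exp ((inner ℝ a (w i) / q i) ^ 2 / 4)) ∂ν := by
        rw [lintegral_finsetSum _ fun i _ => by fun_prop]
        exact Finset.sum_congr rfl fun i _ => lintegral_const_mul _ (by fun_prop)
    _ ≤ ∑ _i : Fin 5, ENNReal.ofReal (4 / 15) * ENNReal.ofReal 3 := by
        gcongr with i
        simpa using h (w i) (q i) (hq i) (hw i)
    _ = ENNReal.ofReal 4 := by
        rw [← ENNReal.ofReal_mul (by norm_num), Finset.sum_const, Finset.card_univ,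
          Fintype.card_fin, ← ENNReal.ofReal_nsmul]
        norm_num

theorem diagForm_le_one (hs : ∀ i, 0 ≤ s i) (hs1 : ∀ i, s i ≤ 1) {w : EuclideanSpace ℝ ι}
    (hw : ‖w‖ ≤ 1) : diagForm s w ≤ 1 :=
  (diagForm_le_norm_sq hs hs1 w).trans (pow_le_one₀ (norm_nonneg w) hw)

variable {G : ℝ → ℝ} {x x' u u' : EuclideanSpace ℝ ι}

theorem measurable_truncHessTerm (hG : Measurable G) (M : ℝ) (x u : EuclideanSpace ℝ ι) :
    Measurable (truncHessTerm G M x u) := by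
  unfold truncHessTerm hessTerm
  exact Measurable.ite (measurableSet_le (by fun_prop) measurable_const) (by fun_prop)
    measurable_const

theorem HasSubgaussianDiag.lintegral_exp_hessTermGauge_le (h : HasSubgaussianDiag ν s)
    (hs : ∀ i, 0 ≤ s i) (hs1 : ∀ i, s i ≤ 1) (hx' : ‖x'‖ ≤ 1) (hu : ‖u‖ ≤ 1) (hu' : ‖u'‖ ≤ 1)
    {ρ : ℝ} (hρ : 0 < ρ) (hxρ : diagForm s (x - x') ≤ ρ ^ 2)
    (huρ : diagForm s (u - u') ≤ ρ ^ 2) :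
    ∫⁻ a, ENNReal.ofReal (Real.exp (hessTermGauge ρ x x' u u' a / 20)) ∂ν ≤ ENNReal.ofReal 4 := by
  have hunit {w : EuclideanSpace ℝ ι} (hw : ‖w‖ ≤ 1) : diagForm s w ≤ 1 ^ 2 :=
    (diagForm_le_one hs hs1 hw).trans_eq (one_pow 2).symm
  have hmoment := h.lintegral_exp_one_add_sum_sq_le ![x - x', u - u', u, u', x'] ![ρ, ρ, 1, 1, 1]
    (fun i => by fin_cases i <;> simp [hρ])
    (fun i => by fin_cases i; exacts [hxρ, huρ, hunit hu, hunit hu', hunit hx'])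
  simpa only [hessTermGauge, Fin.sum_univ_five, Matrix.cons_val, div_one] using hmoment

theorem HasSubgaussianDiag.integrable_and_integral_truncHessTerm_sub_le
    (h : HasSubgaussianDiag ν s) (hs : ∀ i, 0 ≤ s i) (hs1 : ∀ i, s i ≤ 1)
    (hG : LipschitzWith 1 G) (hG0 : |G 0| ≤ 1) {M : ℝ} (hM : 1 ≤ M)
    (hx' : ‖x'‖ ≤ 1) (hu : ‖u‖ ≤ 1) (hu' : ‖u'‖ ≤ 1) {ρ : ℝ} (hρ : 0 < ρ)
    (hxρ : diagForm s (x - x') ≤ ρ ^ 2) (huρ : diagForm s (u - u') ≤ ρ ^ 2) :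
    let X := fun a => truncHessTerm G M x u a - truncHessTerm G M x' u' a
    Integrable (fun a => X a ^ 2 * Real.exp (1 / (80 * M * ρ) * |X a|)) ν ∧
      ∫ a, X a ^ 2 * Real.exp (1 / (80 * M * ρ) * |X a|) ∂ν ≤ 15360000 * ρ ^ 2 := by
  intro X
  have hXmeas : Measurable X := (measurable_truncHessTerm hG.continuous.measurable M x u).sub
    (measurable_truncHessTerm hG.continuous.measurable M x' u')
  have hgauge := h.lintegral_exp_hessTermGauge_le hs hs1 hx' hu hu' hρ hxρ huρ
  refine integrable_and_integral_le_of_lintegral_ofReal_le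
    (by fun_prop) (fun a => by positivity) (by positivity)
    ((lintegral_ofReal_le_of_le_const_mul (c := 3840000 * ρ ^ 2) (by positivity) (fun a => ?_)
      hgauge).trans_eq (by ring_nf))
  set V := hessTermGauge ρ x x' u u' a
  have hV0 : 0 ≤ V := zero_le_one.trans (one_le_hessTermGauge ρ x x' u u' a)
  have hexponent : 1 / (80 * M * ρ) * |X a| ≤ V / 40 := by
    rw [one_div, inv_mul_le_iff₀ (by positivity)]
    linarith [abs_truncHessTerm_sub_le hG hG0 hM x hx' hu u' hρ a]
  calc X a ^ 2 * Real.exp (1 / (80 * M * ρ) * |X a|)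
      ≤ 10 * ρ ^ 2 * V ^ 3 * Real.exp (V / 40) := by
        gcongr
        exact truncHessTerm_sub_sq_le hG hG0 M x x' u u' hρ a
    _ ≤ 10 * ρ ^ 2 * (384000 * Real.exp (V / 40)) * Real.exp (V / 40) := by
        gcongr
        exact cube_le_exp hV0
    _ = 3840000 * ρ ^ 2 * (Real.exp (V / 40) * Real.exp (V / 40)) := by ring
    _ = 3840000 * ρ ^ 2 * Real.exp (V / 20) := by rw [← Real.exp_add]; ring_nf

theorem HasSubgaussianDiag.lintegral_hessTerm_sq_le (h : HasSubgaussianDiag ν s)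
    (hs : ∀ i, 0 ≤ s i) (hs1 : ∀ i, s i ≤ 1) (hG : LipschitzWith 1 G) (hG0 : |G 0| ≤ 1)
    (hx : ‖x‖ ≤ 1) (hu : ‖u‖ ≤ 1) :
    ∫⁻ a, ENNReal.ofReal (hessTerm G x u a ^ 2) ∂ν ≤ ENNReal.ofReal 3072000 := by
  have hgauge := h.lintegral_exp_hessTermGauge_le hs hs1 hx hu hu one_pos
    (x := x) (by simp [diagForm]) (by simp [diagForm])
  refine (lintegral_ofReal_le_of_le_const_mul (c := 768000) (by positivity) (fun a => ?_)
    hgauge).trans_eq (by norm_num)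
  set V := hessTermGauge 1 x x u u a with hV
  have hV0 : 0 ≤ V := zero_le_one.trans (one_le_hessTermGauge 1 x x u u a)
  have hle : 1 + (inner ℝ a x ^ 2 + inner ℝ a u ^ 2) ≤ V := by
    simp only [hV, hessTermGauge, sub_self, inner_zero_right]
    nlinarith [sq_nonneg (inner ℝ a u)]
  calc hessTerm G x u a ^ 2
      ≤ 2 * (1 + (inner ℝ a x ^ 2 + inner ℝ a u ^ 2)) ^ 3 := hessTerm_sq_le hG hG0 x u a
    _ ≤ 2 * V ^ 3 := by gcongr
    _ ≤ 2 * (384000 * Real.exp (V / 40)) := by gcongr; exact cube_le_exp hV0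
    _ ≤ 768000 * Real.exp (V / 20) := by
        linarith [Real.exp_le_exp.2 (show V / 40 ≤ V / 20 by linarith)]

end Moments

section SampleDeviation

variable {α : Type*} [MeasurableSpace α] {ν : Measure α} {n : ℕ}

/-- The deviation of the empirical mean of `X` over the sample `v` from its expectation under
`ν`. -/
noncomputable def sampleDev (ν : Measure α) (X : α → ℝ) (v : Fin n → α) : ℝ :=
  1 / (n : ℝ) * ∑ j, X (v j) - ∫ a, X a ∂ν

theorem sampleDev_sub {X Z : α → ℝ} (hX : Integrable X ν) (hZ : Integrable Z ν) (v : Fin n → α) :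
    sampleDev ν (fun a => X a - Z a) v = sampleDev ν X v - sampleDev ν Z v := by
  simp only [sampleDev, integral_sub hX hZ, Finset.sum_sub_distrib]
  ring

theorem tendsto_sampleDev [IsFiniteMeasure ν] {X : ℕ → α → ℝ} {Z : α → ℝ} {B : ℝ}
    (hX : ∀ k, Measurable (X k)) (hB : ∀ k a, |X k a| ≤ B)
    (hlim : ∀ a, Filter.Tendsto (fun k => X k a) Filter.atTop (nhds (Z a))) (v : Fin n → α) :
    Filter.Tendsto (fun k => sampleDev ν (X k) v) Filter.atTop (nhds (sampleDev ν Z v)) :=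
  ((tendsto_finsetSum _ fun j _ => hlim (v j)).const_mul _).sub <|
    tendsto_integral_of_dominated_convergence (fun _ => B)
      (fun k => (hX k).aestronglyMeasurable) (integrable_const B)
      (fun k => ae_of_all _ (hB k)) (ae_of_all _ hlim)

theorem measure_exists_mem_finset_le {β : Type*} (I : Finset β) {p : β → α → Prop} {c : ℝ}
    (h : ∀ i ∈ I, ν {a | p i a} ≤ ENNReal.ofReal c) :
    ν {a | ∃ i ∈ I, p i a} ≤ ENNReal.ofReal (I.card * c) :=
  calc ν {a | ∃ i ∈ I, p i a} = ν (⋃ i ∈ I, {a | p i a}) := by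
        congr 1
        ext a
        simp
    _ ≤ ∑ i ∈ I, ν {a | p i a} := measure_biUnion_finset_le _ _
    _ ≤ I.card • ENNReal.ofReal c := Finset.sum_le_card_nsmul _ _ _ h
    _ = ENNReal.ofReal (I.card * c) := by rw [← ENNReal.ofReal_nsmul, nsmul_eq_mul]

end SampleDeviation

section Chaining

theorem abs_le_of_tendsto_of_abs_sub_le {z t : ℕ → ℝ} {a b : ℝ} (hz0 : z 0 = 0)
    (hinc : ∀ k, |z (k + 1) - z k| ≤ t k) (hb : ∀ T, ∑ k ∈ Finset.range T, t k ≤ b)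
    (hz : Filter.Tendsto z Filter.atTop (nhds a)) : |a| ≤ b := by
  refine le_of_tendsto hz.abs (Filter.Eventually.of_forall fun T => ?_)
  calc |z T| = |∑ k ∈ Finset.range T, (z (k + 1) - z k)| := by
        rw [Finset.sum_range_sub, hz0, sub_zero]
    _ ≤ ∑ k ∈ Finset.range T, |z (k + 1) - z k| := Finset.abs_sum_le_sum_abs _ _
    _ ≤ ∑ k ∈ Finset.range T, t k := Finset.sum_le_sum fun k _ => hinc k
    _ ≤ b := hb T

theorem sum_half_pow_mul_add_two_le (T : ℕ) :
    ∑ k ∈ Finset.range T, (1 / 2 : ℝ) ^ k * (k + 2) ≤ 6 := by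
  suffices h : ∑ k ∈ Finset.range T, (1 / 2 : ℝ) ^ k * (k + 2)
      = 6 - (1 / 2 : ℝ) ^ T * (2 * T + 6) by
    rw [h, sub_le_self_iff]
    positivity
  induction T with
  | zero => norm_num
  | succ T ih =>
    rw [Finset.sum_range_succ, ih, pow_succ]
    push_cast
    ring

theorem sum_half_pow_le_two (T : ℕ) : ∑ k ∈ Finset.range T, (1 / 2 : ℝ) ^ k ≤ 2 :=
  (geom_sum_le_inv_one_sub (by norm_num) (by norm_num) T).trans (by norm_num)

variable {ι : Type*} [Fintype ι] {s : ι → ℝ}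

theorem diagForm_sub_le_two_mul_add (s : ι → ℝ) (x y z : EuclideanSpace ℝ ι) :
    diagForm s (y - z) ≤ 2 * diagForm s (x - y) + 2 * diagForm s (x - z) := by
  simp only [diagForm, Finset.mul_sum, ← Finset.sum_add_distrib]
  refine Finset.sum_le_sum fun i _ => ?_
  have hsq : (y i - z i) ^ 2 ≤ 2 * (x i - y i) ^ 2 + 2 * (x i - z i) ^ 2 := by
    linarith [sq_nonneg ((x i - y i) + (x i - z i))]
  simp only [PiLp.sub_apply]
  linarith [mul_le_mul_of_nonneg_left hsq (sq_nonneg (s i))]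

theorem diagForm_succ_sub_le {x : EuclideanSpace ℝ ι} {y : ℕ → EuclideanSpace ℝ ι}
    (h : ∀ k, diagForm s (x - y k) ≤ 2 * ((1 / 2) ^ k) ^ 2) (k : ℕ) :
    diagForm s (y (k + 1) - y k) ≤ (3 * (1 / 2) ^ k) ^ 2 := by
  have hsucc := h (k + 1)
  rw [pow_succ (1 / 2 : ℝ) k, mul_pow] at hsucc
  have hpos : (0 : ℝ) ≤ ((1 / 2) ^ k) ^ 2 := by positivity
  rw [mul_pow]
  linarith [diagForm_sub_le_two_mul_add s x (y (k + 1)) (y k), h k]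

theorem tendsto_of_diagForm_sub_le (hs : ∀ i, 0 < s i) {x : EuclideanSpace ℝ ι}
    {y : ℕ → EuclideanSpace ℝ ι} (h : ∀ k, diagForm s (x - y k) ≤ 2 * ((1 / 2) ^ k) ^ 2) :
    Filter.Tendsto y Filter.atTop (nhds x) := by
  set c := √(∑ i, 2 / s i ^ 2)
  have hcoord (k : ℕ) (i : ι) : (x - y k) i ^ 2 ≤ 2 / s i ^ 2 * ((1 / 2) ^ k) ^ 2 := by
    have hle : s i ^ 2 * (x - y k) i ^ 2 ≤ diagForm s (x - y k) :=
      Finset.single_le_sum (f := fun i => s i ^ 2 * (x - y k) i ^ 2)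
        (fun j _ => by positivity) (Finset.mem_univ i)
    have := hs i
    rw [div_mul_eq_mul_div, le_div_iff₀ (by positivity)]
    linarith [h k]
  have hnorm (k : ℕ) : ‖y k - x‖ ≤ c * (1 / 2) ^ k := by
    refine (sq_le_sq₀ (norm_nonneg _) (by positivity)).1 ?_
    rw [norm_sub_rev, mul_pow, Real.sq_sqrt (Finset.sum_nonneg fun i _ => by positivity),
      EuclideanSpace.real_norm_sq_eq, Finset.sum_mul]
    exact Finset.sum_le_sum fun i _ => hcoord k i
  rw [tendsto_iff_norm_sub_tendsto_zero]
  refine squeeze_zero (fun k => norm_nonneg _) hnorm ?_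
  simpa using (tendsto_pow_atTop_nhds_zero_of_lt_one (r := (1 / 2 : ℝ)) (by norm_num)
    (by norm_num)).const_mul c

/-- The exponent of the union bound at the level `k` of the chaining: `4 * entropy` pays for the
number of links, the other two terms for the failure probability `η * (1 / 2) ^ (k + 1)`. -/
noncomputable def chainExponent (s : ι → ℝ) (η : ℝ) (k : ℕ) : ℝ :=
  4 * entropy s ((1 / 2) ^ (k + 1)) + (k + 2) * Real.log 2 + Real.log (1 / η)

/-- The increment allowed at the level `k` of the chaining, where points at distance `3 * 2⁻ᵏ` are
compared: the Bernstein radius for the exponential moments of the difference of two truncated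
Hessian terms. -/
noncomputable def chainStep (s : ι → ℝ) (M n η : ℝ) (k : ℕ) : ℝ :=
  bernsteinRadius (15360000 * (3 * (1 / 2) ^ k) ^ 2) (1 / (80 * M * (3 * (1 / 2) ^ k))) n
    (chainExponent s η k)

/-- The bound on the deviation of the truncated Hessian form that results from the chaining in
dimension `d`, where `d₁` and `d₃` stand for `∑ i, s i ^ 2` and `∑ i, s i ^ (2 / 3)`. -/
noncomputable def chainBound (d : ℕ) (d₁ d₃ M n η : ℝ) : ℝ :=
  23520 * (20 * √(d₁ * Real.log d) + 38 + 2 * √(Real.log (1 / η))) / √n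
    + 480 * M * (120 * d₃ + 6 + 2 * Real.log (1 / η)) / n

variable {η : ℝ}

theorem chainExponent_nonneg (s : ι → ℝ) (hη : 0 < η) (hη1 : η ≤ 1) (k : ℕ) :
    0 ≤ chainExponent s η k := by
  have hent : 0 ≤ entropy s ((1 / 2) ^ (k + 1)) := entropy_nonneg (by positivity)
  have hlog : 0 ≤ Real.log (1 / η) := Real.log_nonneg (by rwa [one_le_div hη])
  unfold chainExponent
  positivity

theorem exp_mul_two_mul_exp_neg_chainExponent (s : ι → ℝ) (hη : 0 < η) (k : ℕ) :
    Real.exp (4 * entropy s ((1 / 2) ^ (k + 1))) * (2 * Real.exp (-chainExponent s η k))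
      = η * (1 / 2) ^ (k + 1) := by
  have hexp : Real.exp (4 * entropy s ((1 / 2) ^ (k + 1))) * Real.exp (-chainExponent s η k)
      = (1 / 2) ^ (k + 2) * η := by
    rw [← Real.exp_add, ← Real.exp_log (show (0 : ℝ) < (1 / 2) ^ (k + 2) * η by positivity),
      Real.log_mul (by positivity) hη.ne', Real.log_pow, chainExponent, one_div 2, one_div η,
      Real.log_inv, Real.log_inv]
    push_cast
    ring_nf
  rw [mul_left_comm, hexp]
  ring

theorem chainStep_le (s : ι → ℝ) {M n : ℝ} (hM : M ≠ 0) (hn : 0 < n) (k : ℕ) :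
    chainStep s M n η k ≤ 23520 / √n * ((1 / 2) ^ k * √(chainExponent s η k))
      + 480 * M / n * ((1 / 2) ^ k * chainExponent s η k) := by
  have hsqrt : √(15360000 * (3 * (1 / 2) ^ k) ^ 2 * chainExponent s η k / n)
      = √15360000 * (3 * (1 / 2) ^ k) * √(chainExponent s η k) / √n := by
    rw [Real.sqrt_div' _ hn.le, Real.sqrt_mul (by positivity), Real.sqrt_mul (by positivity),
      Real.sqrt_sq (by positivity)]
  unfold chainStep bernsteinRadius
  rw [hsqrt]
  refine add_le_add ?_ (le_of_eq (by field_simp; ring))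
  calc 2 * (√15360000 * (3 * (1 / 2) ^ k) * √(chainExponent s η k) / √n)
      ≤ 2 * (3920 * (3 * (1 / 2) ^ k) * √(chainExponent s η k) / √n) := by
        gcongr
        rw [Real.sqrt_le_left (by norm_num)]
        norm_num
    _ = _ := by ring

theorem sqrt_chainExponent_le (s : ι → ℝ) (hη : 0 < η) (hη1 : η ≤ 1) (k : ℕ) :
    √(chainExponent s η k)
      ≤ 2 * √(entropy s ((1 / 2) ^ (k + 1))) + (k + 2) + √(Real.log (1 / η)) := by
  set A := √(entropy s ((1 / 2) ^ (k + 1)))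
  set B := √(Real.log (1 / η))
  have hAsq : A ^ 2 = entropy s ((1 / 2) ^ (k + 1)) :=
    Real.sq_sqrt (entropy_nonneg (by positivity))
  have hBsq : B ^ 2 = Real.log (1 / η) :=
    Real.sq_sqrt (Real.log_nonneg (by rwa [one_le_div hη]))
  have : 0 ≤ A := Real.sqrt_nonneg _
  have : 0 ≤ B := Real.sqrt_nonneg _
  have hlog : ((k : ℝ) + 2) * Real.log 2 ≤ (k + 2) * (k + 2) := by
    gcongr
    linarith [Real.log_two_lt_d9, (Nat.cast_nonneg k : (0 : ℝ) ≤ k)]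
  have hcross : 0 ≤ 4 * A * (k + 2) + 4 * A * B + 2 * B * (k + 2) := by positivity
  refine Real.sqrt_le_iff.2 ⟨by positivity, ?_⟩
  rw [chainExponent, ← hAsq, ← hBsq]
  linarith

theorem sum_half_pow_mul_sqrt_chainExponent_le (hs : ∀ i, 0 ≤ s i) (hs1 : ∀ i, s i ≤ 1)
    (hη : 0 < η) (hη1 : η ≤ 1) (T : ℕ) :
    ∑ k ∈ Finset.range T, (1 / 2) ^ k * √(chainExponent s η k)
      ≤ 20 * √((∑ i, s i ^ 2) * Real.log (Fintype.card ι)) + 38 + 2 * √(Real.log (1 / η)) := by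
  set S := (∑ i, s i ^ 2) * Real.log (Fintype.card ι)
  have hentropy : ∑ k ∈ Finset.range T, (1 / 2 : ℝ) ^ (k + 1) * √(entropy s ((1 / 2) ^ (k + 1)))
      ≤ √(18 * S) + 8 := by
    have hshift := sum_half_pow_mul_sqrt_entropy_le hs hs1 (T + 1)
    rw [Finset.sum_range_succ'] at hshift
    have : 0 ≤ (1 / 2 : ℝ) ^ 0 * √(entropy s ((1 / 2 : ℝ) ^ 0)) := by positivity
    linarith
  have hsqrt : √(18 * S) ≤ 5 * √S := by
    rw [Real.sqrt_mul (by norm_num)]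
    gcongr
    rw [Real.sqrt_le_left (by norm_num)]
    norm_num
  calc ∑ k ∈ Finset.range T, (1 / 2) ^ k * √(chainExponent s η k)
      ≤ ∑ k ∈ Finset.range T, (1 / 2 : ℝ) ^ k
          * (2 * √(entropy s ((1 / 2) ^ (k + 1))) + (k + 2) + √(Real.log (1 / η))) := by
        gcongr with k
        exact sqrt_chainExponent_le s hη hη1 k
    _ = 4 * ∑ k ∈ Finset.range T, ((1 / 2 : ℝ) ^ (k + 1) * √(entropy s ((1 / 2) ^ (k + 1))))
        + ∑ k ∈ Finset.range T, (1 / 2 : ℝ) ^ k * (k + 2)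
        + (∑ k ∈ Finset.range T, (1 / 2 : ℝ) ^ k) * √(Real.log (1 / η)) := by
      rw [Finset.mul_sum, Finset.sum_mul, ← Finset.sum_add_distrib, ← Finset.sum_add_distrib]
      exact Finset.sum_congr rfl fun k _ => by ring
    _ ≤ 4 * (5 * √S + 8) + 6 + 2 * √(Real.log (1 / η)) := by
      gcongr
      · exact hentropy.trans (by linarith)
      · exact sum_half_pow_mul_add_two_le T
      · exact sum_half_pow_le_two T
    _ = _ := by ring

theorem sum_half_pow_mul_chainExponent_le (hs : ∀ i, 0 ≤ s i) (hη : 0 < η) (hη1 : η ≤ 1) (T : ℕ) :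
    ∑ k ∈ Finset.range T, (1 / 2) ^ k * chainExponent s η k
      ≤ 120 * ∑ i, s i ^ (2 / 3 : ℝ) + 6 + 2 * Real.log (1 / η) := by
  have hlog : 0 ≤ Real.log (1 / η) := Real.log_nonneg (by rwa [one_le_div hη])
  calc ∑ k ∈ Finset.range T, (1 / 2) ^ k * chainExponent s η k
      ≤ ∑ k ∈ Finset.range T, (1 / 2 : ℝ) ^ k
          * (4 * entropy s ((1 / 2) ^ (k + 1)) + (k + 2) * 1 + Real.log (1 / η)) := by
        unfold chainExponent
        gcongr
        linarith [Real.log_two_lt_d9]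
    _ = 4 * ∑ k ∈ Finset.range T, ((1 / 2 : ℝ) ^ k * entropy s ((1 / 2) ^ (k + 1)))
        + ∑ k ∈ Finset.range T, (1 / 2 : ℝ) ^ k * (k + 2)
        + (∑ k ∈ Finset.range T, (1 / 2 : ℝ) ^ k) * Real.log (1 / η) := by
      rw [Finset.mul_sum, Finset.sum_mul, ← Finset.sum_add_distrib, ← Finset.sum_add_distrib]
      exact Finset.sum_congr rfl fun k _ => by ring
    _ ≤ 4 * (30 * ∑ i, s i ^ (2 / 3 : ℝ)) + 6 + 2 * Real.log (1 / η) := by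
      gcongr
      · exact sum_half_pow_mul_entropy_le hs T
      · exact sum_half_pow_mul_add_two_le T
      · exact sum_half_pow_le_two T
    _ = _ := by ring

theorem sum_chainStep_le (hs : ∀ i, 0 ≤ s i) (hs1 : ∀ i, s i ≤ 1) {M n : ℝ} (hM : 0 < M)
    (hn : 0 < n) (hη : 0 < η) (hη1 : η ≤ 1) (T : ℕ) :
    ∑ k ∈ Finset.range T, chainStep s M n η k
      ≤ chainBound (Fintype.card ι) (∑ i, s i ^ 2) (∑ i, s i ^ (2 / 3 : ℝ)) M n η :=
  calc ∑ k ∈ Finset.range T, chainStep s M n η k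
      ≤ ∑ k ∈ Finset.range T, (23520 / √n * ((1 / 2) ^ k * √(chainExponent s η k))
          + 480 * M / n * ((1 / 2) ^ k * chainExponent s η k)) :=
        Finset.sum_le_sum fun k _ => chainStep_le s hM.ne' hn k
    _ = 23520 / √n * ∑ k ∈ Finset.range T, (1 / 2) ^ k * √(chainExponent s η k)
        + 480 * M / n * ∑ k ∈ Finset.range T, (1 / 2) ^ k * chainExponent s η k := by
        rw [Finset.sum_add_distrib, Finset.mul_sum, Finset.mul_sum]
    _ ≤ 23520 / √n * (20 * √((∑ i, s i ^ 2) * Real.log (Fintype.card ι)) + 38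
          + 2 * √(Real.log (1 / η)))
        + 480 * M / n * (120 * ∑ i, s i ^ (2 / 3 : ℝ) + 6 + 2 * Real.log (1 / η)) := by
        gcongr
        · exact sum_half_pow_mul_sqrt_chainExponent_le hs hs1 hη hη1 T
        · exact sum_half_pow_mul_chainExponent_le hs hη hη1 T
    _ = _ := by unfold chainBound; ring

open Classical in
/-- The links of the chaining at the level `k`: the pairs of a point `(x, u)` of `N (k + 1)²` and
a point `(x', u')` of `N k²` whose components are at distance at most `3 * 2⁻ᵏ`. -/
noncomputable def chainLinks (s : ι → ℝ) (N : ℕ → Finset (EuclideanSpace ℝ ι)) (k : ℕ) :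
    Finset ((EuclideanSpace ℝ ι × EuclideanSpace ℝ ι) ×
      (EuclideanSpace ℝ ι × EuclideanSpace ℝ ι)) :=
  {p ∈ (N (k + 1) ×ˢ N (k + 1)) ×ˢ (N k ×ˢ N k) |
    diagForm s (p.1.1 - p.2.1) ≤ (3 * (1 / 2) ^ k) ^ 2 ∧
    diagForm s (p.1.2 - p.2.2) ≤ (3 * (1 / 2) ^ k) ^ 2}

theorem mem_chainLinks {N : ℕ → Finset (EuclideanSpace ℝ ι)} {k : ℕ}
    {x u x' u' : EuclideanSpace ℝ ι} :
    ((x, u), (x', u')) ∈ chainLinks s N k ↔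
      ((x ∈ N (k + 1) ∧ u ∈ N (k + 1)) ∧ (x' ∈ N k ∧ u' ∈ N k)) ∧
        diagForm s (x - x') ≤ (3 * (1 / 2) ^ k) ^ 2 ∧
        diagForm s (u - u') ≤ (3 * (1 / 2) ^ k) ^ 2 := by
  simp only [chainLinks, Finset.mem_filter, Finset.mem_product]

theorem card_chainLinks_le {N : ℕ → Finset (EuclideanSpace ℝ ι)}
    (hN : ∀ k, ((N k).card : ℝ) ≤ Real.exp (entropy s ((1 / 2) ^ k))) (k : ℕ) :
    ((chainLinks s N k).card : ℝ) ≤ Real.exp (4 * entropy s ((1 / 2) ^ (k + 1))) := by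
  have hanti : entropy s ((1 / 2) ^ k) ≤ entropy s ((1 / 2) ^ (k + 1)) :=
    entropy_antitoneOn s (Set.mem_Ioi.2 (by positivity)) (Set.mem_Ioi.2 (by positivity))
      (pow_le_pow_of_le_one (by norm_num) (by norm_num) k.le_succ)
  set e := Real.exp (entropy s ((1 / 2) ^ (k + 1)))
  have hk : ((N k).card : ℝ) ≤ e := (hN k).trans (Real.exp_le_exp.2 hanti)
  calc ((chainLinks s N k).card : ℝ)
      ≤ (((N (k + 1) ×ˢ N (k + 1)) ×ˢ (N k ×ˢ N k)).card : ℝ) := by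
        exact_mod_cast Finset.card_filter_le _ _
    _ = (N (k + 1)).card * (N (k + 1)).card * ((N k).card * (N k).card) := by
        simp only [Finset.card_product, Nat.cast_mul]
    _ ≤ e * e * (e * e) := by gcongr <;> exact hN (k + 1)
    _ = Real.exp (4 * entropy s ((1 / 2) ^ (k + 1))) := by
        simp only [e, ← Real.exp_add]
        ring_nf

end Chaining

section TruncatedDeviation

variable {ι : Type*} [Fintype ι] {ν : Measure (EuclideanSpace ℝ ι)} {s : ι → ℝ} {G : ℝ → ℝ}
  {M η : ℝ} {n : ℕ}

theorem continuous_truncHessTerm (hG : Continuous G) (M : ℝ) (a : EuclideanSpace ℝ ι) :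
    Continuous fun p : EuclideanSpace ℝ ι × EuclideanSpace ℝ ι => truncHessTerm G M p.1 p.2 a := by
  unfold truncHessTerm hessTerm
  split_ifs
  · fun_prop
  · exact continuous_const

theorem integrable_truncHessTerm [IsFiniteMeasure ν] (hG : LipschitzWith 1 G) (hG0 : |G 0| ≤ 1)
    (hM : 0 ≤ M) {x u : EuclideanSpace ℝ ι} (hx : ‖x‖ ≤ 1) (hu : ‖u‖ ≤ 1) :
    Integrable (truncHessTerm G M x u) ν :=
  .of_bound (measurable_truncHessTerm hG.continuous.measurable M x u).aestronglyMeasurable _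
    (ae_of_all _ (abs_truncHessTerm_le hG hG0 hM hx hu))

theorem tendsto_sampleDev_truncHessTerm [IsFiniteMeasure ν] (hG : LipschitzWith 1 G)
    (hG0 : |G 0| ≤ 1) (hM : 0 ≤ M) (v : Fin n → EuclideanSpace ℝ ι)
    {x u : EuclideanSpace ℝ ι} {y w : ℕ → EuclideanSpace ℝ ι}
    (hy : ∀ k, ‖y k‖ ≤ 1) (hw : ∀ k, ‖w k‖ ≤ 1) (hyx : Filter.Tendsto y Filter.atTop (nhds x))
    (hwu : Filter.Tendsto w Filter.atTop (nhds u)) :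
    Filter.Tendsto (fun k => sampleDev ν (truncHessTerm G M (y k) (w k)) v) Filter.atTop
      (nhds (sampleDev ν (truncHessTerm G M x u) v)) := by
  have hlim (a : EuclideanSpace ℝ ι) : Filter.Tendsto (fun k => truncHessTerm G M (y k) (w k) a)
      Filter.atTop (nhds (truncHessTerm G M x u a)) :=
    ((continuous_truncHessTerm hG.continuous M a).tendsto (x, u)).comp
      (f := fun k => (y k, w k)) (hyx.prodMk_nhds hwu)
  exact tendsto_sampleDev (fun _ => measurable_truncHessTerm hG.continuous.measurable M _ _)
    (fun k => abs_truncHessTerm_le hG hG0 hM (hy k) (hw k)) hlim v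

/-- The samples for which, along some chaining link of level `k`, the increment of the deviation
of the truncated Hessian form exceeds `chainStep`. -/
def chainFailure (ν : Measure (EuclideanSpace ℝ ι)) (s : ι → ℝ) (G : ℝ → ℝ) (M η : ℝ) (n : ℕ)
    (N : ℕ → Finset (EuclideanSpace ℝ ι)) (k : ℕ) : Set (Fin n → EuclideanSpace ℝ ι) :=
  {v | ∃ p ∈ chainLinks s N k, chainStep s M n η k
    < |sampleDev ν (truncHessTerm G M p.1.1 p.1.2) v
      - sampleDev ν (truncHessTerm G M p.2.1 p.2.2) v|}

theorem abs_sampleDev_truncHessTerm_le_chainBound [IsFiniteMeasure ν] (hs : ∀ i, 0 < s i)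
    (hs1 : ∀ i, s i ≤ 1) (hG : LipschitzWith 1 G) (hG0 : |G 0| ≤ 1) (hM : 1 ≤ M) (hn : 0 < n)
    (hη : 0 < η) (hη1 : η ≤ 1) {N : ℕ → Finset (EuclideanSpace ℝ ι)}
    (hNball : ∀ k, ∀ y ∈ N k, ‖y‖ ≤ 1) (hN0 : N 0 = {0})
    (hNnet : ∀ k x, ‖x‖ ≤ 1 → ∃ y ∈ N k, diagForm s (x - y) ≤ 2 * ((1 / 2) ^ k) ^ 2)
    {v : Fin n → EuclideanSpace ℝ ι} (hv : ∀ k, v ∉ chainFailure ν s G M η n N k)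
    {x u : EuclideanSpace ℝ ι} (hx : ‖x‖ ≤ 1) (hu : ‖u‖ ≤ 1) :
    |sampleDev ν (truncHessTerm G M x u) v|
      ≤ chainBound (Fintype.card ι) (∑ i, s i ^ 2) (∑ i, s i ^ (2 / 3 : ℝ)) M n η := by
  have hM0 : 0 < M := one_pos.trans_le hM
  choose y hyN hyx using fun k => hNnet k x hx
  choose w hwN hwu using fun k => hNnet k u hu
  have hy0 : y 0 = 0 := by simpa [hN0] using hyN 0
  have hw0 : w 0 = 0 := by simpa [hN0] using hwN 0
  refine abs_le_of_tendsto_of_abs_sub_le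
    (by simp [sampleDev, truncHessTerm, hessTerm, hy0, hw0]) (fun k => ?_)
    (sum_chainStep_le (fun i => (hs i).le) hs1 hM0 (by exact_mod_cast hn) hη hη1)
    (tendsto_sampleDev_truncHessTerm hG hG0 hM0.le _ (fun k => hNball k _ (hyN k))
      (fun k => hNball k _ (hwN k)) (tendsto_of_diagForm_sub_le hs hyx)
      (tendsto_of_diagForm_sub_le hs hwu))
  by_contra! hlt
  exact hv k ⟨((y (k + 1), w (k + 1)), (y k, w k)), mem_chainLinks.2
    ⟨⟨⟨hyN _, hwN _⟩, hyN _, hwN _⟩, diagForm_succ_sub_le hyx k, diagForm_succ_sub_le hwu k⟩, hlt⟩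

variable {Ω : Type*} [MeasurableSpace Ω] {P : Measure Ω} {Y : Fin n → Ω → EuclideanSpace ℝ ι}

theorem measure_chainStep_lt_abs_sampleDev_sub_le [IsProbabilityMeasure ν]
    (h : HasSubgaussianDiag ν s) (hs : ∀ i, 0 ≤ s i) (hs1 : ∀ i, s i ≤ 1)
    (hG : LipschitzWith 1 G) (hG0 : |G 0| ≤ 1) (hM : 1 ≤ M) (hn : 0 < n)
    (hY : ∀ j, Measurable (Y j)) (hind : iIndepFun Y P) (hlaw : ∀ j, P.map (Y j) = ν)
    (hη : 0 < η) (hη1 : η ≤ 1) {x u x' u' : EuclideanSpace ℝ ι} (hx : ‖x‖ ≤ 1) (hu : ‖u‖ ≤ 1)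
    (hx' : ‖x'‖ ≤ 1) (hu' : ‖u'‖ ≤ 1) {k : ℕ}
    (hxx' : diagForm s (x - x') ≤ (3 * (1 / 2) ^ k) ^ 2)
    (huu' : diagForm s (u - u') ≤ (3 * (1 / 2) ^ k) ^ 2) :
    P {ω | chainStep s M n η k < |sampleDev ν (truncHessTerm G M x u) (fun j => Y j ω)
      - sampleDev ν (truncHessTerm G M x' u') (fun j => Y j ω)|}
      ≤ ENNReal.ofReal (2 * Real.exp (-chainExponent s η k)) := by
  have hM0 : 0 ≤ M := zero_le_one.trans hM
  have hmeas := measurable_truncHessTerm (ι := ι) hG.continuous.measurable M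
  obtain ⟨hint, hmoment⟩ := h.integrable_and_integral_truncHessTerm_sub_le hs hs1 hG hG0 hM hx' hu
    hu' (by positivity) hxx' huu'
  have hbern := measure_bernsteinRadius_lt_abs_mean_sub_integral_le hn hY hind hlaw
    ((hmeas x u).sub (hmeas x' u')) (by positivity) (by positivity) hint hmoment
    (chainExponent_nonneg s hη hη1 k)
  simp only [← sampleDev_sub (integrable_truncHessTerm hG hG0 hM0 hx hu)
    (integrable_truncHessTerm hG hG0 hM0 hx' hu')]
  exact hbern

theorem measure_chainFailure_le [IsProbabilityMeasure ν] (h : HasSubgaussianDiag ν s)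
    (hs : ∀ i, 0 ≤ s i) (hs1 : ∀ i, s i ≤ 1) (hG : LipschitzWith 1 G) (hG0 : |G 0| ≤ 1)
    (hM : 1 ≤ M) (hn : 0 < n) (hY : ∀ j, Measurable (Y j)) (hind : iIndepFun Y P)
    (hlaw : ∀ j, P.map (Y j) = ν) (hη : 0 < η) (hη1 : η ≤ 1)
    {N : ℕ → Finset (EuclideanSpace ℝ ι)}
    (hNcard : ∀ k, ((N k).card : ℝ) ≤ Real.exp (entropy s ((1 / 2) ^ k)))
    (hNball : ∀ k, ∀ y ∈ N k, ‖y‖ ≤ 1) (k : ℕ) :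
    P {ω | (fun j => Y j ω) ∈ chainFailure ν s G M η n N k}
      ≤ ENNReal.ofReal (η * (1 / 2) ^ (k + 1)) := by
  refine (measure_exists_mem_finset_le (chainLinks s N k) ?_).trans
    (ENNReal.ofReal_le_ofReal ?_) (b := ENNReal.ofReal ((chainLinks s N k).card
      * (2 * Real.exp (-chainExponent s η k))))
  · rintro ⟨⟨x, u⟩, ⟨x', u'⟩⟩ hp
    obtain ⟨⟨⟨hx, hu⟩, hx', hu'⟩, hxx', huu'⟩ := mem_chainLinks.1 hp
    exact measure_chainStep_lt_abs_sampleDev_sub_le h hs hs1 hG hG0 hM hn hY hind hlaw hη hη1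
      (hNball _ x hx) (hNball _ u hu) (hNball _ x' hx') (hNball _ u' hu') hxx' huu'
  · rw [← exp_mul_two_mul_exp_neg_chainExponent s hη k]
    gcongr
    exact card_chainLinks_le hNcard k

theorem tsum_ofReal_mul_half_pow_succ {η : ℝ} (hη : 0 ≤ η) :
    ∑' k : ℕ, ENNReal.ofReal (η * (1 / 2) ^ (k + 1)) = ENNReal.ofReal η := by
  have hsum : HasSum (fun k : ℕ => η * (1 / 2 : ℝ) ^ (k + 1)) η := by
    convert hasSum_geometric_two' η using 2 with k
    rw [pow_succ, one_div, inv_pow]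
    ring
  rw [← ENNReal.ofReal_tsum_of_nonneg (fun k => by positivity) hsum.summable, hsum.tsum_eq]

theorem measure_exists_chainBound_lt_abs_sampleDev_le [IsProbabilityMeasure ν]
    (h : HasSubgaussianDiag ν s) (hs : ∀ i, 0 < s i) (hs1 : ∀ i, s i ≤ 1)
    (hG : LipschitzWith 1 G) (hG0 : |G 0| ≤ 1) (hM : 1 ≤ M) (hn : 0 < n)
    (hY : ∀ j, Measurable (Y j)) (hind : iIndepFun Y P) (hlaw : ∀ j, P.map (Y j) = ν)
    (hη : 0 < η) (hη1 : η ≤ 1) :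
    P {ω | ∃ x u : EuclideanSpace ℝ ι, ‖x‖ ≤ 1 ∧ ‖u‖ ≤ 1 ∧
      chainBound (Fintype.card ι) (∑ i, s i ^ 2) (∑ i, s i ^ (2 / 3 : ℝ)) M n η
        < |sampleDev ν (truncHessTerm G M x u) (fun j => Y j ω)|} ≤ ENNReal.ofReal η := by
  obtain ⟨N, hNcard, hNball, hN0, hNnet⟩ := exists_nets hs hs1
  have hsub : {ω | ∃ x u : EuclideanSpace ℝ ι, ‖x‖ ≤ 1 ∧ ‖u‖ ≤ 1 ∧
      chainBound (Fintype.card ι) (∑ i, s i ^ 2) (∑ i, s i ^ (2 / 3 : ℝ)) M n η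
        < |sampleDev ν (truncHessTerm G M x u) (fun j => Y j ω)|}
      ⊆ ⋃ k, {ω | (fun j => Y j ω) ∈ chainFailure ν s G M η n N k} := by
    rintro ω ⟨x, u, hx, hu, hlt⟩
    by_contra hω
    simp only [Set.mem_iUnion, Set.mem_ofPred_eq, not_exists] at hω
    exact hlt.not_ge (abs_sampleDev_truncHessTerm_le_chainBound hs hs1 hG hG0 hM hn hη hη1 hNball
      hN0 hNnet hω hx hu)
  calc _ ≤ P (⋃ k, {ω | (fun j => Y j ω) ∈ chainFailure ν s G M η n N k}) := measure_mono hsub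
    _ ≤ ∑' k, P {ω | (fun j => Y j ω) ∈ chainFailure ν s G M η n N k} := measure_iUnion_le _
    _ ≤ ∑' k : ℕ, ENNReal.ofReal (η * (1 / 2) ^ (k + 1)) := ENNReal.tsum_le_tsum fun k =>
        measure_chainFailure_le h (fun i => (hs i).le) hs1 hG hG0 hM hn hY hind hlaw hη hη1
          hNcard hNball k
    _ = ENNReal.ofReal η := tsum_ofReal_mul_half_pow_succ hη.le

end TruncatedDeviation

section Truncation

variable {α : Type*} [MeasurableSpace α] {ν : Measure α}

theorem abs_setIntegral_le_sqrt_integral_sq_mul [IsFiniteMeasure ν] {f : α → ℝ}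
    (hf : MemLp f 2 ν) {B : Set α} (hB : MeasurableSet B) :
    |∫ a in B, f a ∂ν| ≤ √((∫ a, f a ^ 2 ∂ν) * ν.real B) := by
  have hconj : Real.HolderConjugate 2 2 := .two_two
  have hone : MemLp (B.indicator fun _ => (1 : ℝ)) (ENNReal.ofReal 2) ν :=
    memLp_indicator_const _ hB _ (Or.inr (measure_ne_top ν B))
  have hholder := integral_mul_norm_le_Lp_mul_Lq hconj (by simpa using hf) hone
  calc |∫ a in B, f a ∂ν| = |∫ a, f a * B.indicator (fun _ => (1 : ℝ)) a ∂ν| := by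
        rw [← integral_indicator hB]
        congr 2 with a
        by_cases ha : a ∈ B <;> simp [ha]
    _ ≤ ∫ a, ‖f a‖ * ‖B.indicator (fun _ => (1 : ℝ)) a‖ ∂ν := by
        simpa only [Real.norm_eq_abs, norm_mul] using
          norm_integral_le_integral_norm fun a => f a * B.indicator (fun _ => (1 : ℝ)) a
    _ ≤ √(∫ a, f a ^ 2 ∂ν) * √(ν.real B) := by
        refine hholder.trans_eq ?_
        have hind (a : α) : B.indicator (fun _ => (1 : ℝ)) a ^ 2
            = B.indicator (fun _ => (1 : ℝ)) a := by
          by_cases ha : a ∈ B <;> simp [ha]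
        simp only [Real.rpow_two, Real.norm_eq_abs, sq_abs, hind, integral_indicator_const _ hB,
          smul_eq_mul, mul_one, ← Real.sqrt_eq_rpow]
    _ = √((∫ a, f a ^ 2 ∂ν) * ν.real B) :=
        (Real.sqrt_mul (integral_nonneg fun _ => sq_nonneg _) _).symm

theorem measure_exists_mem_le_of_map_eq {Ω : Type*} [MeasurableSpace Ω] {P : Measure Ω} {n : ℕ}
    (hn : 0 < n) {Y : Fin n → Ω → α} (hY : ∀ j, Measurable (Y j)) (hlaw : ∀ j, P.map (Y j) = ν)
    {B : Set α} (hB : MeasurableSet B) {η : ℝ} (hνB : ν B ≤ ENNReal.ofReal (η / n)) :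
    P {ω | ∃ j, Y j ω ∈ B} ≤ ENNReal.ofReal η := by
  have hn0 : (n : ℝ) ≠ 0 := by exact_mod_cast hn.ne'
  calc P {ω | ∃ j, Y j ω ∈ B} = P (⋃ j, Y j ⁻¹' B) := by
        congr 1
        ext ω
        simp
    _ ≤ ∑ j, P (Y j ⁻¹' B) := measure_iUnion_fintype_le _ _
    _ = ∑ _j : Fin n, ν B := Finset.sum_congr rfl fun j _ => by
        rw [← Measure.map_apply (hY j) hB, hlaw j]
    _ ≤ ∑ _j : Fin n, ENNReal.ofReal (η / n) := Finset.sum_le_sum fun _ _ => hνB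
    _ = ENNReal.ofReal η := by
        rw [Finset.sum_const, Finset.card_univ, Fintype.card_fin, ← ENNReal.ofReal_nsmul,
          nsmul_eq_mul, mul_div_cancel₀ _ hn0]

variable {ι : Type*} [Fintype ι] {ν : Measure (EuclideanSpace ℝ ι)} {s : ι → ℝ} {G : ℝ → ℝ}
  {M : ℝ} {x u : EuclideanSpace ℝ ι}

/-- A radius that all `n` samples stay below with probability at least `1 - η`, where `d₁` stands
for `∑ i, s i ^ 2`. -/
noncomputable def truncRadius (d₁ n η : ℝ) : ℝ :=
  √(4 * d₁ + 8 * Real.log (3 * n / η))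

theorem one_le_truncRadius {d₁ n η : ℝ} (hd₁ : 1 ≤ d₁) (hn : 1 ≤ n) (hη : 0 < η) (hη1 : η ≤ 1) :
    1 ≤ truncRadius d₁ n η := by
  have hlog : 0 ≤ Real.log (3 * n / η) := Real.log_nonneg (by rw [one_le_div hη]; linarith)
  rw [truncRadius, Real.one_le_sqrt]
  linarith

theorem HasSubgaussianDiag.measure_truncRadius_lt_norm_le [IsProbabilityMeasure ν]
    (h : HasSubgaussianDiag ν s) (hs : ∀ i, 0 < s i) (hs1 : ∀ i, s i ≤ 1) {n η : ℝ}
    (hn : 0 < n) (hη : 0 < η) :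
    ν {a | truncRadius (∑ i, s i ^ 2) n η < ‖a‖} ≤ ENNReal.ofReal (η / n) := by
  refine (measure_mono fun a ha => ?_).trans (h.measure_lt_norm_sq_le hs hs1 (div_pos hη hn))
  rw [Set.mem_ofPred_eq, truncRadius, show 3 * n / η = 3 / (η / n) by field_simp] at ha
  exact Real.lt_sq_of_sqrt_lt ha

theorem HasSubgaussianDiag.memLp_hessTerm (h : HasSubgaussianDiag ν s) (hs : ∀ i, 0 ≤ s i)
    (hs1 : ∀ i, s i ≤ 1) (hG : LipschitzWith 1 G) (hG0 : |G 0| ≤ 1) (hx : ‖x‖ ≤ 1)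
    (hu : ‖u‖ ≤ 1) :
    MemLp (hessTerm G x u) 2 ν ∧ ∫ a, hessTerm G x u a ^ 2 ∂ν ≤ 3072000 := by
  have hmeas : Measurable (hessTerm G x u) := by
    have := hG.continuous.measurable
    unfold hessTerm
    fun_prop
  obtain ⟨hint, hle⟩ := integrable_and_integral_le_of_lintegral_ofReal_le
    (hmeas.pow_const 2).aestronglyMeasurable (fun a => sq_nonneg _) (by norm_num)
    (h.lintegral_hessTerm_sq_le hs hs1 hG hG0 hx hu)
  exact ⟨(memLp_two_iff_integrable_sq hmeas.aestronglyMeasurable).2 hint, hle⟩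

theorem integral_hessTerm_sub_integral_truncHessTerm (hint : Integrable (hessTerm G x u) ν)
    (M : ℝ) :
    ∫ a, hessTerm G x u a ∂ν - ∫ a, truncHessTerm G M x u a ∂ν
      = ∫ a in {a | M < ‖a‖}, hessTerm G x u a ∂ν := by
  have hball : MeasurableSet {a : EuclideanSpace ℝ ι | ‖a‖ ≤ M} :=
    measurableSet_le measurable_norm measurable_const
  have hcompl : {a : EuclideanSpace ℝ ι | M < ‖a‖} = {a | ‖a‖ ≤ M}ᶜ := by
    ext a
    simp
  have htrunc : truncHessTerm G M x u = {a | ‖a‖ ≤ M}.indicator (hessTerm G x u) := by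
    ext a
    simp only [truncHessTerm, Set.indicator_apply, Set.mem_ofPred_eq]
  rw [htrunc, integral_indicator hball, hcompl, ← integral_add_compl hball hint,
    add_sub_cancel_left]

theorem HasSubgaussianDiag.abs_integral_hessTerm_sub_integral_truncHessTerm_le
    [IsFiniteMeasure ν] (h : HasSubgaussianDiag ν s) (hs : ∀ i, 0 ≤ s i) (hs1 : ∀ i, s i ≤ 1)
    (hG : LipschitzWith 1 G) (hG0 : |G 0| ≤ 1) {n : ℝ} (hn : 0 < n)
    (hν : ν {a | M < ‖a‖} ≤ ENNReal.ofReal (1 / n)) (hx : ‖x‖ ≤ 1) (hu : ‖u‖ ≤ 1) :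
    |∫ a, hessTerm G x u a ∂ν - ∫ a, truncHessTerm G M x u a ∂ν| ≤ 2000 / √n := by
  obtain ⟨hmem, hsq⟩ := h.memLp_hessTerm hs hs1 hG hG0 hx hu
  rw [integral_hessTerm_sub_integral_truncHessTerm (hmem.integrable one_le_two)]
  calc |∫ a in {a | M < ‖a‖}, hessTerm G x u a ∂ν|
      ≤ √((∫ a, hessTerm G x u a ^ 2 ∂ν) * ν.real {a | M < ‖a‖}) :=
        abs_setIntegral_le_sqrt_integral_sq_mul hmem
          (measurableSet_lt measurable_const measurable_norm)
    _ ≤ √(2000 ^ 2 * (1 / n)) := by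
        gcongr
        · linarith
        · exact ENNReal.toReal_le_of_le_ofReal (by positivity) hν
    _ = 2000 / √n := by
        rw [Real.sqrt_mul (by positivity), Real.sqrt_sq (by norm_num), Real.sqrt_div zero_le_one,
          Real.sqrt_one, mul_one_div]

theorem sampleDev_hessTerm_eq_of_norm_le {n : ℕ} {v : Fin n → EuclideanSpace ℝ ι}
    (hv : ∀ j, ‖v j‖ ≤ M) (ν : Measure (EuclideanSpace ℝ ι)) (G : ℝ → ℝ)
    (x u : EuclideanSpace ℝ ι) :
    sampleDev ν (hessTerm G x u) v = sampleDev ν (truncHessTerm G M x u) v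
      - (∫ a, hessTerm G x u a ∂ν - ∫ a, truncHessTerm G M x u a ∂ν) := by
  have hterm (j : Fin n) : truncHessTerm G M x u (v j) = hessTerm G x u (v j) := if_pos (hv j)
  simp only [sampleDev, hterm]
  ring

theorem measure_exists_chainBound_lt_abs_sampleDev_hessTerm_le {Ω : Type*} [MeasurableSpace Ω]
    {P : Measure Ω} [IsProbabilityMeasure ν] (h : HasSubgaussianDiag ν s) (hs : ∀ i, 0 < s i)
    (hs1 : ∀ i, s i ≤ 1) (hsum : 1 ≤ ∑ i, s i ^ 2) (hG : LipschitzWith 1 G) (hG0 : |G 0| ≤ 1)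
    {n : ℕ} (hn : 0 < n)
    {Y : Fin n → Ω → EuclideanSpace ℝ ι} (hY : ∀ j, Measurable (Y j)) (hind : iIndepFun Y P)
    (hlaw : ∀ j, P.map (Y j) = ν) {η : ℝ} (hη : 0 < η) (hη1 : η ≤ 1) :
    P {ω | ∃ x u : EuclideanSpace ℝ ι, ‖x‖ ≤ 1 ∧ ‖u‖ ≤ 1 ∧
      chainBound (Fintype.card ι) (∑ i, s i ^ 2) (∑ i, s i ^ (2 / 3 : ℝ))
          (truncRadius (∑ i, s i ^ 2) n η) n η + 2000 / √n
        < |sampleDev ν (hessTerm G x u) (fun j => Y j ω)|} ≤ ENNReal.ofReal (2 * η) := by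
  have hn0 : (0 : ℝ) < n := by exact_mod_cast hn
  set M := truncRadius (∑ i, s i ^ 2) n η
  have hM : 1 ≤ M := one_le_truncRadius hsum (by exact_mod_cast hn) hη hη1
  have htail : ν {a | M < ‖a‖} ≤ ENNReal.ofReal (η / n) :=
    h.measure_truncRadius_lt_norm_le hs hs1 hn0 hη
  have hbias {x u : EuclideanSpace ℝ ι} (hx : ‖x‖ ≤ 1) (hu : ‖u‖ ≤ 1) :=
    h.abs_integral_hessTerm_sub_integral_truncHessTerm_le (fun i => (hs i).le) hs1 hG hG0 hn0
      (htail.trans (ENNReal.ofReal_le_ofReal (by gcongr))) hx hu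
  have hchain := measure_exists_chainBound_lt_abs_sampleDev_le h hs hs1 hG hG0 hM hn hY hind hlaw
    hη hη1
  have hlarge := measure_exists_mem_le_of_map_eq hn hY hlaw
    (measurableSet_lt measurable_const measurable_norm) htail
  rw [two_mul, ENNReal.ofReal_add hη.le hη.le]
  refine (measure_mono ?_).trans ((measure_union_le _ _).trans (add_le_add hchain hlarge))
  rintro ω ⟨x, u, hx, hu, hlt⟩
  refine or_iff_not_imp_right.2 fun hω => ⟨x, u, hx, hu, ?_⟩
  have hnorm (j : Fin n) : ‖Y j ω‖ ≤ M := not_lt.1 fun hj => hω ⟨j, hj⟩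
  rw [sampleDev_hessTerm_eq_of_norm_le hnorm] at hlt
  linarith [hbias hx hu, abs_sub (sampleDev ν (truncHessTerm G M x u) fun j => Y j ω)
    (∫ a, hessTerm G x u a ∂ν - ∫ a, truncHessTerm G M x u a ∂ν)]

end Truncation

section Rate

variable {d : ℕ} {d₁ d₃ n δ : ℝ}

theorem half_le_log_natCast (hd : 2 ≤ d) : 1 / 2 ≤ Real.log d := by
  have h2 : (2 : ℝ) ≤ d := by exact_mod_cast hd
  linarith [Real.log_le_log two_pos h2, Real.log_two_gt_d9]

theorem half_le_log_one_div (hδ : 0 < δ) (hδ2 : δ ≤ 1 / 2) : 1 / 2 ≤ Real.log (1 / δ) := by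
  have h2 : 2 ≤ 1 / δ := by
    rw [le_div_iff₀ hδ]
    linarith
  linarith [Real.log_le_log two_pos h2, Real.log_two_gt_d9]

theorem half_le_sqrt_log_add_sqrt_mul_log (hd₁ : 1 ≤ d₁) (hδ : 0 < δ)
    (hdδ : 2 ≤ d ∨ δ ≤ 1 / 2) :
    1 / 2 ≤ √(Real.log (1 / δ)) + √(d₁ * Real.log d) := by
  rcases hdδ with hd | hδ2
  · have hd₁log : 1 / 2 ≤ d₁ * Real.log d := by nlinarith [half_le_log_natCast hd]
    have hsqrt : 1 / 2 ≤ √(d₁ * Real.log d) := Real.le_sqrt_of_sq_le (by linarith)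
    linarith [Real.sqrt_nonneg (Real.log (1 / δ))]
  · have hsqrt : 1 / 2 ≤ √(Real.log (1 / δ)) :=
      Real.le_sqrt_of_sq_le (by linarith [half_le_log_one_div hδ hδ2])
    linarith [Real.sqrt_nonneg (d₁ * Real.log d)]

theorem le_two_mul_mul_log_add_log_one_div (hd₃ : 1 ≤ d₃) (hd₃d : d₃ ≤ d) (hδ : 0 < δ)
    (hδ1 : δ < 1) (hdδ : 2 ≤ d ∨ δ ≤ 1 / 2) :
    d₃ ≤ 2 * (d₃ * Real.log d + Real.log (1 / δ)) := by
  have hlog : 0 ≤ Real.log (1 / δ) := Real.log_nonneg (by rw [one_le_div hδ]; exact hδ1.le)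
  by_cases hd : 2 ≤ d
  · nlinarith [half_le_log_natCast hd]
  · have hd1 : (d : ℝ) ≤ 1 := by exact_mod_cast (by omega : d ≤ 1)
    have : 0 ≤ d₃ * Real.log d := mul_nonneg (by linarith) (Real.log_natCast_nonneg d)
    linarith [half_le_log_one_div hδ (hdδ.resolve_left hd)]

theorem log_one_div_div_four_le (hδ : 0 < δ) :
    Real.log (1 / (δ / 4)) ≤ Real.log (1 / δ) + 7 / 5 := by
  rw [show 1 / (δ / 4) = 1 / δ * 2 ^ 2 by field_simp; norm_num,
    Real.log_mul (by positivity) (by norm_num), Real.log_pow]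
  push_cast
  linarith [Real.log_two_lt_d9]

theorem sqrt_log_one_div_div_four_le (hδ : 0 < δ) (hδ1 : δ < 1) :
    √(Real.log (1 / (δ / 4))) ≤ √(Real.log (1 / δ)) + 6 / 5 := by
  have hlog : 0 ≤ Real.log (1 / δ) := Real.log_nonneg (by rw [one_le_div hδ]; exact hδ1.le)
  rw [Real.sqrt_le_left (by positivity)]
  nlinarith [Real.sq_sqrt hlog, log_one_div_div_four_le hδ, Real.sqrt_nonneg (Real.log (1 / δ))]

theorem truncRadius_div_four_le (hd₁ : 1 ≤ d₁) (hn : 1 ≤ n) (hδ : 0 < δ) (hδ1 : δ < 1) :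
    truncRadius d₁ n (δ / 4) ≤ 6 * √(d₁ + Real.log (n / δ)) := by
  have hlog : 0 ≤ Real.log (n / δ) := Real.log_nonneg (by rw [one_le_div hδ]; linarith)
  have hmul : Real.log (3 * n / (δ / 4)) = Real.log 12 + Real.log (n / δ) := by
    rw [← Real.log_mul (by norm_num) (by positivity)]
    congr 1
    field_simp
    norm_num
  have h12 : Real.log 12 ≤ 4 * Real.log 2 := by
    rw [show (4 : ℝ) = (4 : ℕ) by norm_num, ← Real.log_pow]
    exact Real.log_le_log (by norm_num) (by norm_num)
  rw [truncRadius, Real.sqrt_le_left (by positivity), mul_pow, Real.sq_sqrt (by linarith), hmul]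
  linarith [Real.log_two_lt_d9]

theorem chainBound_add_le_devRate (hd₁ : 1 ≤ d₁) (hd₃ : 1 ≤ d₃) (hd₃d : d₃ ≤ d) (hn : 1 ≤ n)
    (hδ : 0 < δ) (hδ1 : δ < 1) (hdδ : 2 ≤ d ∨ δ ≤ 1 / 2) :
    chainBound d d₁ d₃ (truncRadius d₁ n (δ / 4)) n (δ / 4) + 2000 / √n
      ≤ 10000000 * devRate d d₁ d₃ n δ := by
  have : 0 ≤ Real.log d := Real.log_natCast_nonneg d
  have hlog : 0 ≤ Real.log (1 / δ) := Real.log_nonneg (by rw [one_le_div hδ]; exact hδ1.le)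
  have hlog4 : 0 ≤ Real.log (1 / (δ / 4)) :=
    Real.log_nonneg (by rw [one_le_div (by positivity)]; linarith)
  set E := d₃ * Real.log d + Real.log (1 / δ)
  set T := √(Real.log (1 / δ)) + √(d₁ * Real.log d)
  set R := √(d₁ + Real.log (n / δ))
  have hE : d₃ ≤ 2 * E := le_two_mul_mul_log_add_log_one_div hd₃ hd₃d hδ hδ1 hdδ
  have hT : 1 / 2 ≤ T := half_le_sqrt_log_add_sqrt_mul_log hd₁ hδ hdδ
  have hfirst : 23520 * (20 * √(d₁ * Real.log d) + 38 + 2 * √(Real.log (1 / (δ / 4)))) / √n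
      + 2000 / √n ≤ 10000000 * (T / √n) := by
    rw [← add_div, ← mul_div_assoc]
    gcongr
    linarith [sqrt_log_one_div_div_four_le hδ hδ1, Real.sqrt_nonneg (Real.log (1 / δ)),
      Real.sqrt_nonneg (d₁ * Real.log d)]
  have hmid : 120 * d₃ + 6 + 2 * Real.log (1 / (δ / 4)) ≤ 300 * E := by
    have : 0 ≤ d₃ * Real.log d := by positivity
    linarith [log_one_div_div_four_le hδ]
  have hsecond : 480 * truncRadius d₁ n (δ / 4) * (120 * d₃ + 6 + 2 * Real.log (1 / (δ / 4))) / n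
      ≤ 10000000 * (E * R / n) :=
    calc _ ≤ 480 * (6 * R) * (300 * E) / n := by
          gcongr
          exact truncRadius_div_four_le hd₁ hn hδ hδ1
      _ = 864000 * (E * R / n) := by ring
      _ ≤ 10000000 * (E * R / n) := by
          gcongr
          norm_num
  unfold chainBound devRate
  linarith

theorem devRate_antitone {m : ℝ} (hd₁ : 1 ≤ d₁) (hd₃ : 0 ≤ d₃) (hm : 1 ≤ m) (hmn : m ≤ n)
    (hδ : 0 < δ) (hδ1 : δ < 1) :
    devRate d d₁ d₃ n δ ≤ devRate d d₁ d₃ m δ := by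
  have hm0 : 0 < m := by linarith
  have hn0 : 0 < n := by linarith
  have : 0 ≤ Real.log d := Real.log_natCast_nonneg d
  have hlog : 0 ≤ Real.log (1 / δ) := Real.log_nonneg (by rw [one_le_div hδ]; exact hδ1.le)
  have hlogm : 0 ≤ Real.log (m / δ) := Real.log_nonneg (by rw [one_le_div hδ]; linarith)
  have hlogn : Real.log (n / δ) = Real.log (n / m) + Real.log (m / δ) := by
    rw [← Real.log_mul (by positivity) (by positivity)]
    congr 1
    field_simp
  have hratio : 1 ≤ n / m := by rwa [one_le_div hm0]
  have hsqrt : √(d₁ + Real.log (n / δ)) ≤ n / m * √(d₁ + Real.log (m / δ)) := by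
    rw [Real.sqrt_le_left (by positivity), mul_pow, Real.sq_sqrt (by linarith), hlogn]
    set c := d₁ + Real.log (m / δ)
    have : 1 ≤ c := le_add_of_le_of_nonneg hd₁ hlogm
    calc d₁ + (Real.log (n / m) + Real.log (m / δ)) ≤ c + (n / m - 1) := by
          linarith [Real.log_le_sub_one_of_pos (show 0 < n / m by positivity)]
      _ ≤ n / m * c := by nlinarith
      _ ≤ (n / m) ^ 2 * c := by
          gcongr
          exact le_self_pow₀ hratio two_ne_zero
  unfold devRate
  gcongr ?_ + ?_
  · rw [div_le_div_iff₀ hn0 hm0]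
    calc _ ≤ (d₃ * Real.log d + Real.log (1 / δ)) * (n / m * √(d₁ + Real.log (m / δ))) * m := by
          gcongr
      _ = _ := by field_simp
  · gcongr

theorem measure_exists_devRate_lt_abs_sampleDev_hessTerm_le {Ω ι : Type*} [MeasurableSpace Ω]
    {P : Measure Ω} [Fintype ι] {ν : Measure (EuclideanSpace ℝ ι)} [IsProbabilityMeasure ν]
    {s : ι → ℝ} (h : HasSubgaussianDiag ν s) (hs : ∀ i, 0 < s i) (hs1 : ∀ i, s i ≤ 1)
    (hsum₁ : 1 ≤ ∑ i, s i ^ 2) (hsum₃ : 1 ≤ ∑ i, s i ^ (2 / 3 : ℝ)) {G : ℝ → ℝ}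
    (hG : LipschitzWith 1 G) (hG0 : |G 0| ≤ 1) {n : ℕ} (hn : 0 < n)
    {Y : Fin n → Ω → EuclideanSpace ℝ ι} (hY : ∀ j, Measurable (Y j)) (hind : iIndepFun Y P)
    (hlaw : ∀ j, P.map (Y j) = ν) (hδ : 0 < δ) (hδ1 : δ < 1)
    (hdδ : 2 ≤ Fintype.card ι ∨ δ ≤ 1 / 2) :
    P {ω | ∃ x u : EuclideanSpace ℝ ι, ‖x‖ ≤ 1 ∧ ‖u‖ ≤ 1 ∧
      10000000 * devRate (Fintype.card ι) (∑ i, s i ^ 2) (∑ i, s i ^ (2 / 3 : ℝ)) n δ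
        < |sampleDev ν (hessTerm G x u) (fun j => Y j ω)|} ≤ ENNReal.ofReal (δ / 2) := by
  have hcard : ∑ i, s i ^ (2 / 3 : ℝ) ≤ Fintype.card ι :=
    calc ∑ i, s i ^ (2 / 3 : ℝ) ≤ ∑ _i : ι, (1 : ℝ) := Finset.sum_le_sum fun i _ =>
          Real.rpow_le_one (hs i).le (hs1 i) (by norm_num)
      _ = Fintype.card ι := by simp
  have hrate := chainBound_add_le_devRate hsum₁ hsum₃ hcard
    (by exact_mod_cast hn : (1 : ℝ) ≤ n) hδ hδ1 hdδ
  have hdev := measure_exists_chainBound_lt_abs_sampleDev_hessTerm_le h hs hs1 hsum₁ hG hG0 hn hY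
    hind hlaw (η := δ / 4) (by positivity) (by linarith)
  rw [show 2 * (δ / 4) = δ / 2 by ring] at hdev
  refine (measure_mono ?_).trans hdev
  rintro ω ⟨x, u, hx, hu, hlt⟩
  exact ⟨x, u, hx, hu, hrate.trans_lt hlt⟩

end Rate

section Spectral

theorem toEuclideanLin_apply_eigenvectorBasis {ι : Type*} [Fintype ι] [DecidableEq ι]
    {S : Matrix ι ι ℝ} (hS : S.IsHermitian) (i : ι) :
    Matrix.toEuclideanLin S (hS.eigenvectorBasis i)
      = hS.eigenvalues i • hS.eigenvectorBasis i := by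
  ext j
  simpa using congrFun (hS.mulVec_eigenvectorBasis i) j

theorem dotProduct_mulVec_eq_sum_eigenvalues {ι : Type*} [Fintype ι] [DecidableEq ι]
    {S : Matrix ι ι ℝ} (hS : S.IsHermitian) (y : EuclideanSpace ℝ ι) :
    y.ofLp ⬝ᵥ (S *ᵥ y.ofLp) = ∑ i, hS.eigenvalues i * hS.eigenvectorBasis.repr y i ^ 2 := by
  set e := hS.eigenvectorBasis
  have hSy : Matrix.toEuclideanLin S y = ∑ i, (e.repr y i * hS.eigenvalues i) • e i := by
    conv_lhs => rw [← e.sum_repr y]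
    rw [map_sum]
    refine Finset.sum_congr rfl fun i _ => ?_
    rw [map_smul, toEuclideanLin_apply_eigenvectorBasis, smul_smul]
  have hinner : y.ofLp ⬝ᵥ (S *ᵥ y.ofLp) = inner ℝ (Matrix.toEuclideanLin S y) y := by
    rw [EuclideanSpace.inner_eq_star_dotProduct]
    simp
  rw [hinner, hSy, sum_inner]
  refine Finset.sum_congr rfl fun i _ => ?_
  rw [real_inner_smul_left, OrthonormalBasis.repr_apply_apply]
  ring

variable {d : ℕ} {S : Matrix (Fin d) (Fin d) ℝ}

/-- The ratio `σ_i / σ₁` of the square root of the `i`-th eigenvalue to the largest one. -/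
noncomputable def sigmaRatio (hS : S.IsHermitian) (i : Fin d) : ℝ :=
  √(hS.eigenvalues i) / sigmaOne hS

theorem sqrt_eigenvalues_le_sigmaOne (hS : S.IsHermitian) (i : Fin d) :
    √(hS.eigenvalues i) ≤ sigmaOne hS :=
  Real.sqrt_le_sqrt (le_ciSup (Set.finite_range _).bddAbove i)

theorem sigmaOne_pos (hd : 0 < d) (hS : S.PosDef) : 0 < sigmaOne hS.isHermitian :=
  (Real.sqrt_pos.2 (hS.eigenvalues_pos ⟨0, hd⟩)).trans_le (sqrt_eigenvalues_le_sigmaOne _ _)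

theorem sigmaRatio_pos (hS : S.PosDef) (i : Fin d) : 0 < sigmaRatio hS.isHermitian i :=
  div_pos (Real.sqrt_pos.2 (hS.eigenvalues_pos i)) (sigmaOne_pos (Fin.pos i) hS)

theorem sigmaRatio_le_one (hS : S.IsHermitian) (i : Fin d) : sigmaRatio hS i ≤ 1 :=
  div_le_one_of_le₀ (sqrt_eigenvalues_le_sigmaOne hS i) (Real.sqrt_nonneg _)

theorem exists_sigmaRatio_eq_one (hd : 0 < d) (hS : S.PosDef) :
    ∃ i, sigmaRatio hS.isHermitian i = 1 := by
  have : Nonempty (Fin d) := ⟨⟨0, hd⟩⟩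
  obtain ⟨i, hi⟩ := exists_eq_ciSup_of_finite (f := hS.isHermitian.eigenvalues)
  refine ⟨i, ?_⟩
  rw [sigmaRatio, hi]
  exact div_self (sigmaOne_pos hd hS).ne'

theorem one_le_effDim (hd : 0 < d) (hS : S.PosDef) (r : ℕ) : 1 ≤ effDim hS.isHermitian r := by
  obtain ⟨i, hi⟩ := exists_sigmaRatio_eq_one hd hS
  calc (1 : ℝ) = sigmaRatio hS.isHermitian i ^ ((2 : ℝ) / r) := by rw [hi, Real.one_rpow]
    _ ≤ ∑ j, sigmaRatio hS.isHermitian j ^ ((2 : ℝ) / r) :=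
      Finset.single_le_sum (f := fun j => sigmaRatio hS.isHermitian j ^ ((2 : ℝ) / r))
        (fun j _ => Real.rpow_nonneg (sigmaRatio_pos hS j).le _) (Finset.mem_univ i)

theorem effDim_one_eq_sum_sq (hS : S.IsHermitian) : effDim hS 1 = ∑ i, sigmaRatio hS i ^ 2 := by
  refine Finset.sum_congr rfl fun i _ => ?_
  rw [← Real.rpow_natCast]
  norm_num [sigmaRatio]

theorem effDim_three_eq_sum_rpow (hS : S.IsHermitian) :
    effDim hS 3 = ∑ i, sigmaRatio hS i ^ (2 / 3 : ℝ) := by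
  refine Finset.sum_congr rfl fun i _ => ?_
  norm_num [sigmaRatio]

/-- The linear change of coordinates to the eigenbasis of `S`, divided by `σ₁`. It maps an
`S`-subgaussian vector to one with the diagonal variance proxy `(σ_i / σ₁)²`. -/
noncomputable def whiten (hS : S.IsHermitian) (a : Vec d) : Vec d :=
  (sigmaOne hS)⁻¹ • hS.eigenvectorBasis.repr a

theorem measurable_whiten (hS : S.IsHermitian) : Measurable (whiten hS) :=
  (hS.eigenvectorBasis.repr.continuous.const_smul (sigmaOne hS)⁻¹).measurable

theorem inner_whiten_repr (hS : S.IsHermitian) (a y : Vec d) :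
    inner ℝ (whiten hS a) (hS.eigenvectorBasis.repr y) = (sigmaOne hS)⁻¹ * inner ℝ a y := by
  rw [whiten, real_inner_smul_left, LinearIsometryEquiv.inner_map_map]

theorem dotProduct_mulVec_eq_sigmaOne_sq_mul_diagForm (hd : 0 < d) (hS : S.PosDef) (y : Vec d) :
    y.ofLp ⬝ᵥ (S *ᵥ y.ofLp) = sigmaOne hS.isHermitian ^ 2 *
      diagForm (sigmaRatio hS.isHermitian) (hS.isHermitian.eigenvectorBasis.repr y) := by
  have := sigmaOne_pos hd hS
  rw [dotProduct_mulVec_eq_sum_eigenvalues hS.isHermitian, diagForm, Finset.mul_sum]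
  refine Finset.sum_congr rfl fun i _ => ?_
  rw [sigmaRatio, div_pow, Real.sq_sqrt (hS.eigenvalues_pos i).le]
  field_simp

end Spectral

section Whitening

variable {Ω : Type*} [MeasurableSpace Ω] {P : Measure Ω} {d : ℕ} {S : Matrix (Fin d) (Fin d) ℝ}
  {a : Ω → Vec d}

theorem IsSubgaussianVec.measureReal_lt_abs_inner_le (h : IsSubgaussianVec P S a) {t : ℝ}
    (ht : 0 < t) (y : Vec d) :
    P.real {ω | t < |inner ℝ (a ω) y|}
      ≤ 2 * Real.exp (-(1 / 2) * (t ^ 2 / (y.ofLp ⬝ᵥ (S *ᵥ y.ofLp)))) := by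
  rcases eq_or_ne y 0 with rfl | hy
  · exact h t ht 0 (by simp)
  have hn : 0 < ‖y‖ := norm_pos_iff.2 hy
  have hunit := h (t / ‖y‖) (by positivity) (‖y‖⁻¹ • y) (by
    rw [norm_smul, norm_inv, norm_norm, inv_mul_cancel₀ hn.ne'])
  have hset : {ω | t / ‖y‖ < |inner ℝ (a ω) (‖y‖⁻¹ • y)|} = {ω | t < |inner ℝ (a ω) y|} := by
    ext ω
    rw [Set.mem_ofPred_eq, Set.mem_ofPred_eq, real_inner_smul_right, abs_mul, abs_inv, abs_norm,
      div_eq_inv_mul, mul_lt_mul_iff_right₀ (by positivity)]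
  have hform : (‖y‖⁻¹ • y).ofLp ⬝ᵥ (S *ᵥ (‖y‖⁻¹ • y).ofLp)
      = ‖y‖⁻¹ ^ 2 * (y.ofLp ⬝ᵥ (S *ᵥ y.ofLp)) := by
    simp only [WithLp.ofLp_smul, Matrix.mulVec_smul, smul_dotProduct, dotProduct_smul, smul_eq_mul]
    ring
  rwa [hset, hform, div_pow, div_eq_inv_mul (t ^ 2), ← inv_pow,
    mul_div_mul_left _ _ (by positivity)] at hunit

theorem IsSubgaussianVec.measure_mul_lt_abs_inner_le [IsFiniteMeasure P] (hS : S.PosDef)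
    (h : IsSubgaussianVec P S a) {y : Vec d} {t q : ℝ} (ht : 0 < t) (hq : 0 < q)
    (hyq : y.ofLp ⬝ᵥ (S *ᵥ y.ofLp) ≤ q ^ 2) :
    P {ω | t * q < |inner ℝ (a ω) y|} ≤ ENNReal.ofReal (2 * Real.exp (-(t ^ 2 / 2))) := by
  rcases eq_or_ne y 0 with rfl | hy
  · have hempty : {ω | t * q < |inner ℝ (a ω) (0 : Vec d)|} = ∅ := by
      refine Set.eq_empty_iff_forall_notMem.2 fun ω hω => ?_
      rw [Set.mem_ofPred_eq, inner_zero_right, abs_zero] at hω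
      exact hω.not_ge (by positivity)
    rw [hempty, measure_empty]
    exact zero_le
  have hpos : 0 < y.ofLp ⬝ᵥ (S *ᵥ y.ofLp) := by
    simpa using hS.dotProduct_mulVec_pos (x := y.ofLp) (by simpa using hy)
  rw [← ofReal_measureReal]
  refine ENNReal.ofReal_le_ofReal ((h.measureReal_lt_abs_inner_le (by positivity) y).trans ?_)
  gcongr
  have hexp : t ^ 2 ≤ (t * q) ^ 2 / (y.ofLp ⬝ᵥ (S *ᵥ y.ofLp)) := by
    rw [le_div_iff₀ hpos, mul_pow]
    gcongr
  linarith

theorem IsSubgaussianVec.hasSubgaussianDiag_map_whiten [IsProbabilityMeasure P] (hd : 0 < d)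
    (hS : S.PosDef) (ha : Measurable a) (h : IsSubgaussianVec P S a) :
    HasSubgaussianDiag ((P.map a).map (whiten hS.isHermitian)) (sigmaRatio hS.isHermitian) := by
  intro w q hq hw
  set σ := sigmaOne hS.isHermitian
  have hσ : 0 < σ := sigmaOne_pos hd hS
  have hT := measurable_whiten hS.isHermitian
  rw [lintegral_map (by fun_prop) hT, lintegral_map (by fun_prop) ha]
  obtain ⟨y, rfl⟩ := hS.isHermitian.eigenvectorBasis.repr.surjective w
  have hin : ∀ ω, inner ℝ (whiten hS.isHermitian (a ω))
      (hS.isHermitian.eigenvectorBasis.repr y) / q = inner ℝ (a ω) y / (σ * q) := fun ω => by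
    rw [inner_whiten_repr, mul_comm σ, ← div_div, div_eq_inv_mul _ σ, mul_div_assoc]
  simp_rw [hin]
  refine lintegral_exp_sq_le_of_tail (by fun_prop) fun t ht => ?_
  have hform : y.ofLp ⬝ᵥ (S *ᵥ y.ofLp) ≤ (σ * q) ^ 2 := by
    rw [dotProduct_mulVec_eq_sigmaOne_sq_mul_diagForm hd hS, mul_pow]
    gcongr
  have htail := h.measure_mul_lt_abs_inner_le hS ht (by positivity : 0 < σ * q) hform
  simpa only [abs_div, abs_of_pos (show 0 < σ * q by positivity),
    lt_div_iff₀ (show 0 < σ * q by positivity)] using htail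

end Whitening

section Rescaling

theorem devScale_nonneg {R s L c : ℝ} (hR : 0 ≤ R) (hs : 0 ≤ s) (hL : 0 ≤ L) (hc : 0 ≤ c) :
    0 ≤ devScale R s L c := by
  rw [devScale]
  positivity

variable {g : ℝ → ℝ} {L : ℝ≥0} {R σ : ℝ}

theorem eq_zero_of_devScale_eq_zero (hg : LipschitzWith L g) (hg0 : 0 ≤ g 0) (hR : 0 ≤ R)
    (hσ : 0 < σ) (h : devScale R σ L (g 0) = 0) {c t : ℝ} (ht : |t| ≤ c * R) : g t = 0 := by
  obtain ⟨hRL, hg00⟩ := (add_eq_zero_iff_of_nonneg (by positivity) (by positivity)).1 h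
  replace hg00 : g 0 = 0 := by simpa [hσ.ne'] using hg00
  replace hRL : R * L = 0 := by simpa [hσ.ne'] using hRL
  refine abs_nonpos_iff.1 ?_
  calc |g t| = dist (g t) (g 0) := by rw [hg00, Real.dist_eq, sub_zero]
    _ ≤ L * |t| := by simpa [Real.dist_eq] using hg.dist_le_mul t 0
    _ ≤ L * (c * R) := by gcongr
    _ = c * (R * L) := by ring
    _ = 0 := by rw [hRL, mul_zero]

/-- The curvature `g` rescaled to be `1`-Lipschitz and bounded by `1` at `0`, as seen by data points
whitened at scale `σ` and by points of the unit ball standing for the ball of radius `R`. -/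
noncomputable def unitCurvature (g : ℝ → ℝ) (L R σ t : ℝ) : ℝ :=
  g (R * σ * t) * (σ ^ 2 / devScale R σ L (g 0))

theorem lipschitzWith_unitCurvature (hg : LipschitzWith L g) (hg0 : 0 ≤ g 0) (hR : 0 ≤ R)
    (hσ : 0 < σ) (h : 0 < devScale R σ L (g 0)) : LipschitzWith 1 (unitCurvature g L R σ) := by
  refine LipschitzWith.of_dist_le_mul fun t t' => ?_
  have hle : R * σ ^ 3 * L ≤ devScale R σ L (g 0) := le_add_of_nonneg_right (by positivity)
  calc dist (unitCurvature g L R σ t) (unitCurvature g L R σ t')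
      = dist (g (R * σ * t)) (g (R * σ * t')) * (σ ^ 2 / devScale R σ L (g 0)) := by
        rw [Real.dist_eq, Real.dist_eq, unitCurvature, unitCurvature, ← sub_mul, abs_mul,
          abs_of_pos (show 0 < σ ^ 2 / devScale R σ L (g 0) by positivity)]
    _ ≤ L * dist (R * σ * t) (R * σ * t') * (σ ^ 2 / devScale R σ L (g 0)) := by
        gcongr
        exact hg.dist_le_mul _ _
    _ = R * σ ^ 3 * L / devScale R σ L (g 0) * dist t t' := by
        rw [Real.dist_eq, Real.dist_eq, ← mul_sub, abs_mul,
          abs_of_nonneg (show 0 ≤ R * σ by positivity)]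
        ring
    _ ≤ (1 : ℝ≥0) * dist t t' := by
        rw [NNReal.coe_one]
        gcongr
        rwa [div_le_one h]

theorem abs_unitCurvature_zero_le_one (hg0 : 0 ≤ g 0) (hR : 0 ≤ R) (hσ : 0 < σ)
    (h : 0 < devScale R σ L (g 0)) : |unitCurvature g L R σ 0| ≤ 1 := by
  have hle : σ ^ 2 * g 0 ≤ devScale R σ L (g 0) := le_add_of_nonneg_left (by positivity)
  rw [unitCurvature, mul_zero, abs_of_nonneg (by positivity), mul_div_assoc', div_le_one h]
  linarith

end Rescaling

section Sample

open scoped Pointwise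

variable {d : ℕ} {S : Matrix (Fin d) (Fin d) ℝ}

theorem hessTerm_unitCurvature_whiten (hd : 0 < d) (hS : S.PosDef) (g : ℝ → ℝ) (L R : ℝ)
    (x u v : Vec d) :
    hessTerm (unitCurvature g L R (sigmaOne hS.isHermitian))
        (hS.isHermitian.eigenvectorBasis.repr x) (hS.isHermitian.eigenvectorBasis.repr u)
        (whiten hS.isHermitian v)
      = hessTerm g (R • x) u v / devScale R (sigmaOne hS.isHermitian) L (g 0) := by
  have := sigmaOne_pos hd hS
  rw [hessTerm, hessTerm, inner_whiten_repr, inner_whiten_repr, real_inner_smul_right,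
    unitCurvature, mul_assoc R, mul_inv_cancel_left₀ this.ne']
  field_simp

theorem sampleDev_hessTerm_unitCurvature_whiten (hd : 0 < d) (hS : S.PosDef) {g : ℝ → ℝ}
    (hg : Measurable g) (L R : ℝ) (ν : Measure (Vec d)) {n : ℕ} (v : Fin n → Vec d)
    (x u : Vec d) :
    sampleDev (ν.map (whiten hS.isHermitian))
        (hessTerm (unitCurvature g L R (sigmaOne hS.isHermitian))
          (hS.isHermitian.eigenvectorBasis.repr x) (hS.isHermitian.eigenvectorBasis.repr u))
        (fun j => whiten hS.isHermitian (v j))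
      = sampleDev ν (hessTerm g (R • x) u) v / devScale R (sigmaOne hS.isHermitian) L (g 0) := by
  have hmeas : Measurable (hessTerm (unitCurvature g L R (sigmaOne hS.isHermitian))
      (hS.isHermitian.eigenvectorBasis.repr x) (hS.isHermitian.eigenvectorBasis.repr u)) := by
    unfold hessTerm unitCurvature
    fun_prop
  rw [sampleDev, integral_map (measurable_whiten _).aemeasurable hmeas.aestronglyMeasurable]
  simp_rw [hessTerm_unitCurvature_whiten hd hS]
  rw [integral_div, ← Finset.sum_div, sampleDev]
  ring

variable {Ω : Type*} [MeasurableSpace Ω] {P : Measure Ω} {n : ℕ} {a : Fin n → Ω → Vec d}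
  {ν : Measure (Vec d)} {g : ℝ → ℝ} {L : ℝ≥0} {R δ : ℝ}

theorem sampleDev_hessTerm_eq_zero (hd : 0 < d) (hS : S.PosDef) (hg : LipschitzWith L g)
    (hg0 : 0 ≤ g 0) (hR : 0 ≤ R) (h : devScale R (sigmaOne hS.isHermitian) L (g 0) = 0)
    {x : Vec d} (hx : ‖x‖ ≤ R) (u : Vec d) (v : Fin n → Vec d) :
    sampleDev ν (hessTerm g x u) v = 0 := by
  have hzero : ∀ w : Vec d, g (inner ℝ w x) = 0 := fun w =>
    eq_zero_of_devScale_eq_zero hg hg0 hR (sigmaOne_pos hd hS) h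
      ((abs_real_inner_le_norm w x).trans (mul_le_mul_of_nonneg_left hx (norm_nonneg w)))
  simp [sampleDev, hessTerm, hzero]

theorem measure_exists_devScale_mul_devRate_lt_abs_sampleDev_hessTerm_le
    [IsProbabilityMeasure P] (hd : 0 < d) (hn : 0 < n) (hS : S.PosDef)
    (ha : ∀ j, Measurable (a j)) (hind : iIndepFun a P) (hlaw : ∀ j, P.map (a j) = ν)
    (hsub : ∀ j, IsSubgaussianVec P S (a j)) (hg : LipschitzWith L g) (hg0 : 0 ≤ g 0)
    (hR : 0 ≤ R) (hδ : 0 < δ) (hδ1 : δ < 1) (hdδ : 2 ≤ d ∨ δ ≤ 1 / 2) :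
    P {ω | ∃ x u : Vec d, ‖x‖ ≤ R ∧ ‖u‖ ≤ 1 ∧
      10000000 * devScale R (sigmaOne hS.isHermitian) L (g 0)
        * devRate d (effDim hS.isHermitian 1) (effDim hS.isHermitian 3) n δ
        < |sampleDev ν (hessTerm g x u) (fun j => a j ω)|} ≤ ENNReal.ofReal (δ / 2) := by
  have hσ := sigmaOne_pos hd hS
  rcases (devScale_nonneg hR hσ.le L.coe_nonneg hg0).eq_or_lt' with hA | hA
  · refine le_of_eq_of_le (measure_mono_null (t := ∅) ?_ measure_empty) zero_le
    rintro ω ⟨x, u, hx, -, hlt⟩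
    rw [sampleDev_hessTerm_eq_zero hd hS hg hg0 hR hA hx, hA] at hlt
    simp at hlt
  have hT := measurable_whiten hS.isHermitian
  have hsubν : HasSubgaussianDiag (ν.map (whiten hS.isHermitian)) (sigmaRatio hS.isHermitian) := by
    rw [← hlaw ⟨0, hn⟩]
    exact (hsub ⟨0, hn⟩).hasSubgaussianDiag_map_whiten hd hS (ha _)
  have : IsProbabilityMeasure ν := by
    rw [← hlaw ⟨0, hn⟩]
    exact Measure.isProbabilityMeasure_map (ha _).aemeasurable
  have : IsProbabilityMeasure (ν.map (whiten hS.isHermitian)) :=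
    Measure.isProbabilityMeasure_map hT.aemeasurable
  have hwhite := measure_exists_devRate_lt_abs_sampleDev_hessTerm_le (P := P) hsubν
    (sigmaRatio_pos hS) (sigmaRatio_le_one _)
    (effDim_one_eq_sum_sq hS.isHermitian ▸ one_le_effDim hd hS 1)
    (effDim_three_eq_sum_rpow hS.isHermitian ▸ one_le_effDim hd hS 3)
    (lipschitzWith_unitCurvature hg hg0 hR hσ hA) (abs_unitCurvature_zero_le_one hg0 hR hσ hA) hn
    (fun j => hT.comp (ha j)) (hind.comp (fun _ => whiten hS.isHermitian) fun _ => hT)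
    (fun j => by rw [← hlaw j, Measure.map_map hT (ha j)]) hδ hδ1 (by simpa using hdδ)
  refine (measure_mono ?_).trans hwhite
  rintro ω ⟨x, u, hx, hu, hlt⟩
  obtain ⟨y, hy, rfl⟩ : ∃ y : Vec d, ‖y‖ ≤ 1 ∧ R • y = x := by
    have hball : x ∈ R • Metric.closedBall (0 : Vec d) 1 := by
      rwa [smul_unitClosedBall, Real.norm_of_nonneg hR, mem_closedBall_zero_iff]
    simpa [Set.mem_smul_set] using hball
  refine ⟨hS.isHermitian.eigenvectorBasis.repr y, hS.isHermitian.eigenvectorBasis.repr u,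
    by simpa using hy, by simpa using hu, ?_⟩
  simp only [Function.comp_apply]
  rw [sampleDev_hessTerm_unitCurvature_whiten hd hS hg.continuous.measurable, abs_div,
    abs_of_pos hA, lt_div_iff₀ hA, Fintype.card_fin, ← effDim_one_eq_sum_sq,
    ← effDim_three_eq_sum_rpow]
  linarith

end Sample

section Bregman

theorem sub_sub_nonneg_of_second_deriv_nonneg {p p' p'' : ℝ → ℝ}
    (hp : ∀ t, HasDerivAt p (p' t) t) (hp' : ∀ t, HasDerivAt p' (p'' t) t)
    (hp'' : ∀ t ∈ Set.Icc (0 : ℝ) 1, 0 ≤ p'' t) : 0 ≤ p 1 - p 0 - p' 0 := by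
  have hmono : MonotoneOn p' (Set.Icc 0 1) := by
    refine monotoneOn_of_deriv_nonneg (convex_Icc 0 1)
      (fun t _ => (hp' t).continuousAt.continuousWithinAt)
      (fun t _ => (hp' t).differentiableAt.differentiableWithinAt) fun t ht => ?_
    rw [(hp' t).deriv]
    exact hp'' t (interior_subset ht)
  obtain ⟨c, hc, hslope⟩ := exists_hasDerivAt_eq_slope p p' one_pos
    (fun t _ => (hp t).continuousAt.continuousWithinAt) fun t _ => hp t
  have hle := hmono (Set.left_mem_Icc.2 zero_le_one) ⟨hc.1.le, hc.2.le⟩ hc.1.le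
  rw [hslope, sub_zero, div_one] at hle
  linarith

variable {d : ℕ} {f g : Vec d → ℝ} {f' g' : Vec d → Vec d} {H K : Vec d → Vec d →L[ℝ] Vec d}
  {x y : Vec d}

theorem bregman_eq (hf : HasGradientAt f (f' y) y) :
    bregman f x y = f x - f y - inner ℝ (f' y) (x - y) := by
  rw [bregman, hf.gradient]

theorem bregman_nonneg_of_hessian_nonneg (hf : ∀ z, HasGradientAt f (f' z) z)
    (hf' : ∀ z, HasFDerivAt f' (H z) z)
    (h : ∀ z ∈ segment ℝ y x, 0 ≤ inner ℝ (H z (x - y)) (x - y)) : 0 ≤ bregman f x y := by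
  have hline : ∀ t : ℝ, HasDerivAt (fun t : ℝ => y + t • (x - y)) (x - y) t := fun t => by
    simpa using ((hasDerivAt_id t).smul_const (x - y)).const_add y
  have hp : ∀ t : ℝ, HasDerivAt (fun t : ℝ => f (y + t • (x - y)))
      (inner ℝ (f' (y + t • (x - y))) (x - y)) t := fun t => by
    simpa [Function.comp_def] using (hf (y + t • (x - y))).hasFDerivAt.comp_hasDerivAt t (hline t)
  have hp' : ∀ t : ℝ, HasDerivAt (fun t : ℝ => inner ℝ (f' (y + t • (x - y))) (x - y))
      (inner ℝ (H (y + t • (x - y)) (x - y)) (x - y)) t := fun t => by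
    simpa using ((hf' (y + t • (x - y))).comp_hasDerivAt t (hline t)).inner ℝ
      (hasDerivAt_const t (x - y))
  have hmv := sub_sub_nonneg_of_second_deriv_nonneg hp hp' fun t ht => h _ <| by
    rw [segment_eq_image']
    exact ⟨t, ht, rfl⟩
  rw [bregman_eq (hf y)]
  simpa using hmv

theorem bregman_le_mul_bregman_of_hessian_le (hf : ∀ z, HasGradientAt f (f' z) z)
    (hf' : ∀ z, HasFDerivAt f' (H z) z) (hg : ∀ z, HasGradientAt g (g' z) z)
    (hg' : ∀ z, HasFDerivAt g' (K z) z) {c : ℝ}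
    (h : ∀ z ∈ segment ℝ y x, inner ℝ (H z (x - y)) (x - y) ≤ c * inner ℝ (K z (x - y)) (x - y)) :
    bregman f x y ≤ c * bregman g x y := by
  have hgrad : ∀ z, HasGradientAt (fun z => c * g z - f z) (c • g' z - f' z) z := fun z => by
    rw [hasGradientAt_iff_hasFDerivAt, map_sub, map_smul]
    exact ((hg z).hasFDerivAt.const_mul c).sub (hf z).hasFDerivAt
  have hnonneg := bregman_nonneg_of_hessian_nonneg (x := x) (y := y) hgrad
    (fun z => ((hg' z).const_smul c).sub (hf' z)) fun z hz => by
      simpa [inner_sub_left, real_inner_smul_left] using h z hz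
  rw [bregman_eq (f' := fun z => c • g' z - f' z) (hgrad y), inner_sub_left,
    real_inner_smul_left] at hnonneg
  rw [bregman_eq (hf y), bregman_eq (hg y)]
  linarith

theorem relCondNumber_mem_Icc {D : Set (Vec d)} {F φ : Vec d → ℝ} {c : ℝ} (hc : 0 < c)
    (hD : D.Nontrivial) (hpos : ∀ x ∈ D, ∀ y ∈ D, x ≠ y → 0 < bregman F x y)
    (hFφ : ∀ x ∈ D, ∀ y ∈ D, bregman F x y ≤ bregman φ x y)
    (hφF : ∀ x ∈ D, ∀ y ∈ D, bregman φ x y ≤ c * bregman F x y) :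
    relCondNumber D F φ ∈ Set.Icc 1 c := by
  obtain ⟨x, hx, y, hy, hxy⟩ := hD
  have hφ : 0 < bregman φ x y := (hpos x hx y hy hxy).trans_le (hFφ x hx y hy)
  set r := bregman F x y / bregman φ x y
  have hone_mem : ∀ a ∈ D, ∀ b ∈ D, bregman F a b ≤ 1 * bregman φ a b := by simpa using hFφ
  have hinv_mem : ∀ a ∈ D, ∀ b ∈ D, c⁻¹ * bregman φ a b ≤ bregman F a b := fun a ha b hb => by
    rw [inv_mul_le_iff₀ hc]
    exact hφF a ha b hb
  have hsmooth_le : relSmoothConst D F φ ≤ 1 :=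
    csInf_le ⟨r, fun M hM => (div_le_iff₀ hφ).2 (hM x hx y hy)⟩ hone_mem
  have hle_smooth : r ≤ relSmoothConst D F φ :=
    le_csInf ⟨1, hone_mem⟩ fun M hM => (div_le_iff₀ hφ).2 (hM x hx y hy)
  have hle_convex : c⁻¹ ≤ relStrongConvConst D F φ :=
    le_csSup ⟨r, fun M hM => (le_div_iff₀ hφ).2 (hM x hx y hy)⟩ hinv_mem
  have hconvex_le : relStrongConvConst D F φ ≤ r :=
    csSup_le ⟨c⁻¹, hinv_mem⟩ fun M hM => (le_div_iff₀ hφ).2 (hM x hx y hy)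
  have hconvex_pos : 0 < relStrongConvConst D F φ := (inv_pos.2 hc).trans_le hle_convex
  rw [relCondNumber, Set.mem_Icc, one_le_div hconvex_pos, div_le_iff₀ hconvex_pos]
  exact ⟨hconvex_le.trans hle_smooth, hsmooth_le.trans ((inv_le_iff_one_le_mul₀' hc).1 hle_convex)⟩

end Bregman

section Risk

variable {d n N : ℕ}

/-- The gradient of `regRisk`. -/
noncomputable def riskGrad (ℓs : Fin n → ℝ → ℝ) (v : Fin n → Vec d) (lam : ℝ) (x : Vec d) : Vec d :=
  (1 / (n : ℝ)) • ∑ j, deriv (ℓs j) (inner ℝ (v j) x) • v j + lam • x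

/-- The Hessian of `regRisk` for losses with common second derivative `g`. -/
noncomputable def riskHess (g : ℝ → ℝ) (v : Fin n → Vec d) (lam : ℝ) (x : Vec d) :
    Vec d →L[ℝ] Vec d :=
  (1 / (n : ℝ)) • ∑ j, g (inner ℝ (v j) x) • (innerSL ℝ (v j)).smulRight (v j)
    + lam • ContinuousLinearMap.id ℝ (Vec d)

/-- The quadratic form of the Hessian of the empirical risk at `x`, without the regularization. -/
noncomputable def hessForm (g : ℝ → ℝ) (v : Fin n → Vec d) (x u : Vec d) : ℝ :=
  1 / (n : ℝ) * ∑ j, hessTerm g x u (v j)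

variable {g : ℝ → ℝ}

theorem inner_riskHess_apply (g : ℝ → ℝ) (v : Fin n → Vec d) (lam : ℝ) (x u w : Vec d) :
    inner ℝ (riskHess g v lam x u) w
      = 1 / (n : ℝ) * ∑ j, g (inner ℝ (v j) x) * (inner ℝ (v j) u * inner ℝ (v j) w)
        + lam * inner ℝ u w := by
  simp only [riskHess, _root_.add_apply, _root_.smul_apply,
    _root_.sum_apply, ContinuousLinearMap.smulRight_apply, innerSL_apply_apply,
    ContinuousLinearMap.id_apply, inner_add_left, real_inner_smul_left, sum_inner]

theorem inner_riskHess_self (g : ℝ → ℝ) (v : Fin n → Vec d) (lam : ℝ) (x u : Vec d) :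
    inner ℝ (riskHess g v lam x u) u = hessForm g v x u + lam * ‖u‖ ^ 2 := by
  simp_rw [inner_riskHess_apply, hessForm, hessTerm, real_inner_self_eq_norm_sq, sq]

theorem hessForm_nonneg (hg : ∀ t, 0 ≤ g t) (v : Fin n → Vec d) (x u : Vec d) :
    0 ≤ hessForm g v x u :=
  mul_nonneg (by positivity) (Finset.sum_nonneg fun _ _ => mul_nonneg (hg _) (sq_nonneg _))

theorem hessForm_smul (g : ℝ → ℝ) (v : Fin n → Vec d) (x u : Vec d) (r : ℝ) :
    hessForm g v x (r • u) = r ^ 2 * hessForm g v x u := by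
  simp only [hessForm, hessTerm, real_inner_smul_right, mul_pow, Finset.mul_sum]
  exact Finset.sum_congr rfl fun _ _ => by ring

theorem abs_hessForm_sub_le_mul_norm_sq {v : Fin n → Vec d} {w : Fin N → Vec d} {x : Vec d} {c : ℝ}
    (h : ∀ u, ‖u‖ ≤ 1 → |hessForm g w x u - hessForm g v x u| ≤ c) (u : Vec d) :
    |hessForm g w x u - hessForm g v x u| ≤ c * ‖u‖ ^ 2 := by
  rcases eq_or_ne u 0 with rfl | hu
  · simp [hessForm, hessTerm]
  have hn : 0 < ‖u‖ := norm_pos_iff.2 hu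
  have hunit := h (‖u‖⁻¹ • u) (by rw [norm_smul, norm_inv, norm_norm, inv_mul_cancel₀ hn.ne'])
  rwa [hessForm_smul, hessForm_smul, ← mul_sub, abs_mul, abs_of_nonneg (by positivity), inv_pow,
    inv_mul_le_iff₀ (by positivity), mul_comm] at hunit

theorem opNorm_le_of_symmetric_of_abs_inner_le {E : Type*} [NormedAddCommGroup E]
    [InnerProductSpace ℝ E] {T : E →L[ℝ] E} (hT : ∀ u w, inner ℝ (T u) w = inner ℝ (T w) u)
    {c : ℝ} (hc : 0 ≤ c) (h : ∀ u, |inner ℝ (T u) u| ≤ c * ‖u‖ ^ 2) : ‖T‖ ≤ c := by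
  refine T.opNorm_le_of_unit_norm hc fun u hu => ?_
  rcases eq_or_ne (T u) 0 with hTu | hTu
  · simpa [hTu] using hc
  have hn : 0 < ‖T u‖ := norm_pos_iff.2 hTu
  set w := ‖T u‖⁻¹ • T u with hw
  have hw1 : ‖w‖ = 1 := by rw [hw, norm_smul, norm_inv, norm_norm, inv_mul_cancel₀ hn.ne']
  have hinner : inner ℝ (T u) w = ‖T u‖ := by
    rw [hw, real_inner_smul_right, real_inner_self_eq_norm_sq]
    field_simp
  have hpolar : inner ℝ (T (u + w)) (u + w) - inner ℝ (T (u - w)) (u - w)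
      = 4 * inner ℝ (T u) w := by
    simp only [map_add, map_sub, inner_add_left, inner_add_right, inner_sub_left, inner_sub_right]
    rw [hT w u]
    ring
  have hplus := (abs_le.1 (h (u + w))).2
  have hminus := (abs_le.1 (h (u - w))).1
  have hpar := congrArg (c * ·) (parallelogram_law_with_norm ℝ u w)
  simp only [hu, hw1] at hpar
  linarith

theorem norm_riskHess_sub_le {v : Fin n → Vec d} {w : Fin N → Vec d} {x : Vec d} {lam c : ℝ}
    (hc : 0 ≤ c) (h : ∀ u, |hessForm g w x u - hessForm g v x u| ≤ c * ‖u‖ ^ 2) :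
    ‖riskHess g w lam x - riskHess g v lam x‖ ≤ c := by
  refine opNorm_le_of_symmetric_of_abs_inner_le (fun a b => ?_) hc fun u => ?_
  · simp only [_root_.sub_apply, inner_sub_left, inner_riskHess_apply]
    rw [real_inner_comm b a]
    simp_rw [mul_comm (inner ℝ _ b) (inner ℝ _ a)]
  · rw [_root_.sub_apply, inner_sub_left, inner_riskHess_self, inner_riskHess_self,
      add_sub_add_right_eq_sub]
    exact h u

variable {ℓs : Fin n → ℝ → ℝ} {ℓt : Fin N → ℝ → ℝ}

theorem hasGradientAt_regRisk (hℓ : ∀ j, Differentiable ℝ (ℓs j)) (v : Fin n → Vec d) (lam : ℝ)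
    (x : Vec d) : HasGradientAt (regRisk ℓs v lam) (riskGrad ℓs v lam x) x := by
  rw [hasGradientAt_iff_hasFDerivAt]
  have hterm : ∀ j, HasFDerivAt (fun y : Vec d => ℓs j (inner ℝ (v j) y))
      (deriv (ℓs j) (inner ℝ (v j) x) • innerSL ℝ (v j)) x := fun j =>
    (hℓ j (inner ℝ (v j) x)).hasDerivAt.comp_hasFDerivAt x (innerSL ℝ (v j)).hasFDerivAt
  have hsum := ((HasFDerivAt.fun_sum fun j (_ : j ∈ Finset.univ) => hterm j).const_mul
    (1 / (n : ℝ))).add ((hasStrictFDerivAt_norm_sq x).hasFDerivAt.const_mul (lam / 2))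
  refine hsum.congr_fderiv ?_
  ext w
  simp only [riskGrad, _root_.add_apply, _root_.smul_apply,
    _root_.sum_apply, innerSL_apply_apply, InnerProductSpace.toDual_apply_apply,
    inner_add_left, real_inner_smul_left, sum_inner, smul_eq_mul, nsmul_eq_mul]
  push_cast
  ring

theorem hasFDerivAt_riskGrad (hℓ' : ∀ j t, HasDerivAt (deriv (ℓs j)) (g t) t)
    (v : Fin n → Vec d) (lam : ℝ) (x : Vec d) :
    HasFDerivAt (riskGrad ℓs v lam) (riskHess g v lam x) x := by
  have hterm : ∀ j, HasFDerivAt (fun y : Vec d => deriv (ℓs j) (inner ℝ (v j) y) • v j)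
      (g (inner ℝ (v j) x) • (innerSL ℝ (v j)).smulRight (v j)) x := fun j => by
    refine (((hℓ' j (inner ℝ (v j) x)).comp_hasFDerivAt x
      (innerSL ℝ (v j)).hasFDerivAt).smul_const (v j)).congr_fderiv ?_
    ext w
    simp [mul_assoc]
  exact ((HasFDerivAt.fun_sum fun j (_ : j ∈ Finset.univ) => hterm j).const_smul
    (1 / (n : ℝ))).add ((hasFDerivAt_id x).const_smul lam)

theorem hess_regRisk (hℓ : ∀ j, Differentiable ℝ (ℓs j))
    (hℓ' : ∀ j t, HasDerivAt (deriv (ℓs j)) (g t) t) (v : Fin n → Vec d) (lam : ℝ) (x : Vec d) :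
    hess (regRisk ℓs v lam) x = riskHess g v lam x := by
  have hgrad : gradient (regRisk ℓs v lam) = riskGrad ℓs v lam :=
    funext fun y => (hasGradientAt_regRisk hℓ v lam y).gradient
  rw [hess, hgrad]
  exact (hasFDerivAt_riskGrad hℓ' v lam x).fderiv

theorem bregman_regRisk_le_mul_bregman_regRisk {g' : ℝ → ℝ} (hs : ∀ j, Differentiable ℝ (ℓs j))
    (hs' : ∀ j t, HasDerivAt (deriv (ℓs j)) (g t) t) (ht : ∀ j, Differentiable ℝ (ℓt j))
    (ht' : ∀ j t, HasDerivAt (deriv (ℓt j)) (g' t) t) {v : Fin n → Vec d} {w : Fin N → Vec d}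
    {lam lam' c R : ℝ}
    (h : ∀ z, ‖z‖ ≤ R → ∀ u, hessForm g' w z u + lam' * ‖u‖ ^ 2
      ≤ c * (hessForm g v z u + lam * ‖u‖ ^ 2)) {x y : Vec d} (hx : ‖x‖ ≤ R) (hy : ‖y‖ ≤ R) :
    bregman (regRisk ℓt w lam') x y ≤ c * bregman (regRisk ℓs v lam) x y := by
  refine bregman_le_mul_bregman_of_hessian_le (hasGradientAt_regRisk ht w lam')
    (hasFDerivAt_riskGrad ht' w lam') (hasGradientAt_regRisk hs v lam)
    (hasFDerivAt_riskGrad hs' v lam) fun z hz => ?_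
  have hzR : z ∈ Metric.closedBall (0 : Vec d) R :=
    (convex_closedBall _ _).segment_subset (by simpa using hy) (by simpa using hx) hz
  rw [inner_riskHess_self, inner_riskHess_self]
  exact h z (by simpa using hzR) (x - y)

theorem half_mul_norm_sq_le_bregman_regRisk (hℓ : ∀ j, Differentiable ℝ (ℓs j))
    (hℓ' : ∀ j t, HasDerivAt (deriv (ℓs j)) (g t) t) (hg : ∀ t, 0 ≤ g t) (v : Fin n → Vec d)
    (lam : ℝ) (x y : Vec d) : lam / 2 * ‖x - y‖ ^ 2 ≤ bregman (regRisk ℓs v lam) x y := by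
  have hsplit : bregman (regRisk ℓs v lam) x y
      = bregman (regRisk ℓs v 0) x y + lam / 2 * ‖x - y‖ ^ 2 := by
    rw [bregman_eq (hasGradientAt_regRisk hℓ v lam y), bregman_eq (hasGradientAt_regRisk hℓ v 0 y),
      norm_sub_sq_real, real_inner_comm y x]
    simp only [regRisk, riskGrad, inner_add_left, real_inner_smul_left, inner_sub_right,
      real_inner_self_eq_norm_sq]
    ring
  have hnonneg : 0 ≤ bregman (regRisk ℓs v 0) x y :=
    bregman_nonneg_of_hessian_nonneg (hasGradientAt_regRisk hℓ v 0) (hasFDerivAt_riskGrad hℓ' v 0)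
      fun z _ => by
        rw [inner_riskHess_self, zero_mul, add_zero]
        exact hessForm_nonneg hg v z _
  linarith

theorem relCondNumber_regRisk_mem_Icc (hs : ∀ j, Differentiable ℝ (ℓs j))
    (hs' : ∀ j t, HasDerivAt (deriv (ℓs j)) (g t) t) (ht : ∀ j, Differentiable ℝ (ℓt j))
    (ht' : ∀ j t, HasDerivAt (deriv (ℓt j)) (g t) t) (hg : ∀ t, 0 ≤ g t) {v : Fin n → Vec d}
    {w : Fin N → Vec d} {lam μ R : ℝ} (hlam : 0 < lam) (hμ : 0 ≤ μ)
    (hdev : ∀ z, ‖z‖ ≤ R → ∀ u, |hessForm g w z u - hessForm g v z u| ≤ μ * ‖u‖ ^ 2)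
    {D : Set (Vec d)} (hDR : ∀ x ∈ D, ‖x‖ ≤ R) (hD : D.Nontrivial) :
    relCondNumber D (regRisk ℓs v lam) (regRisk ℓt w (lam + μ)) ∈ Set.Icc 1 (1 + 2 * μ / lam) := by
  refine relCondNumber_mem_Icc (by positivity) hD (fun x _ y _ hxy => ?_) (fun x hx y hy => ?_)
    fun x hx y hy => ?_
  · have : 0 < ‖x - y‖ := norm_sub_pos_iff.2 hxy
    exact (by positivity : 0 < lam / 2 * ‖x - y‖ ^ 2).trans_le
      (half_mul_norm_sq_le_bregman_regRisk hs hs' hg v lam x y)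
  · rw [← one_mul (bregman (regRisk ℓt w (lam + μ)) x y)]
    refine bregman_regRisk_le_mul_bregman_regRisk ht ht' hs hs' (fun z hz u => ?_) (hDR x hx)
      (hDR y hy)
    linarith [(abs_le.1 (hdev z hz u)).1]
  · refine bregman_regRisk_le_mul_bregman_regRisk hs hs' ht ht' (fun z hz u => ?_) (hDR x hx)
      (hDR y hy)
    have hform : 0 ≤ 2 * μ / lam * hessForm g v z u :=
      mul_nonneg (by positivity) (hessForm_nonneg hg v z u)
    have hreg : 2 * μ / lam * (lam * ‖u‖ ^ 2) = 2 * (μ * ‖u‖ ^ 2) := by field_simp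
    linarith [(abs_le.1 (hdev z hz u)).2]

end Risk

section RateBound

variable {d : ℕ} {d₁ d₃ m δ : ℝ}

theorem devRate_nonneg (hd₃ : 0 ≤ d₃) (hm : 0 ≤ m) (hδ : 0 < δ) (hδ1 : δ ≤ 1) :
    0 ≤ devRate d d₁ d₃ m δ := by
  have : 0 ≤ Real.log (1 / δ) := Real.log_nonneg (by rwa [one_le_div hδ])
  have : 0 ≤ Real.log d := Real.log_natCast_nonneg d
  unfold devRate
  positivity

theorem devRate_le_log_sq_mul_max (hd₁ : 1 ≤ d₁) (hd₃ : 1 ≤ d₃) (hm : 1 ≤ m) (hδ : 0 < δ)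
    (hδ1 : δ ≤ 1) :
    devRate d d₁ d₃ m δ ≤ 3 * ((1 + Real.log d + Real.log m + Real.log (1 / δ)) ^ 2
      * max (√d₁ / √m) (√d₁ * d₃ / m)) := by
  have : 0 < m := by linarith
  have hlogδ : 0 ≤ Real.log (1 / δ) := Real.log_nonneg (by rwa [one_le_div hδ])
  have hlogd : 0 ≤ Real.log d := Real.log_natCast_nonneg d
  have hlogm : 0 ≤ Real.log m := Real.log_nonneg hm
  have hlog : Real.log (m / δ) = Real.log m + Real.log (1 / δ) := by
    rw [← Real.log_mul (by positivity) (by positivity), mul_one_div]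
  set l := Real.log (1 / δ)
  set Λ := 1 + Real.log d + Real.log m + l
  set X := max (√d₁ / √m) (√d₁ * d₃ / m)
  have hΛ : 1 ≤ Λ := by linarith
  have hΛsq : Λ ≤ Λ ^ 2 := le_self_pow₀ hΛ two_ne_zero
  have hsqrt : ∀ {t : ℝ}, t ≤ d₁ * Λ → √t ≤ √d₁ * Λ := fun {t} ht => by
    rw [Real.sqrt_le_left (by positivity), mul_pow, Real.sq_sqrt (by linarith)]
    exact ht.trans (by gcongr)
  have hbase : d₃ * Real.log d + l ≤ d₃ * Λ := by nlinarith
  have hfirst : (d₃ * Real.log d + l) * √(d₁ + Real.log (m / δ)) / m ≤ Λ ^ 2 * X :=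
    calc _ ≤ (d₃ * Λ) * (√d₁ * Λ) / m := by
          gcongr
          exact hsqrt (by nlinarith)
      _ = Λ ^ 2 * (√d₁ * d₃ / m) := by ring
      _ ≤ Λ ^ 2 * X := by
          gcongr
          exact le_max_right _ _
  have hsecond : (√l + √(d₁ * Real.log d)) / √m ≤ 2 * (Λ ^ 2 * X) :=
    calc _ ≤ (√d₁ * Λ + √d₁ * Λ) / √m := by
          gcongr
          · exact hsqrt (by nlinarith)
          · exact hsqrt (by gcongr; linarith)
      _ = 2 * (Λ * (√d₁ / √m)) := by ring
      _ ≤ 2 * (Λ ^ 2 * X) := by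
          gcongr
          exact le_max_left _ _
  unfold devRate
  linarith

end RateBound

theorem deriv_deriv_nonneg_of_convexOn {f : ℝ → ℝ} (hf : ConvexOn ℝ Set.univ f)
    (hd : Differentiable ℝ f) (t : ℝ) : 0 ≤ deriv (deriv f) t :=
  (monotoneOn_univ.1 (hf.monotoneOn_deriv fun x _ => hd x)).deriv_nonneg

section Model

variable {Ω : Type*} [MeasurableSpace Ω] {P : Measure Ω} {d n N : ℕ}
  {S : Matrix (Fin d) (Fin d) ℝ} {ℓ : ℝ → ℝ} {L : ℝ≥0} {ℓs : Fin n → ℝ → ℝ}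
  {a : Fin n → Ω → Vec d} {ℓt : Fin N → ℝ → ℝ} {b : Fin N → Ω → Vec d} {R δ : ℝ}

theorem IsEmpiricalRiskModel.hasDerivAt_deriv_losses (h : IsEmpiricalRiskModel P S ℓ L ℓs a)
    (j : Fin n) (t : ℝ) : HasDerivAt (deriv (ℓs j)) (deriv (deriv ℓ) t) t :=
  h.deriv2_losses j t ▸ (h.differentiable_deriv_losses j t).hasDerivAt

theorem IsEmpiricalRiskModel.deriv_deriv_loss_nonneg (h : IsEmpiricalRiskModel P S ℓ L ℓs a)
    (t : ℝ) : 0 ≤ deriv (deriv ℓ) t :=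
  deriv_deriv_nonneg_of_convexOn h.convex_loss h.differentiable_loss t

theorem measure_exists_devScale_mul_devRate_lt_abs_hessForm_sub_le [IsProbabilityMeasure P]
    (hd : 0 < d) (hn : 0 < n) (hN : 0 < N) (hS : S.PosDef) (ha : IsEmpiricalRiskModel P S ℓ L ℓs a)
    (hb : IsEmpiricalRiskModel P S ℓ L ℓt b) (hab : ∀ i j, IdentDistrib (b i) (a j) P P)
    (hR : 0 ≤ R) (hδ : 0 < δ) (hδ1 : δ < 1) (hdδ : 2 ≤ d ∨ δ ≤ 1 / 2) :
    P {ω | ∃ x u : Vec d, ‖x‖ ≤ R ∧ ‖u‖ ≤ 1 ∧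
      20000000 * devScale R (sigmaOne hS.isHermitian) L (deriv (deriv ℓ) 0)
        * devRate d (effDim hS.isHermitian 1) (effDim hS.isHermitian 3) (min (n : ℝ) N) δ
        < |hessForm (deriv (deriv ℓ)) (fun i => b i ω) x u
            - hessForm (deriv (deriv ℓ)) (fun j => a j ω) x u|} ≤ ENNReal.ofReal δ := by
  set g := deriv (deriv ℓ)
  set A := devScale R (sigmaOne hS.isHermitian) L (g 0)
  have hg0 : 0 ≤ g 0 := ha.deriv_deriv_loss_nonneg 0
  have : 0 ≤ A := devScale_nonneg hR (sigmaOne_pos hd hS).le L.coe_nonneg hg0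
  have hdev := (measure_union_le _ _).trans <| add_le_add
    (measure_exists_devScale_mul_devRate_lt_abs_sampleDev_hessTerm_le hd hn hS ha.measurable_sample
      ha.indep_sample (fun j => (ha.identDistrib_sample j ⟨0, hn⟩).map_eq) ha.subgaussian_sample
      ha.lipschitz_deriv2_loss hg0 hR hδ hδ1 hdδ)
    (measure_exists_devScale_mul_devRate_lt_abs_sampleDev_hessTerm_le hd hN hS hb.measurable_sample
      hb.indep_sample (fun i => (hab i ⟨0, hn⟩).map_eq) hb.subgaussian_sample
      hb.lipschitz_deriv2_loss hg0 hR hδ hδ1 hdδ)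
  rw [← ENNReal.ofReal_add (by positivity) (by positivity), add_halves] at hdev
  refine (measure_mono ?_).trans hdev
  rintro ω ⟨x, u, hx, hu, hlt⟩
  have hm : 1 ≤ min (n : ℝ) N := le_min (by exact_mod_cast hn) (by exact_mod_cast hN)
  have hrate : ∀ {k : ℝ}, min (n : ℝ) N ≤ k →
      devRate d (effDim hS.isHermitian 1) (effDim hS.isHermitian 3) k δ
        ≤ devRate d (effDim hS.isHermitian 1) (effDim hS.isHermitian 3) (min (n : ℝ) N) δ :=
    fun hk => devRate_antitone (one_le_effDim hd hS 1)
      (zero_le_one.trans (one_le_effDim hd hS 3)) hm hk hδ hδ1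
  have hA : 0 ≤ 10000000 * A := by positivity
  have hra := mul_le_mul_of_nonneg_left (hrate (min_le_left _ _)) hA
  have hrb := mul_le_mul_of_nonneg_left (hrate (min_le_right _ _)) hA
  by_contra hω
  simp only [Set.mem_union, Set.mem_ofPred_eq, not_or, not_exists, not_and, not_lt] at hω
  have hdecomp : hessForm g (fun i => b i ω) x u - hessForm g (fun j => a j ω) x u
      = sampleDev (P.map (a ⟨0, hn⟩)) (hessTerm g x u) (fun i => b i ω)
        - sampleDev (P.map (a ⟨0, hn⟩)) (hessTerm g x u) (fun j => a j ω) := by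
    simp only [hessForm, sampleDev]
    ring
  rw [hdecomp] at hlt
  linarith [abs_sub (sampleDev (P.map (a ⟨0, hn⟩)) (hessTerm g x u) (fun i => b i ω))
    (sampleDev (P.map (a ⟨0, hn⟩)) (hessTerm g x u) (fun j => a j ω)), hω.1 x u hx hu,
    hω.2 x u hx hu]

end Model

end StatPrecond

theorem mainTheorem7_general {Ω : Type*} [MeasurableSpace Ω] {P : Measure Ω}
    [IsProbabilityMeasure P] {d n N : ℕ} (hd : 1 ≤ d) (hn : 1 ≤ n) (hN : 1 ≤ N)
    {S : Matrix (Fin d) (Fin d) ℝ} (hS : S.PosDef) {ℓ : ℝ → ℝ} {L : ℝ≥0}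
    {ℓs : Fin n → ℝ → ℝ} {a : Fin n → Ω → StatPrecond.Vec d}
    {ℓt : Fin N → ℝ → ℝ} {b : Fin N → Ω → StatPrecond.Vec d}
    (ha : StatPrecond.IsEmpiricalRiskModel P S ℓ L ℓs a)
    (hb : StatPrecond.IsEmpiricalRiskModel P S ℓ L ℓt b)
    (hab : ∀ i j, IdentDistrib (b i) (a j) P P)
    {lam R δ : ℝ} (hlam : 0 < lam) (hR : 0 ≤ R) (hδ : 0 < δ) (hδ1 : δ < 1)
    (hdδ : 2 ≤ d ∨ δ ≤ 1 / 2) :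
    let m : ℝ := min (n : ℝ) (N : ℝ)
    let d₁ : ℝ := StatPrecond.effDim hS.isHermitian 1
    let d₃ : ℝ := StatPrecond.effDim hS.isHermitian 3
    let A : ℝ := StatPrecond.devScale R (StatPrecond.sigmaOne hS.isHermitian) L (deriv (deriv ℓ) 0)
    let μ : ℝ := 20000000 * A * StatPrecond.devRate d d₁ d₃ m δ
    let F : Ω → StatPrecond.Vec d → ℝ := fun ω => StatPrecond.regRisk ℓs (fun j => a j ω) lam
    let ft : Ω → StatPrecond.Vec d → ℝ := fun ω => StatPrecond.regRisk ℓt (fun i => b i ω) lam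
    let φ : Ω → StatPrecond.Vec d → ℝ := fun ω x => ft ω x + μ / 2 * ‖x‖ ^ 2
    P {ω | (∀ x, ‖x‖ ≤ R → ‖StatPrecond.hess (ft ω) x - StatPrecond.hess (F ω) x‖ ≤ μ) ∧
          ∀ D : Set (StatPrecond.Vec d), (∀ x ∈ D, ‖x‖ ≤ R) → D.Nontrivial →
            1 ≤ StatPrecond.relCondNumber D (F ω) (φ ω) ∧
            StatPrecond.relCondNumber D (F ω) (φ ω) ≤
              1 + 120000000 * (1 + Real.log d + Real.log m + Real.log (1 / δ)) ^ 2 *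
                (A / lam * max (√d₁ / √m) (√d₁ * d₃ / m))}ᶜ
      ≤ ENNReal.ofReal δ := by
  intro m d₁ d₃ A μ F ft φ
  have hm : 1 ≤ m := le_min (by exact_mod_cast hn) (by exact_mod_cast hN)
  have hd₁ : 1 ≤ d₁ := StatPrecond.one_le_effDim hd hS 1
  have hd₃ : 1 ≤ d₃ := StatPrecond.one_le_effDim hd hS 3
  have : 0 ≤ A := StatPrecond.devScale_nonneg hR (StatPrecond.sigmaOne_pos hd hS).le L.coe_nonneg
    (ha.deriv_deriv_loss_nonneg 0)
  have hμ : 0 ≤ μ := mul_nonneg (by positivity)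
    (StatPrecond.devRate_nonneg (zero_le_one.trans hd₃) (zero_le_one.trans hm) hδ hδ1.le)
  have hμ_le : 2 * μ / lam ≤ 120000000 * (1 + Real.log d + Real.log m + Real.log (1 / δ)) ^ 2 *
      (A / lam * max (√d₁ / √m) (√d₁ * d₃ / m)) :=
    calc 2 * μ / lam = 40000000 * (A / lam) * StatPrecond.devRate d d₁ d₃ m δ := by ring
      _ ≤ _ := mul_le_mul_of_nonneg_left
        (StatPrecond.devRate_le_log_sq_mul_max hd₁ hd₃ hm hδ hδ1.le) (by positivity)
      _ = _ := by ring
  refine (measure_mono (Set.compl_subset_comm.1 fun ω hω => ?_)).trans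
    (StatPrecond.measure_exists_devScale_mul_devRate_lt_abs_hessForm_sub_le hd hn hN hS ha hb hab
      hR hδ hδ1 hdδ)
  simp only [Set.mem_compl_iff, Set.mem_ofPred_eq, not_exists, not_and, not_lt] at hω
  have hdev := fun x hx => StatPrecond.abs_hessForm_sub_le_mul_norm_sq fun u => hω x u hx
  refine ⟨fun x hx => ?_, fun D hDR hD => ?_⟩
  · simp only [ft, F]
    rw [StatPrecond.hess_regRisk hb.differentiable_losses hb.hasDerivAt_deriv_losses,
      StatPrecond.hess_regRisk ha.differentiable_losses ha.hasDerivAt_deriv_losses]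
    exact StatPrecond.norm_riskHess_sub_le hμ (hdev x hx)
  · have hφ : φ ω = StatPrecond.regRisk ℓt (fun i => b i ω) (lam + μ) := by
      ext x
      simp only [φ, ft, StatPrecond.regRisk]
      ring
    have hκ := StatPrecond.relCondNumber_regRisk_mem_Icc ha.differentiable_losses
      ha.hasDerivAt_deriv_losses hb.differentiable_losses hb.hasDerivAt_deriv_losses
      ha.deriv_deriv_loss_nonneg hlam hμ hdev hDR hD
    rw [hφ]
    exact ⟨hκ.1, hκ.2.trans (by gcongr)⟩

theorem mainTheorem7 :
    ∃ C C' : ℝ, ∃ k : ℕ, 0 < C ∧ 0 < C' ∧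
      ∀ (Ω : Type*) [MeasurableSpace Ω] (P : Measure Ω) [IsProbabilityMeasure P]
        (d n N : ℕ) (_ : 1 ≤ d) (_ : 1 ≤ n) (_ : 1 ≤ N)
        (S : Matrix (Fin d) (Fin d) ℝ) (hS : S.PosDef)
        (ℓ : ℝ → ℝ) (L : ℝ≥0)
        (ℓs : Fin n → ℝ → ℝ) (a : Fin n → Ω → StatPrecond.Vec d)
        (ℓt : Fin N → ℝ → ℝ) (b : Fin N → Ω → StatPrecond.Vec d)
        (_ : StatPrecond.IsEmpiricalRiskModel P S ℓ L ℓs a)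
        (_ : StatPrecond.IsEmpiricalRiskModel P S ℓ L ℓt b)
        (_ : ∀ i j, IdentDistrib (b i) (a j) P P)
        (lam R δ : ℝ) (_ : 0 < lam) (_ : 0 ≤ R) (_ : 0 < δ) (_ : δ < 1)
        (_ : 2 ≤ d ∨ δ ≤ 1 / 2)
        (D : Set (StatPrecond.Vec d)) (ψ : StatPrecond.Vec d → ℝ) (_ : ConvexOn ℝ D ψ)
        (_ : ∀ x ∈ D, ‖x‖ ≤ R),
        let m : ℝ := min (n : ℝ) (N : ℝ)
        let d₁ : ℝ := StatPrecond.effDim hS.isHermitian 1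
        let d₃ : ℝ := StatPrecond.effDim hS.isHermitian 3
        let A : ℝ :=
          StatPrecond.devScale R (StatPrecond.sigmaOne hS.isHermitian) L (deriv (deriv ℓ) 0)
        let μ : ℝ := C * A * StatPrecond.devRate d d₁ d₃ m δ
        let F : Ω → StatPrecond.Vec d → ℝ :=
          fun ω => StatPrecond.regRisk ℓs (fun j => a j ω) lam
        let ft : Ω → StatPrecond.Vec d → ℝ :=
          fun ω => StatPrecond.regRisk ℓt (fun i => b i ω) lam
        let φ : Ω → StatPrecond.Vec d → ℝ := fun ω x => ft ω x + μ / 2 * ‖x‖ ^ 2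
        P {ω | (∀ x, ‖x‖ ≤ R →
                  ‖StatPrecond.hess (ft ω) x - StatPrecond.hess (F ω) x‖ ≤ μ) ∧
               (D.Nontrivial →
                  1 ≤ StatPrecond.relCondNumber D (F ω) (φ ω) ∧
                  StatPrecond.relCondNumber D (F ω) (φ ω) ≤
                    1 + C' * (1 + Real.log d + Real.log m + Real.log (1 / δ)) ^ k *
                      (A / lam * max (√d₁ / √m) (√d₁ * d₃ / m)))}ᶜ
          ≤ ENNReal.ofReal δ := by
  refine ⟨20000000, 120000000, 2, by norm_num, by norm_num, ?_⟩
  intro Ω _ P _ d n N hd hn hN S hS ℓ L ℓs a ℓt b ha hb hab lam R δ hlam hR hδ hδ1 hdδ D ψ _ hDR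
  refine (measure_mono ?_).trans
    (mainTheorem7_general hd hn hN hS ha hb hab hlam hR hδ hδ1 hdδ)
  exact Set.compl_subset_compl.2 fun ω hω => ⟨hω.1, hω.2 D hDR⟩
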